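/- Let $\Bbbk$ be a field and $0\le k\le n$. **The algebra.** An I-state is a $k$-element subset $\mathbf x=\{x_1<\dots<x_k\}$ of $\{0,\dots,n\}$; it is a left I-state if $n\notin\mathbf x$. Put $v_i^{\mathbf x}=|\mathbf x\cap\{i,\dots,n\}|$ and $g_i^{\mathbf x,\mathbf y,\mathbf z}=\tfrac12\big(|v_i^{\mathbf y}-v_i^{\mathbf z}|-|v_i^{\mathbf x}-v_i^{\mathbf z}|+|v_i^{\mathbf x}-v_i^{\mathbf y}|\big)$ for $1\le i\le n$. Let $\mathcal B_0(n,k)$ be the $\Bbbk[U_1,\dots,U_n]$-path algebra of the quiver with the I-states as vertices and one arrow $f_{\mathbf x,\mathbf y}$ for each pair, modulo $f_{\mathbf x,\mathbf y}f_{\mathbf y,\mathbf z}=\prod_iU_i^{g_i^{\mathbf x,\mathbf y,\mathbf z}}f_{\mathbf x,\mathbf z}$, where $\mathbf I_{\mathbf x}=f_{\mathbf x,\mathbf x}$ is the trivial path. Let $R_i$ be the sum of all $f_{\mathbf x,\mathbf y}$ with $\mathbf x\cap\{i-1,i\}=\{i-1\}$ and $\mathbf y=\mathbf x\setminus\{i-1\}\cup\{i\}$,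 and $L_i$ the sum of all $f_{\mathbf x,\mathbf y}$ with $\mathbf x\cap\{i-1,i\}=\{i\}$ and $\mathbf y=\mathbf x\setminus\{i\}\cup\{i-1\}$. Let $\mathcal B(n,k)$ be the quotient of $\mathcal B_0(n,k)$ by the ideal generated by all $R_{i-1}R_i$ and $L_iL_{i-1}$ ($2\le i\le n$) and all $U_i\mathbf I_{\mathbf x}$ with $\mathbf x\cap\{i-1,i\}=\varnothing$, and let $\mathcal B_l=\mathcal B_l^{\Bbbk}(n,k)=e\,\mathcal B(n,k)\,e$, where $e$ is the sum of the $\mathbf I_{\mathbf x}$ over the left I-states. It is graded by $\deg R_i=\deg L_i=1$, $\deg U_i=2$; that is, $f_{\mathbf x,\mathbf y}$ has degree $\sum_i|v_i^{\mathbf x}-v_i^{\mathbf y}|$. **Combinatorics.** I-states $\mathbf x,\mathbf y$ are too far if $|x_i-y_i|>1$ for some $i$. If they are not too far, a generating interval is an interval $[j+1,j+l]\subset[1,n]$, $l\ge1$, such that $j,j+l\notin\mathbf x\cap\mathbf y$, $j+1,\dots,j+l-1\in\mathbf x\cap\mathbf y$, and $v_m^{\mathbf x}=v_m^{\mathbf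 y}$ for $j+1\le m\le j+l$. Write $(m)_{q^2}=1+q^2+\dots+q^{2(m-1)}$ and $(m)_{q^2}^!=(m)_{q^2}\cdots(1)_{q^2}$. **Forms on the weight space.** Let $V=\mathbb C(q)\langle v_0,v_1\rangle$ be the vector representation of $U_q(\mathfrak{gl}(1|1))$, and let $(V^{\otimes n})_k$ be the weight space of weight $k\epsilon_1+(n-k)\epsilon_2$; the standard basis vectors with $k$ factors $v_0$ form its standard basis. The Ozsváth–Szabó form $(\,,)_{OSz}$ and Sartori's form $(\,,)_S$ are the bilinear forms on $(V^{\otimes n})_k$ with matrices $(1-q^2)^{-k}\cdot\mathrm{Id}$ and $(k)_{q^2}^!\cdot\mathrm{Id}$ in the standard basis. The canonical basis vector of a left I-state $\mathbf x$ is $v_{\mathbf x}^\diamondsuit=\ell_{x_k+1}\wedge\dots\wedge\ell_{x_1+1}$, where $\ell_1=e_1$ and $\ell_i=e_i+qe_{i-1}$ for $i\ge2$, and $e_{i_k}\wedge\dots\wedge e_{i_1}$ ($i_k>\dots>i_1$) is the standard basis vector with $v_0$ in the positions $i_1,\dots,i_k$ (terms with a repeated index vanish). **Grothendieck group.** Let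 $K_0^{\mathbb C(q)}(\mathcal B_l)=K_0(\mathcal B_l)\otimes_{\mathbb Z[q,q^{-1}]}\mathbb C(q)$, where $K_0(\mathcal B_l)$ is the Grothendieck group of finitely generated projective graded left $\mathcal B_l$-modules and $q$ acts by shifting degrees upwards by one; let $P(\mathbf x)=\mathcal B_l\mathbf I_{\mathbf x}$. Let $\psi$ be the anti-automorphism of $\mathcal B_l$ that exchanges $f_{\mathbf x,\mathbf y}$ and $f_{\mathbf y,\mathbf x}$ (hence $R_i$ and $L_i$ arrows) and fixes the $U_i$. For $P$ finitely generated projective graded let ${}^\vee P^{\psi}$ be the right module $\mathrm{Hom}_{\mathcal B_l}(P,\mathcal B_l)$, regarded as a left module through $\psi$. **Theorem.** 1. Let $\mathbf x,\mathbf y$ be left I-states. If they are too far, the graded dimension of $\mathbf I_{\mathbf x}\mathcal B_l\mathbf I_{\mathbf y}$ is $0$. Otherwise there are exactly $n-k$ generating intervals for $\mathbf x$ and $\mathbf y$, of lengths $l_1,\dots,l_{n-k}$ say; the space $\mathbf I_{\mathbf x}\mathcal B_l\mathbf I_{\mathbf y}$ is finite-dimensional in each degree, and its graded dimension is $$q^{d}\,\frac{\prod_{i=1}^{n-k}(l_i)_{q^2}}{(1-q^2)^k},\qquad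 d=\sum_{i=1}^k|x_i-y_i|.$$ 2. There is a unique $\mathbb C(q)$-bilinear form $[\,,]_{OSz}$ on $K_0^{\mathbb C(q)}(\mathcal B_l)$ such that $[[P],[P']]_{OSz}$ is the graded dimension of $\mathrm{Hom}_{\mathcal B_l}({}^\vee P^{\psi},P')$ for all finitely generated projective graded modules $P,P'$ (this space being finite-dimensional in each degree). There is a unique $\mathbb C(q)$-linear isomorphism $\Phi\colon K_0^{\mathbb C(q)}(\mathcal B_l)\to(V^{\otimes n})_k$ with $\Phi([P(\mathbf x)])=v_{\mathbf x}^\diamondsuit$ for every left I-state $\mathbf x$. The isomorphism $\Phi$ identifies $[\,,]_{OSz}$ with $(\,,)_{OSz}$: for all $\xi,\eta$, $$[\xi,\eta]_{OSz}=(\Phi\xi,\Phi\eta)_{OSz}.$$ 3. Sartori's form is $(k)_{q^2}^!(1-q^2)^k$ times the Ozsváth–Szabó form: on $(V^{\otimes n})_k$ one has $(\,,)_S=(k)_{q^2}^!(1-q^2)^k\,(\,,)_{OSz}$, and hence $(\Phi\xi,\Phi\eta)_S=(k)_{q^2}^!(1-q^2)^k\,[\xi,\eta]_{OSz}$ for all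 $\xi,\eta$. -/

import Mathlib

noncomputable section

open scoped TensorProduct

namespace OSz

universe u

/-! ### I-states -/

/-- I-states with `k` elements: the `k`-element subsets of `{0, 1, …, n}`. -/
def IState (n k : ℕ) : Type :=
  {x : Finset ℕ // x ∈ (Finset.range (n + 1)).powersetCard k}

instance (n k : ℕ) : Fintype (IState n k) :=
  inferInstanceAs (Fintype {x : Finset ℕ // x ∈ (Finset.range (n + 1)).powersetCard k})

instance (n k : ℕ) : DecidableEq (IState n k) :=
  inferInstanceAs (DecidableEq {x : Finset ℕ // x ∈ (Finset.range (n + 1)).powersetCard k})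

/-- Left I-states: the I-states `x` with `n ∉ x`. -/
def LeftIState (n k : ℕ) : Type := {x : IState n k // n ∉ x.1}

instance (n k : ℕ) : Fintype (LeftIState n k) :=
  inferInstanceAs (Fintype {x : IState n k // n ∉ x.1})

instance (n k : ℕ) : DecidableEq (LeftIState n k) :=
  inferInstanceAs (DecidableEq {x : IState n k // n ∉ x.1})

namespace IState

variable {n k : ℕ}

lemma card_eq (x : IState n k) : x.1.card = k := (Finset.mem_powersetCard.1 x.2).2

/-- The `i`-th element of an I-state `x = {x_1 < … < x_k}` (with `i` counted from `0`). -/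
def elt (x : IState n k) (i : Fin k) : ℕ := x.1.orderEmbOfFin x.card_eq i

/-- `v_m^x = |x ∩ {m, m + 1, …, n}|`, where `m = 1, …, n` is the number of a line. -/
def v (x : IState n k) (m : ℕ) : ℕ := (x.1 ∩ Finset.Icc m n).card

/-- `|v_m^x - v_m^y|`, that is, `2 w_m^{x,y}`. -/
def twoW (x y : IState n k) (m : ℕ) : ℕ := ((x.v m : ℤ) - y.v m).natAbs

/-- The exponent `g_m^{x,y,z} = w_m^{y,z} - w_m^{x,z} + w_m^{x,y}`.  It is a nonnegative integer:
the subtraction is never truncated and the division by two is exact. -/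
def g (x y z : IState n k) (m : ℕ) : ℕ := (y.twoW z m + x.twoW y m - x.twoW z m) / 2

/-- `x` and `y` are too far if `|x_i - y_i| > 1` for some `i`. -/
def TooFar (x y : IState n k) : Prop := ∃ i, 1 < ((x.elt i : ℤ) - y.elt i).natAbs

/-- `∑_i |x_i - y_i|`. -/
def dist (x y : IState n k) : ℕ := ∑ i, ((x.elt i : ℤ) - y.elt i).natAbs

/-- The pairs `(j, l)` such that `[j + 1, j + l]` is a generating interval for `x` and `y`: the
regions `j` and `j + l` are not fully used, the regions strictly between them are fully used, and
the lines `j + 1, …, j + l` are uncrossed. -/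
def genIntervals (x y : IState n k) : Finset (ℕ × ℕ) :=
  {G ∈ Finset.range n ×ˢ Finset.Icc 1 n | G.1 + G.2 ≤ n ∧
    G.1 ∉ x.1 ∩ y.1 ∧ G.1 + G.2 ∉ x.1 ∩ y.1 ∧
    (∀ m ∈ Finset.Ioo G.1 (G.1 + G.2), m ∈ x.1 ∩ y.1) ∧
    ∀ m ∈ Finset.Icc (G.1 + 1) (G.1 + G.2), x.v m = y.v m}

lemma two_g (x y z : IState n k) (m : ℕ) :
    2 * x.g y z m + x.twoW z m = x.twoW y m + y.twoW z m := by
  unfold g twoW; omega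

lemma g_symm (x y z : IState n k) (m : ℕ) : z.g y x m = x.g y z m := by
  unfold g twoW; omega

lemma twoW_self (x : IState n k) (m : ℕ) : x.twoW x m = 0 := by unfold twoW; omega

end IState

/-! ### The algebra `B(n, k)` -/

section Algebra

variable (K : Type u) [CommRing K] (n k : ℕ)

/-- The ground ring `K[U_1, …, U_n]`; the variable `U_{i+1}` is `MvPolynomial.X i`, `i : Fin n`. -/
abbrev URing : Type u := MvPolynomial (Fin n) K

/-- The path algebra relations of `B_0(n, k)`: the arrows are `f_{x,y}`, products of arrows that
are not composable vanish, the trivial path at `x` is `f_{x,x}`, and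
`f_{x,y} f_{y,z} = ∏ U_i ^ {g_i^{x,y,z}} f_{x,z}`. -/
inductive Rel0 : FreeAlgebra (URing K n) (IState n k × IState n k) →
    FreeAlgebra (URing K n) (IState n k × IState n k) → Prop
  | comp (x y z : IState n k) : Rel0
      (FreeAlgebra.ι (URing K n) (x, y) * FreeAlgebra.ι (URing K n) (y, z))
      ((∏ i : Fin n, (MvPolynomial.X i : URing K n) ^ x.g y z (i + 1)) •
        FreeAlgebra.ι (URing K n) (x, z))
  | not_comp (x y y' z : IState n k) (h : y ≠ y') : Rel0
      (FreeAlgebra.ι (URing K n) (x, y) * FreeAlgebra.ι (URing K n) (y', z)) 0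
  | one : Rel0 (∑ x : IState n k, FreeAlgebra.ι (URing K n) (x, x)) 1

/-- The algebra `B_0(n, k)` over `K[U_1, …, U_n]`.  The integral version is the case `K = ℤ`; for a
field `K`, the given presentation is that of `B_0(n, k) ⊗ K`. -/
def B0 : Type u := RingQuot (Rel0 K n k)

instance : Ring (B0 K n k) := inferInstanceAs (Ring (RingQuot (Rel0 K n k)))

instance : Algebra (URing K n) (B0 K n k) :=
  inferInstanceAs (Algebra (URing K n) (RingQuot (Rel0 K n k)))

variable {n k}

/-- The arrow `f_{x,y}` of `B_0(n, k)`. -/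
def f0 (x y : IState n k) : B0 K n k :=
  RingQuot.mkAlgHom (URing K n) (Rel0 K n k) (FreeAlgebra.ι (URing K n) (x, y))

/-- `(x, y)` are the ends of an `R_i` arrow: `x ∩ {i - 1, i} = {i - 1}` and
`y = x \ {i - 1} ∪ {i}`. -/
def RArrow (i : ℕ) (x y : IState n k) : Prop :=
  x.1 ∩ {i - 1, i} = {i - 1} ∧ y.1 = (x.1 \ {i - 1}) ∪ {i}

/-- `(x, y)` are the ends of an `L_i` arrow: `x ∩ {i - 1, i} = {i}` and
`y = x \ {i} ∪ {i - 1}`. -/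
def LArrow (i : ℕ) (x y : IState n k) : Prop :=
  x.1 ∩ {i - 1, i} = {i} ∧ y.1 = (x.1 \ {i}) ∪ {i - 1}

instance (i : ℕ) (x y : IState n k) : Decidable (RArrow i x y) := by
  unfold RArrow; infer_instance

instance (i : ℕ) (x y : IState n k) : Decidable (LArrow i x y) := by
  unfold LArrow; infer_instance

variable (n k)

/-- `R_i`, the sum of the `f_{x,y}` over all `R_i` arrows. -/
def Rgen (i : ℕ) : B0 K n k :=
  ∑ x : IState n k, ∑ y : IState n k, if RArrow i x y then f0 K x y else 0

/-- `L_i`, the sum of the `f_{x,y}` over all `L_i` arrows. -/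
def Lgen (i : ℕ) : B0 K n k :=
  ∑ x : IState n k, ∑ y : IState n k, if LArrow i x y then f0 K x y else 0

/-- The relations that define `B(n, k)` as a quotient of `B_0(n, k)`. -/
inductive Rel : B0 K n k → B0 K n k → Prop
  | RR (i : ℕ) (h2 : 2 ≤ i) (hn : i ≤ n) : Rel (Rgen K n k (i - 1) * Rgen K n k i) 0
  | LL (i : ℕ) (h2 : 2 ≤ i) (hn : i ≤ n) : Rel (Lgen K n k i * Lgen K n k (i - 1)) 0
  | U (i : Fin n) (x : IState n k) (hx : x.1 ∩ {(i : ℕ), (i : ℕ) + 1} = ∅) :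
      Rel ((MvPolynomial.X i : URing K n) • f0 K x x) 0

/-- The algebra `B(n, k)`. -/
def B : Type u := RingQuot (Rel K n k)

instance : Ring (B K n k) := inferInstanceAs (Ring (RingQuot (Rel K n k)))

instance : Algebra (URing K n) (B K n k) :=
  inferInstanceAs (Algebra (URing K n) (RingQuot (Rel K n k)))

instance : Algebra K (B K n k) := Algebra.compHom _ (algebraMap K (URing K n))

instance : IsScalarTower K (URing K n) (B K n k) :=
  IsScalarTower.of_algebraMap_eq (fun _ => rfl)

variable {n k}

/-- The element `f_{x,y}` of `B(n, k)`. -/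
def f (x y : IState n k) : B K n k := RingQuot.mkAlgHom (URing K n) (Rel K n k) (f0 K x y)

variable {K}

lemma f0_comp (x y z : IState n k) : f0 K x y * f0 K y z =
    (∏ i : Fin n, (MvPolynomial.X i : URing K n) ^ x.g y z (i + 1)) • f0 K x z := by
  have := RingQuot.mkAlgHom_rel (URing K n) (Rel0.comp (K := K) x y z)
  rw [map_mul, map_smul] at this
  exact this

lemma f0_not_comp (x y y' z : IState n k) (h : y ≠ y') : f0 K x y * f0 K y' z = 0 := by
  have := RingQuot.mkAlgHom_rel (URing K n) (Rel0.not_comp (K := K) x y y' z h)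
  rw [map_mul, map_zero] at this
  exact this

lemma f0_one : ∑ x : IState n k, f0 K x x = 1 := by
  have := RingQuot.mkAlgHom_rel (URing K n) (Rel0.one (K := K) (n := n) (k := k))
  rw [map_sum, map_one] at this
  exact this

lemma f_comp (x y z : IState n k) : f K x y * f K y z =
    (∏ i : Fin n, (MvPolynomial.X i : URing K n) ^ x.g y z (i + 1)) • f K x z := by
  have := congrArg (RingQuot.mkAlgHom (URing K n) (Rel K n k)) (f0_comp (K := K) x y z)
  rw [map_mul, map_smul] at this
  exact this

lemma f_not_comp (x y y' z : IState n k) (h : y ≠ y') : f K x y * f K y' z = 0 := by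
  have := congrArg (RingQuot.mkAlgHom (URing K n) (Rel K n k)) (f0_not_comp (K := K) x y y' z h)
  rw [map_mul, map_zero] at this
  exact this

lemma f_one : ∑ x : IState n k, f K x x = 1 := by
  have := congrArg (RingQuot.mkAlgHom (URing K n) (Rel K n k)) (f0_one (K := K) (n := n) (k := k))
  rw [map_sum, map_one] at this
  exact this

lemma f_idem (x : IState n k) : f K x x * f K x x = f K x x := by
  rw [f_comp]
  have : ∀ m, x.g x x m = 0 := fun m => by
    have := x.two_g x x m
    simp only [IState.twoW_self] at this; omega
  simp [this]

/-- Algebra maps out of `B(n, k)`. -/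
def liftB {T : Type*} [Ring T] [Algebra (URing K n) T] (F : IState n k → IState n k → T)
    (h1 : ∀ x y z, F x y * F y z =
      (∏ i : Fin n, (MvPolynomial.X i : URing K n) ^ x.g y z (i + 1)) • F x z)
    (h2 : ∀ x y y' z, y ≠ y' → F x y * F y' z = 0)
    (h3 : ∑ x, F x x = 1)
    (h4 : ∀ φ : B0 K n k →ₐ[URing K n] T, (∀ x y, φ (f0 K x y) = F x y) →
      ∀ a b, Rel K n k a b → φ a = φ b) : B K n k →ₐ[URing K n] T :=
  let φ : B0 K n k →ₐ[URing K n] T := RingQuot.liftAlgHom (URing K n)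
    ⟨FreeAlgebra.lift (URing K n) (fun p => F p.1 p.2), by
      intro a b hab
      cases hab with
      | comp x y z => simpa using h1 x y z
      | not_comp x y y' z h => simpa using h2 x y y' z h
      | one => simpa using h3⟩
  RingQuot.liftAlgHom (URing K n) ⟨φ, fun a b hab => h4 φ (fun x y => by
    simp only [φ, f0]
    erw [RingQuot.liftAlgHom_mkAlgHom_apply]
    simp) a b hab⟩

lemma liftB_f {T : Type*} [Ring T] [Algebra (URing K n) T] (F : IState n k → IState n k → T)
    (h1 h2 h3 h4) (x y : IState n k) : liftB (K := K) F h1 h2 h3 h4 (f K x y) = F x y := by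
  simp only [liftB, f]
  erw [RingQuot.liftAlgHom_mkAlgHom_apply]
  simp only [f0]
  erw [RingQuot.liftAlgHom_mkAlgHom_apply]
  simp


lemma f_left (x y : IState n k) : f K x x * f K x y = f K x y := by
  rw [f_comp]
  have : ∀ m, x.g x y m = 0 := fun m => by
    have := x.two_g x y m
    simp only [IState.twoW_self] at this; omega
  simp [this]

lemma f_right (x y : IState n k) : f K x y * f K y y = f K x y := by
  rw [f_comp]
  have : ∀ m, x.g y y m = 0 := fun m => by
    have := x.two_g y y m
    simp only [IState.twoW_self] at this; omega
  simp [this]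

lemma arrow_symm (i : ℕ) (hi : 1 ≤ i) (x y : IState n k) : RArrow i x y ↔ LArrow i y x := by
  obtain ⟨x, hx⟩ := x
  obtain ⟨y, hy⟩ := y
  simp only [RArrow, LArrow]
  have hne : i - 1 ≠ i := by omega
  constructor
  · rintro ⟨h1, h2⟩
    have a1 : i - 1 ∈ x := by
      have : i - 1 ∈ x ∩ {i - 1, i} := by rw [h1]; simp
      exact (Finset.mem_inter.1 this).1
    have a2 : i ∉ x := fun h => by
      have : i ∈ x ∩ {i - 1, i} := by simp [h]
      rw [h1] at this
      exact hne (Finset.mem_singleton.1 this).symm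
    subst h2
    constructor
    · ext a; simp only [Finset.mem_inter, Finset.mem_union, Finset.mem_sdiff, Finset.mem_singleton,
        Finset.mem_insert]; grind
    · ext a; simp only [Finset.mem_union, Finset.mem_sdiff, Finset.mem_singleton]; grind
  · rintro ⟨h1, h2⟩
    have a1 : i ∈ y := by
      have : i ∈ y ∩ {i - 1, i} := by rw [h1]; simp
      exact (Finset.mem_inter.1 this).1
    have a2 : i - 1 ∉ y := fun h => by
      have : i - 1 ∈ y ∩ {i - 1, i} := by simp [h]
      rw [h1] at this
      exact hne (Finset.mem_singleton.1 this)
    subst h2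
    constructor
    · ext a; simp only [Finset.mem_inter, Finset.mem_union, Finset.mem_sdiff, Finset.mem_singleton,
        Finset.mem_insert]; grind
    · ext a; simp only [Finset.mem_union, Finset.mem_sdiff, Finset.mem_singleton]; grind

lemma sum_arrow {T : Type*} [Ring T] (F : IState n k → IState n k → T)
    (h2 : ∀ x y y' z, y ≠ y' → F x y * F y' z = 0) (h3 : ∀ x y, F x x * F x y = F x y)
    (P : IState n k → IState n k → Prop) [∀ x y, Decidable (P x y)]
    (hP : ∀ x y y', P x y → P x y' → y = y') {x y : IState n k} (h : P x y) :
    F x x * (∑ x', ∑ y', if P x' y' then F x' y' else 0) = F x y := by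
  rw [Finset.mul_sum, Finset.sum_eq_single x, Finset.mul_sum, Finset.sum_eq_single y]
  · rw [if_pos h, h3]
  · intro b _ hb
    rw [if_neg (fun h' => hb (hP _ _ _ h' h)), mul_zero]
  · simp
  · intro b _ hb
    rw [Finset.mul_sum]
    refine Finset.sum_eq_zero fun c _ => ?_
    split_ifs
    · exact h2 _ _ _ _ hb.symm
    · simp
  · simp

lemma f_arrow_zero (P Q : IState n k → IState n k → Prop) [∀ x y, Decidable (P x y)]
    [∀ x y, Decidable (Q x y)]
    (hP : ∀ x y y', P x y → P x y' → y = y') (hQ : ∀ x y y', Q x y → Q x y' → y = y')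
    (h0 : (∑ x', ∑ y', if P x' y' then f K x' y' else 0) *
      (∑ x', ∑ y', if Q x' y' then f K x' y' else 0) = 0)
    {x y z : IState n k} (hx : P x y) (hy : Q y z) : f K x y * f K y z = 0 := by
  have h := congrArg (f K x x * ·) h0
  simp only [← mul_assoc, mul_zero] at h
  rw [sum_arrow (f K) f_not_comp f_left P hP hx, ← f_right, mul_assoc,
    sum_arrow (f K) f_not_comp f_left Q hQ hy] at h
  exact h

lemma RArrow_unique (i : ℕ) (x y y' : IState n k) (h : RArrow i x y) (h' : RArrow i x y') :
    y = y' := Subtype.ext (h.2.trans h'.2.symm)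

lemma LArrow_unique (i : ℕ) (x y y' : IState n k) (h : LArrow i x y) (h' : LArrow i x y') :
    y = y' := Subtype.ext (h.2.trans h'.2.symm)

lemma map_Rgen {T : Type*} [Ring T] [Algebra (URing K n) T] (φ : B0 K n k →ₐ[URing K n] T)
    (i : ℕ) : φ (Rgen K n k i) = ∑ x, ∑ y, if RArrow i x y then φ (f0 K x y) else 0 := by
  simp only [Rgen, map_sum, apply_ite φ, map_zero]

lemma map_Lgen {T : Type*} [Ring T] [Algebra (URing K n) T] (φ : B0 K n k →ₐ[URing K n] T)
    (i : ℕ) : φ (Lgen K n k i) = ∑ x, ∑ y, if LArrow i x y then φ (f0 K x y) else 0 := by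
  simp only [Lgen, map_sum, apply_ite φ, map_zero]

lemma f_RR (i : ℕ) (h2 : 2 ≤ i) (hn : i ≤ n) {x y z : IState n k} (hx : RArrow (i - 1) x y)
    (hy : RArrow i y z) : f K x y * f K y z = 0 := by
  refine f_arrow_zero _ _ (RArrow_unique _) (RArrow_unique _) ?_ hx hy
  have := RingQuot.mkAlgHom_rel (URing K n) (Rel.RR (K := K) (k := k) i h2 hn)
  rw [map_mul, map_zero] at this
  erw [map_Rgen (RingQuot.mkAlgHom (URing K n) (Rel K n k)),
    map_Rgen (RingQuot.mkAlgHom (URing K n) (Rel K n k))] at this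
  exact this

lemma f_LL (i : ℕ) (h2 : 2 ≤ i) (hn : i ≤ n) {x y z : IState n k} (hx : LArrow i x y)
    (hy : LArrow (i - 1) y z) : f K x y * f K y z = 0 := by
  refine f_arrow_zero _ _ (LArrow_unique _) (LArrow_unique _) ?_ hx hy
  have := RingQuot.mkAlgHom_rel (URing K n) (Rel.LL (K := K) (k := k) i h2 hn)
  rw [map_mul, map_zero] at this
  erw [map_Lgen (RingQuot.mkAlgHom (URing K n) (Rel K n k)),
    map_Lgen (RingQuot.mkAlgHom (URing K n) (Rel K n k))] at this
  exact this

lemma f_U (i : Fin n) (x : IState n k) (hx : x.1 ∩ {(i : ℕ), (i : ℕ) + 1} = ∅) :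
    (MvPolynomial.X i : URing K n) • f K x x = 0 := by
  have := RingQuot.mkAlgHom_rel (URing K n) (Rel.U (K := K) i x hx)
  rw [map_smul, map_zero] at this
  exact this

lemma arrow_mul_zero {T : Type*} [Ring T] (F : IState n k → IState n k → T)
    (h2 : ∀ x y y' z, y ≠ y' → F x y * F y' z = 0)
    (P Q : IState n k → IState n k → Prop) [∀ x y, Decidable (P x y)] [∀ x y, Decidable (Q x y)]
    (h : ∀ x y z, P x y → Q y z → F x y * F y z = 0) :
    (∑ x', ∑ y', if P x' y' then F x' y' else 0) *
      (∑ x', ∑ y', if Q x' y' then F x' y' else 0) = 0 := by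
  simp only [Finset.sum_mul, Finset.mul_sum]
  refine Finset.sum_eq_zero fun a _ => Finset.sum_eq_zero fun b _ =>
    Finset.sum_eq_zero fun c _ => Finset.sum_eq_zero fun d _ => ?_
  split_ifs with h1 h3
  · by_cases e : d = a
    · subst e; exact h _ _ _ ‹_› ‹_›
    · exact h2 _ _ _ _ e
  all_goals simp

/-- Algebra maps out of `B(n, k)`, with the relations checked on arrows. -/
def liftB' {T : Type*} [Ring T] [Algebra (URing K n) T] (F : IState n k → IState n k → T)
    (h1 : ∀ x y z, F x y * F y z =
      (∏ i : Fin n, (MvPolynomial.X i : URing K n) ^ x.g y z (i + 1)) • F x z)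
    (h2 : ∀ x y y' z, y ≠ y' → F x y * F y' z = 0)
    (h3 : ∑ x, F x x = 1)
    (hR : ∀ i, 2 ≤ i → i ≤ n → ∀ x y z, RArrow (i - 1) x y → RArrow i y z → F x y * F y z = 0)
    (hL : ∀ i, 2 ≤ i → i ≤ n → ∀ x y z, LArrow i x y → LArrow (i - 1) y z → F x y * F y z = 0)
    (hU : ∀ (i : Fin n) (x : IState n k), x.1 ∩ {(i : ℕ), (i : ℕ) + 1} = ∅ →
      (MvPolynomial.X i : URing K n) • F x x = 0) : B K n k →ₐ[URing K n] T :=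
  liftB F h1 h2 h3 (by
    intro φ hφ a b hab
    cases hab with
    | RR i hi hn =>
      rw [map_mul, map_zero, map_Rgen, map_Rgen]
      simp only [hφ]
      exact arrow_mul_zero F h2 _ _ (hR i hi hn)
    | LL i hi hn =>
      rw [map_mul, map_zero, map_Lgen, map_Lgen]
      simp only [hφ]
      exact arrow_mul_zero F h2 _ _ (hL i hi hn)
    | U i x hx => rw [map_smul, map_zero, hφ]; exact hU i x hx)

lemma liftB'_f {T : Type*} [Ring T] [Algebra (URing K n) T] (F : IState n k → IState n k → T)
    (h1 h2 h3 hR hL hU) (x y : IState n k) :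
    liftB' (K := K) F h1 h2 h3 hR hL hU (f K x y) = F x y := liftB_f _ _ _ _ _ _ _

variable (K n k) in
/-- The anti-automorphism of `B(n, k)`: it is `K[U_1, …, U_n]`-linear and exchanges `f_{x,y}` and
`f_{y,x}`; in particular it exchanges `R_i` and `L_i` and fixes the idempotents. -/
def psiB : B K n k →ₐ[URing K n] (B K n k)ᵐᵒᵖ :=
  liftB' (fun x y => MulOpposite.op (f K y x))
    (fun x y z => by
      rw [← MulOpposite.op_mul, f_comp, ← MulOpposite.op_smul]
      simp only [IState.g_symm])
    (fun x y y' z h => by rw [← MulOpposite.op_mul, f_not_comp _ _ _ _ h.symm, MulOpposite.op_zero])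
    (by rw [← Finset.op_sum, f_one, MulOpposite.op_one])
    (fun i hi hn x y z hx hy => by
      rw [arrow_symm _ (by omega)] at hx hy
      rw [← MulOpposite.op_mul, f_LL i hi hn hy hx, MulOpposite.op_zero])
    (fun i hi hn x y z hx hy => by
      rw [← arrow_symm _ (by omega)] at hx hy
      rw [← MulOpposite.op_mul, f_RR i hi hn hy hx, MulOpposite.op_zero])
    (fun i x hx => by rw [← MulOpposite.op_smul, f_U i x hx, MulOpposite.op_zero])

lemma psiB_f (x y : IState n k) : psiB K n k (f K x y) = MulOpposite.op (f K y x) :=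
  liftB'_f _ _ _ _ _ _ _ _ _

/-! ### The grading of `B(n, k)` -/

/-- The degree of `f_{x,y}`, namely `∑_i 2 w_i^{x,y}`; it is `1` for `R_i` and `L_i` arrows. -/
def IState.deg (x y : IState n k) : ℕ := ∑ i : Fin n, x.twoW y (i + 1)

/-- A monomial in the variables `U_1, …, U_n`. -/
def Umon (K : Type u) [CommRing K] {n : ℕ} (m : Fin n → ℕ) : URing K n :=
  ∏ i, MvPolynomial.X i ^ m i

variable (K n k) in
/-- The degree `d` part of `B(n, k)` for the grading `deg^q`, in which `R_i` and `L_i` have degree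
`1` and `U_i` has degree `2`. -/
def grB (d : ℤ) : Submodule K (B K n k) :=
  Submodule.span K {b | ∃ (m : Fin n → ℕ) (x y : IState n k),
    ((2 * ∑ i, m i + x.deg y : ℕ) : ℤ) = d ∧ b = Umon K m • f K x y}

lemma Umon_mul (m m' : Fin n → ℕ) : Umon K m * Umon K m' = Umon K (m + m') := by
  simp [Umon, pow_add, Finset.prod_mul_distrib]

lemma f_comp' (x y z : IState n k) : f K x y * f K y z =
    Umon K (fun i : Fin n => x.g y z (i + 1)) • f K x z := f_comp x y z

lemma deg_add (x y z : IState n k) :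
    2 * (∑ i : Fin n, x.g y z (i + 1)) + x.deg z = x.deg y + y.deg z := by
  simp only [IState.deg, Finset.mul_sum, ← Finset.sum_add_distrib, IState.two_g]

lemma deg_self (x : IState n k) : x.deg x = 0 := by
  simp [IState.deg, IState.twoW_self]

lemma Umon_smul_f_mem_grB (m : Fin n → ℕ) (x y : IState n k) :
    Umon K m • f K x y ∈ grB K n k ((2 * ∑ i, m i + x.deg y : ℕ) : ℤ) :=
  Submodule.subset_span ⟨m, x, y, rfl, rfl⟩

lemma grB_mul {i j : ℤ} {a b : B K n k} (ha : a ∈ grB K n k i) (hb : b ∈ grB K n k j) :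
    a * b ∈ grB K n k (i + j) := by
  have key : ∀ a ∈ grB K n k i, ∀ b ∈ grB K n k j, a * b ∈ grB K n k (i + j) := by
    intro a ha
    induction ha using Submodule.span_induction with
    | mem a ha =>
      obtain ⟨m, x, y, hd, rfl⟩ := ha
      intro b hb
      induction hb using Submodule.span_induction with
      | mem b hb =>
        obtain ⟨m', x', y', hd', rfl⟩ := hb
        rw [smul_mul_assoc, mul_smul_comm]
        by_cases h : y = x'
        · subst h
          rw [f_comp', smul_smul, smul_smul, Umon_mul, Umon_mul, add_assoc]
          have := Umon_smul_f_mem_grB (K := K) (m + (m' + fun i : Fin n => x.g y y' (i + 1))) x y'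
          have e := deg_add x y y'
          convert this using 1
          rw [← hd, ← hd', ← Nat.cast_add]
          congr 1
          simp only [Pi.add_apply, Finset.sum_add_distrib]
          omega
        · rw [f_not_comp _ _ _ _ h]; simp
      | zero => simp
      | add b b' _ _ h h' => rw [mul_add]; exact add_mem h h'
      | smul c b _ h => rw [mul_smul_comm]; exact Submodule.smul_mem _ _ h
    | zero => simp
    | add a a' _ _ h h' => intro b hb; rw [add_mul]; exact add_mem (h b hb) (h' b hb)
    | smul c a _ h => intro b hb; rw [smul_mul_assoc]; exact Submodule.smul_mem _ _ (h b hb)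
  exact key a ha b hb

lemma f_self_mem_grB (x : IState n k) : f K x x ∈ grB K n k 0 := by
  have := Umon_smul_f_mem_grB (K := K) 0 x x
  simpa [deg_self, Umon] using this

lemma iSup_grB : ⨆ d, grB K n k d = ⊤ := by
  set W := ⨆ d, grB K n k d with hW
  have hle : ∀ d, grB K n k d ≤ W := fun d => le_iSup _ d
  have hind : ∀ (p : B K n k → Prop), (∀ (m : Fin n → ℕ) (x y : IState n k), p (Umon K m • f K x y)) → p 0 →
      (∀ a b, p a → p b → p (a + b)) → (∀ (c : K) a, p a → p (c • a)) → ∀ w ∈ W, p w := by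
    intro p h1 h0 ha hs w hw
    induction hw using Submodule.iSup_induction' with
    | mem i x hx =>
      induction hx using Submodule.span_induction with
      | mem b hb => obtain ⟨m, x, y, -, rfl⟩ := hb; exact h1 _ _ _
      | zero => exact h0
      | add b b' _ _ h h' => exact ha _ _ h h'
      | smul c b _ h => exact hs _ _ h
    | zero => exact h0
    | add x y _ _ h h' => exact ha _ _ h h'
  have hU : ∀ (r : URing K n) (w), w ∈ W → r • w ∈ W := by
    intro r w hw
    refine hind (fun w => r • w ∈ W) ?_ (by simp) (fun a b h h' => by
      rw [smul_add]; exact add_mem h h') (fun c a h => by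
      rw [smul_comm]; exact Submodule.smul_mem _ _ h) w hw
    intro m x y
    induction r using MvPolynomial.induction_on' with
    | monomial e c =>
      have : MvPolynomial.monomial e c = c • Umon K (fun i => e i) := by
        rw [MvPolynomial.monomial_eq, Finsupp.prod_fintype _ _ (fun _ => pow_zero _),
          MvPolynomial.smul_eq_C_mul]; rfl
      rw [this, smul_assoc, smul_smul, Umon_mul]
      exact Submodule.smul_mem _ _ (hle _ (Umon_smul_f_mem_grB _ _ _))
    | add p q hp hq => rw [add_smul]; exact add_mem hp hq
  have hf : ∀ x y : IState n k, ∀ w ∈ W, f K x y * w ∈ W := by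
    intro x y
    refine hind _ ?_ (by simp) (fun a b h h' => by rw [mul_add]; exact add_mem h h')
      (fun c a h => by rw [mul_smul_comm]; exact Submodule.smul_mem _ _ h)
    intro m x' y'
    rw [mul_smul_comm]
    refine hU _ _ ?_
    by_cases h : y = x'
    · subst h
      rw [f_comp']
      exact hle _ (Umon_smul_f_mem_grB _ _ _)
    · rw [f_not_comp _ _ _ _ h]; simp
  have h1 : (1 : B K n k) ∈ W := by
    rw [← f_one]
    exact sum_mem fun x _ => hle _ (f_self_mem_grB x)
  rw [eq_top_iff]
  rintro b -
  obtain ⟨a, rfl⟩ := RingQuot.mkAlgHom_surjective (URing K n) (Rel K n k) b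
  obtain ⟨a, rfl⟩ := RingQuot.mkAlgHom_surjective (URing K n) (Rel0 K n k) a
  let Φ : FreeAlgebra (URing K n) (IState n k × IState n k) →ₐ[URing K n] B K n k :=
    (RingQuot.mkAlgHom (URing K n) (Rel K n k)).comp (RingQuot.mkAlgHom (URing K n) (Rel0 K n k))
  have key : ∀ w ∈ W, Φ a * w ∈ W := by
    induction a using FreeAlgebra.induction with
    | grade0 r => intro w hw; rw [AlgHom.commutes, ← Algebra.smul_def]; exact hU _ _ hw
    | grade1 p => exact hf p.1 p.2
    | mul a b ha hb => intro w hw; rw [map_mul, mul_assoc]; exact ha _ (hb _ hw)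
    | add a b ha hb => intro w hw; rw [map_add, add_mul]; exact add_mem (ha _ hw) (hb _ hw)
  have := key 1 h1
  rw [mul_one] at this
  exact this

/-- The auxiliary ring homomorphism that records degrees in `K[U_1, …, U_n]`. -/
def tau (K : Type u) [CommRing K] (n : ℕ) : URing K n →+* Polynomial (URing K n) :=
  MvPolynomial.eval₂Hom (Polynomial.C.comp MvPolynomial.C)
    (fun i => Polynomial.C (MvPolynomial.X i) * Polynomial.X ^ 2)

lemma tau_Umon (m : Fin n → ℕ) :
    tau K n (Umon K m) = Polynomial.monomial (2 * ∑ i, m i) (Umon K m) := by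
  simp only [tau, Umon, map_prod, map_pow, MvPolynomial.coe_eval₂Hom,
    MvPolynomial.eval₂_X, mul_pow, Finset.prod_mul_distrib]
  rw [← Polynomial.C_mul_X_pow_eq_monomial]
  simp only [← pow_mul, Finset.prod_pow_eq_pow_sum, Finset.mul_sum, map_prod, map_pow]

variable (K n k) in
/-- Polynomials over `B(n, k)`, with the `K[U_1, …, U_n]`-algebra structure for which `U_i` acts as
multiplication by `U_i X ^ 2`. -/
def Tw : Type u := Polynomial (B K n k)

instance : Ring (Tw K n k) := inferInstanceAs (Ring (Polynomial (B K n k)))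

lemma map_comm (z : Polynomial (URing K n)) (q : Polynomial (B K n k)) :
    Polynomial.mapRingHom (algebraMap (URing K n) (B K n k)) z * q =
      q * Polynomial.mapRingHom (algebraMap (URing K n) (B K n k)) z := by
  induction z using Polynomial.induction_on' with
  | add p r hp hr => rw [map_add, add_mul, mul_add, hp, hr]
  | monomial i a =>
    rw [Polynomial.coe_mapRingHom, Polynomial.map_monomial, ← Polynomial.C_mul_X_pow_eq_monomial,
      mul_assoc, Polynomial.X_pow_mul, ← mul_assoc, ← mul_assoc]
    congr 1
    exact Algebra.commutes (A := Polynomial (B K n k)) a q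

instance : Algebra (URing K n) (Tw K n k) :=
  RingHom.toAlgebra' ((Polynomial.mapRingHom (algebraMap (URing K n) (B K n k))).comp (tau K n))
    (fun _ _ => map_comm _ _)

/-- An element of `B(n, k)` placed in degree `d`. -/
def twMon (d : ℕ) (b : B K n k) : Tw K n k := Polynomial.monomial d b

lemma twMon_mul (d e : ℕ) (a b : B K n k) : twMon d a * twMon e b = twMon (d + e) (a * b) :=
  Polynomial.monomial_mul_monomial _ _ _ _

lemma twMon_zero (d : ℕ) : twMon d (0 : B K n k) = 0 := Polynomial.monomial_zero_right d

lemma Umon_smul_twMon (m : Fin n → ℕ) (d : ℕ) (b : B K n k) :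
    Umon K m • twMon d b = twMon (2 * ∑ i, m i + d) (Umon K m • b) := by
  rw [Algebra.smul_def, Algebra.smul_def, ← twMon_mul]
  congr 1
  change Polynomial.mapRingHom _ (tau K n (Umon K m)) = _
  rw [tau_Umon, Polynomial.coe_mapRingHom, Polynomial.map_monomial]
  rfl

variable (K n k) in
/-- The ring homomorphism `B(n, k) → B(n, k)[X]` that multiplies elements of degree `d` by
`X ^ d`. -/
def deltaB : B K n k →ₐ[URing K n] Tw K n k :=
  liftB' (fun x y => twMon (x.deg y) (f K x y))
    (fun x y z => by
      change _ = Umon K (fun i => x.g y z (i + 1)) • _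
      rw [twMon_mul, Umon_smul_twMon, f_comp', deg_add])
    (fun x y y' z h => by rw [twMon_mul, f_not_comp _ _ _ _ h, twMon_zero])
    (by
      simp only [deg_self]
      have := congrArg (Polynomial.C (R := B K n k)) (f_one (K := K) (n := n) (k := k))
      rw [map_sum, map_one] at this
      exact this)
    (fun i hi hn x y z hx hy => by rw [twMon_mul, f_RR i hi hn hx hy, twMon_zero])
    (fun i hi hn x y z hx hy => by rw [twMon_mul, f_LL i hi hn hx hy, twMon_zero])
    (fun i x hx => by
      have : (MvPolynomial.X i : URing K n) = Umon K (Pi.single i 1) := by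
        simp [Umon, Pi.single_apply, Finset.prod_ite_eq', pow_ite]
      rw [this, Umon_smul_twMon, ← this, f_U i x hx, twMon_zero])

lemma deltaB_smul (c : K) (b : B K n k) :
    deltaB K n k (c • b) = twMon 0 (algebraMap K (B K n k) c) * deltaB K n k b := by
  have h : c • b = (MvPolynomial.C c : URing K n) • b := by
    rw [← MvPolynomial.algebraMap_eq, algebraMap_smul]
  rw [h, map_smul, Algebra.smul_def]
  congr 1
  change Polynomial.mapRingHom _ (tau K n _) = _
  simp only [tau, MvPolynomial.coe_eval₂Hom, MvPolynomial.eval₂_C]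
  simp
  rfl

lemma deltaB_mem {d : ℤ} {b : B K n k} (hb : b ∈ grB K n k d) :
    ∃ e : ℕ, (b = 0 ∨ (e : ℤ) = d) ∧ deltaB K n k b = twMon e b := by
  by_cases hd : 0 ≤ d
  · lift d to ℕ using hd
    refine ⟨d, Or.inr rfl, ?_⟩
    induction hb using Submodule.span_induction with
    | mem b hb =>
      obtain ⟨m, x, y, hd, rfl⟩ := hb
      rw [map_smul, deltaB, liftB'_f, Umon_smul_twMon]
      congr 1
      exact_mod_cast hd
    | zero => rw [map_zero, twMon_zero]
    | add b b' _ _ h h' => rw [map_add, h, h']; exact (map_add (Polynomial.monomial d) b b').symm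
    | smul c b _ h =>
      rw [deltaB_smul, h, Algebra.smul_def, twMon_mul, zero_add]
  · have : b = 0 := by
      have hbot : grB K n k d = ⊥ := by
        rw [grB, Submodule.span_eq_bot]
        rintro _ ⟨m, x, y, h, -⟩
        omega
      rw [hbot] at hb
      exact hb
    subst this
    exact ⟨0, Or.inl rfl, by rw [map_zero, twMon_zero]⟩

/-- A criterion for a family of submodules to be a grading. -/
lemma isInternal_of_proj {K M X : Type*} [CommRing K] [AddCommGroup M] [Module K M]
    [AddCommGroup X] (gr : ℤ → Submodule K M) (ι : M →+ X) (hι : Function.Injective ι)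
    (π : M →+ (ℤ → X)) (h1 : ∀ d, ∀ m ∈ gr d, π m = Pi.single d (ι m))
    (h2 : ∀ m, m ∈ ⨆ d, gr d) : DirectSum.IsInternal gr := by
  constructor
  · rw [injective_iff_map_eq_zero]
    intro x hx
    have key : ∀ (x : DirectSum ℤ fun d => gr d) (d : ℤ),
        π (DirectSum.coeAddMonoidHom gr x) d = ι (x d) := by
      intro x d
      induction x using DirectSum.induction_on with
      | zero => simp
      | of i m =>
        rw [DirectSum.coeAddMonoidHom_of, h1 i _ m.2]
        by_cases h : d = i
        · subst h; simp
        · rw [Pi.single_eq_of_ne h, DirectSum.of_eq_of_ne _ _ _ h]; simp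
      | add x y hx hy => rw [map_add, map_add, Pi.add_apply, hx, hy]; simp
    refine DFinsupp.ext fun d => Subtype.ext (hι ?_)
    rw [← key x d, hx]
    simp
  · intro m
    have := h2 m
    induction this using Submodule.iSup_induction' with
    | mem i x hx => exact ⟨DirectSum.of (fun d => gr d) i ⟨x, hx⟩, by simp⟩
    | zero => exact ⟨0, by simp⟩
    | add x y _ _ h h' =>
      obtain ⟨a, rfl⟩ := h; obtain ⟨b, rfl⟩ := h'
      exact ⟨a + b, by simp⟩

/-- The pieces `grB d` grade `B(n, k)`. -/
theorem grB_internal : DirectSum.IsInternal (grB K n k) := by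
  refine isInternal_of_proj (X := B K n k) _ (AddMonoidHom.id _) (fun _ _ h => h)
    { toFun := fun b d => if 0 ≤ d then
        Polynomial.coeff (R := B K n k) (deltaB K n k b) d.toNat else 0
      map_zero' := by
        funext d; simp only [map_zero]; split_ifs
        · exact Polynomial.coeff_zero _
        · rfl
      map_add' := fun a b => by
        funext d; simp only [map_add, Pi.add_apply]; split_ifs
        · exact Polynomial.coeff_add _ _ _
        · simp } ?_ (fun m => by rw [iSup_grB]; trivial)
  intro d m hm
  obtain ⟨e, he, hδ⟩ := deltaB_mem hm
  funext d'
  simp only [AddMonoidHom.coe_mk, ZeroHom.coe_mk, AddMonoidHom.id_apply, hδ, twMon,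
    Polynomial.coeff_monomial, Pi.single_apply]
  rcases he with rfl | rfl
  · simp
  · split_ifs <;> first | rfl | omega

end Algebra

/-! ### The algebra `B_l(n, k)` -/

/-- A corner `e A e` of an `S`-algebra is an `S`-algebra. -/
@[reducible]
def cornerAlgebra {S A : Type*} [CommRing S] [Ring A] [Algebra S A] {e : A}
    (h : IsIdempotentElem e) : Algebra S h.Corner where
  smul c b := ⟨c • b.1, by
    have hb := (Subsemigroup.mem_corner_iff h).1 b.2
    exact (Subsemigroup.mem_corner_iff h).2
      ⟨by rw [mul_smul_comm, hb.1], by rw [smul_mul_assoc, hb.2]⟩⟩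
  algebraMap :=
    { toFun := fun c => ⟨c • e, (Subsemigroup.mem_corner_iff h).2
        ⟨by rw [mul_smul_comm, h.eq], by rw [smul_mul_assoc, h.eq]⟩⟩
      map_one' := Subtype.ext (one_smul S e)
      map_mul' := fun c d => Subtype.ext (by
        change (c * d) • e = (c • e) * (d • e)
        rw [smul_mul_assoc, mul_smul_comm, h.eq, smul_smul])
      map_zero' := Subtype.ext (zero_smul S e)
      map_add' := fun c d => Subtype.ext (add_smul c d e) }
  commutes' c b := Subtype.ext (by
    have hb := (Subsemigroup.mem_corner_iff h).1 b.2
    change (c • e) * b.1 = b.1 * (c • e)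
    rw [smul_mul_assoc, mul_smul_comm, hb.1, hb.2])
  smul_def' c b := Subtype.ext (by
    have hb := (Subsemigroup.mem_corner_iff h).1 b.2
    change c • b.1 = (c • e) * b.1
    rw [smul_mul_assoc, hb.1])

section Corner

variable (K : Type u) [CommRing K] (n k : ℕ)

/-- The idempotent `∑ I_x`, where `x` runs over the left I-states and `I_x = f_{x,x}`. -/
def eLeft : B K n k := ∑ x : LeftIState n k, f K x.1 x.1

variable {n k}

lemma eLeft_mul (x : LeftIState n k) (y : IState n k) : eLeft K n k * f K x.1 y = f K x.1 y := by
  rw [eLeft, Finset.sum_mul, Finset.sum_eq_single x]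
  · exact f_left _ _
  · intro b _ hb
    exact f_not_comp _ _ _ _ (fun h => hb (Subtype.ext h))
  · simp

lemma mul_eLeft (y : IState n k) (x : LeftIState n k) : f K y x.1 * eLeft K n k = f K y x.1 := by
  rw [eLeft, Finset.mul_sum, Finset.sum_eq_single x]
  · exact f_right _ _
  · intro b _ hb
    exact f_not_comp _ _ _ _ (fun h => hb (Subtype.ext h.symm))
  · simp

lemma eLeft_idem : IsIdempotentElem (eLeft K n k) := by
  unfold IsIdempotentElem
  conv_lhs => rw [eLeft, ← eLeft, eLeft, Finset.mul_sum]
  exact Finset.sum_congr rfl fun x _ => eLeft_mul K x x.1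

variable (n k)

/-- The algebra `B_l(n, k) = (∑ I_x) B(n, k) (∑ I_x)`. -/
def Bl : Type u := (eLeft_idem K (n := n) (k := k)).Corner

instance : Ring (Bl K n k) := inferInstanceAs (Ring (eLeft_idem K (n := n) (k := k)).Corner)

instance : Algebra K (Bl K n k) := cornerAlgebra (eLeft_idem K (n := n) (k := k))

/-- The inclusion of `B_l(n, k)` in `B(n, k)`. -/
def inclBl : Bl K n k →ₗ[K] B K n k where
  toFun b := b.1
  map_add' _ _ := rfl
  map_smul' _ _ := rfl

/-- The degree `d` part of `B_l(n, k)`. -/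
def grBl (d : ℤ) : Submodule K (Bl K n k) := (grB K n k d).comap (inclBl K n k)

variable {n k}

lemma inclBl_injective : Function.Injective (inclBl K n k) := Subtype.val_injective

lemma inclBl_mul (a b : Bl K n k) : inclBl K n k (a * b) = inclBl K n k a * inclBl K n k b := rfl

lemma inclBl_one : inclBl K n k 1 = eLeft K n k := rfl

lemma eLeft_mul_incl (b : Bl K n k) : eLeft K n k * inclBl K n k b = inclBl K n k b :=
  ((Subsemigroup.mem_corner_iff (eLeft_idem K)).1 b.2).1

lemma incl_mul_eLeft (b : Bl K n k) : inclBl K n k b * eLeft K n k = inclBl K n k b :=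
  ((Subsemigroup.mem_corner_iff (eLeft_idem K)).1 b.2).2

/-- The element `e b e` of `B_l(n, k)`, where `b ∈ B(n, k)` and `e = ∑ I_x`. -/
def cut (b : B K n k) : Bl K n k := ⟨eLeft K n k * b * eLeft K n k, b, rfl⟩

lemma incl_cut (b : B K n k) : inclBl K n k (cut K b) = eLeft K n k * b * eLeft K n k := rfl

/-- The idempotent `I_x` of `B_l(n, k)`. -/
def Il (x : LeftIState n k) : Bl K n k :=
  ⟨f K x.1 x.1, (Subsemigroup.mem_corner_iff (eLeft_idem K)).2
    ⟨eLeft_mul K x x.1, mul_eLeft K x.1 x⟩⟩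

lemma Il_idem (x : LeftIState n k) : Il K x * Il K x = Il K x := Subtype.ext (f_idem x.1)

lemma Il_mem (x : LeftIState n k) : Il K x ∈ grBl K n k 0 := f_self_mem_grB x.1

lemma grBl_mul {i j : ℤ} {a b : Bl K n k} (ha : a ∈ grBl K n k i) (hb : b ∈ grBl K n k j) :
    a * b ∈ grBl K n k (i + j) := grB_mul (K := K) ha hb

lemma eLeft_mem : eLeft K n k ∈ grB K n k 0 := sum_mem fun x _ => f_self_mem_grB x.1

end Corner

/-- Let `M` be graded and `p : M → N` a surjection that preserves degrees, where `N` is embedded in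
`M` with the induced filtration by degrees; then `N` is graded. -/
lemma isInternal_of_retract {K M N : Type*} [CommRing K] [AddCommGroup M] [Module K M]
    [AddCommGroup N] [Module K N] {gr : ℤ → Submodule K M} (h : DirectSum.IsInternal gr)
    (ι : N →ₗ[K] M) (hι : Function.Injective ι) (p : M →+ N) (hp : ∀ x, p (ι x) = x)
    (hgr : ∀ d, ∀ m ∈ gr d, ι (p m) ∈ gr d) :
    DirectSum.IsInternal fun d => (gr d).comap ι := by
  let e := AddEquiv.ofBijective (DirectSum.coeAddMonoidHom gr) h
  refine isInternal_of_proj (X := M) _ ι.toAddMonoidHom hι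
    { toFun := fun x d => ((e.symm (ι x)) d : M)
      map_zero' := by funext d; simp
      map_add' := fun a b => by funext d; simp } ?_ ?_
  · intro d m hm
    have : e.symm (ι m) = DirectSum.of (fun d => gr d) d ⟨ι m, hm⟩ := by
      rw [AddEquiv.symm_apply_eq]
      exact (DirectSum.coeAddMonoidHom_of (fun d => gr d) d ⟨ι m, hm⟩).symm
    funext d'
    simp only [AddMonoidHom.coe_mk, ZeroHom.coe_mk, this, LinearMap.toAddMonoidHom_coe]
    by_cases hd : d' = d
    · subst hd; simp
    · rw [Pi.single_eq_of_ne hd, DirectSum.of_eq_of_ne _ _ _ hd]; simp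
  · intro x
    have key : ∀ m ∈ ⨆ d, gr d, p m ∈ ⨆ d, (gr d).comap ι := by
      intro m hm
      induction hm using Submodule.iSup_induction' with
      | mem i m hm => exact Submodule.mem_iSup_of_mem i (hgr i m hm)
      | zero => simp
      | add a b _ _ ha hb => rw [map_add]; exact add_mem ha hb
    rw [← hp x]
    apply key
    rw [h.submodule_iSup_eq_top]
    trivial

section Corner

variable (K : Type u) [CommRing K] (n k : ℕ)

/-- The pieces `grBl d` grade `B_l(n, k)`. -/
theorem grBl_internal : DirectSum.IsInternal (grBl K n k) := by
  refine isInternal_of_retract (grB_internal (K := K)) (inclBl K n k) (inclBl_injective K)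
    { toFun := cut K
      map_zero' := inclBl_injective K (by rw [incl_cut]; simp)
      map_add' := fun a b => inclBl_injective K (by
        rw [map_add]; simp only [incl_cut, mul_add, add_mul]) } ?_ ?_
  · intro b
    apply inclBl_injective K
    change inclBl K n k (cut K _) = _
    rw [incl_cut, eLeft_mul_incl, incl_mul_eLeft]
  · intro d m hm
    change eLeft K n k * m * eLeft K n k ∈ _
    have := grB_mul (grB_mul (eLeft_mem K) hm) (eLeft_mem K)
    simpa using this

lemma psiB_eLeft : psiB K n k (eLeft K n k) = MulOpposite.op (eLeft K n k) := by
  rw [eLeft, map_sum, Finset.op_sum]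
  exact Finset.sum_congr rfl fun x _ => psiB_f _ _

/-- The anti-automorphism `ψ` of `B_l(n, k)`, the restriction of that of `B(n, k)`, as a ring
homomorphism to the opposite ring. -/
def psiBl : Bl K n k →+* (Bl K n k)ᵐᵒᵖ where
  toFun b := MulOpposite.op ⟨(psiB K n k (inclBl K n k b)).unop,
    (Subsemigroup.mem_corner_iff (eLeft_idem K)).2 ⟨by
      have := congrArg (fun z => (psiB K n k z).unop) (incl_mul_eLeft K b)
      simpa only [map_mul, psiB_eLeft, MulOpposite.unop_mul, MulOpposite.unop_op] using this, by
      have := congrArg (fun z => (psiB K n k z).unop) (eLeft_mul_incl K b)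
      simpa only [map_mul, psiB_eLeft, MulOpposite.unop_mul, MulOpposite.unop_op] using this⟩⟩
  map_one' := MulOpposite.unop_injective (Subtype.ext (by
    change (psiB K n k (inclBl K n k 1)).unop = eLeft K n k
    rw [inclBl_one, psiB_eLeft, MulOpposite.unop_op]))
  map_mul' a b := MulOpposite.unop_injective (Subtype.ext (by
    change (psiB K n k (inclBl K n k (a * b))).unop =
      (psiB K n k (inclBl K n k b)).unop * (psiB K n k (inclBl K n k a)).unop
    rw [inclBl_mul, map_mul, MulOpposite.unop_mul]))
  map_zero' := MulOpposite.unop_injective (Subtype.ext (by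
    change (psiB K n k (inclBl K n k 0)).unop = 0
    rw [map_zero, map_zero, MulOpposite.unop_zero]))
  map_add' a b := MulOpposite.unop_injective (Subtype.ext (by
    change (psiB K n k (inclBl K n k (a + b))).unop =
      (psiB K n k (inclBl K n k a)).unop + (psiB K n k (inclBl K n k b)).unop
    rw [map_add, map_add, MulOpposite.unop_add]))

end Corner

/-! ### Graded projective modules and the Grothendieck group -/

/-- The variable `q` of `ℂ(q)`. -/
abbrev q : RatFunc ℂ := RatFunc.X

/-- The graded vector space with pieces `ℳ d` is finite-dimensional in each degree, and its graded
dimension `∑_d dim(ℳ_d) q ^ d` is the expansion of the rational function `r` in `ℂ((q))`. -/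
def HasGrDim {K M : Type*} [Field K] [AddCommGroup M] [Module K M] (ℳ : ℤ → Submodule K M)
    (r : RatFunc ℂ) : Prop :=
  ∀ d, Module.Finite K (ℳ d) ∧
    HahnSeries.coeff (r : LaurentSeries ℂ) d = (Module.finrank K (ℳ d) : ℂ)

/-- The algebra `ℂ(q)` over `ℤ[q, q⁻¹]`. -/
instance : Algebra (LaurentPolynomial ℤ) (RatFunc ℂ) :=
  RingHom.toAlgebra (LaurentPolynomial.eval₂ (Int.castRingHom (RatFunc ℂ))
    (Units.mk0 q RatFunc.X_ne_zero))

section Modules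

variable {K : Type u} [Field K] {A : Type u} [Ring A] [Algebra K A]

/-- A finitely generated projective graded left module over a `K`-algebra `A` with grading `𝒜`. -/
structure GrProj (𝒜 : ℤ → Submodule K A) : Type (u + 1) where
  carrier : Type u
  [addCommGroup : AddCommGroup carrier]
  [moduleBase : Module K carrier]
  [module : Module A carrier]
  [tower : IsScalarTower K A carrier]
  /-- The piece of degree `d`. -/
  gr : ℤ → Submodule K carrier
  internal : DirectSum.IsInternal gr
  smul_mem : ∀ {i j : ℤ} {a : A} {m : carrier}, a ∈ 𝒜 i → m ∈ gr j → a • m ∈ gr (i + j)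
  finite : Module.Finite A carrier
  projective : Module.Projective A carrier

attribute [instance] GrProj.addCommGroup GrProj.moduleBase GrProj.module GrProj.tower

variable {𝒜 : ℤ → Submodule K A}

namespace GrProj

/-- The graded module `q ^ i P`, that is, `P` with degrees shifted upwards by `i`. -/
def shift (i : ℤ) (P : GrProj 𝒜) : GrProj 𝒜 where
  carrier := P.carrier
  gr j := P.gr (j - i)
  internal := by
    refine isInternal_of_proj (X := P.carrier) _ (AddMonoidHom.id _) (fun _ _ h => h)
      { toFun := fun x d => (((AddEquiv.ofBijective (DirectSum.coeAddMonoidHom P.gr)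
          P.internal).symm x) (d - i) : P.carrier)
        map_zero' := by funext d; simp
        map_add' := fun a b => by funext d; simp } ?_ ?_
    · intro d m hm
      have : (AddEquiv.ofBijective (DirectSum.coeAddMonoidHom P.gr) P.internal).symm m =
          DirectSum.of (fun d => P.gr d) (d - i) ⟨m, hm⟩ := by
        rw [AddEquiv.symm_apply_eq]
        exact (DirectSum.coeAddMonoidHom_of (fun d => P.gr d) (d - i) ⟨m, hm⟩).symm
      funext d'
      simp only [AddMonoidHom.coe_mk, ZeroHom.coe_mk, this, AddMonoidHom.id_apply]
      by_cases hd : d' = d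
      · subst hd; simp
      · rw [Pi.single_eq_of_ne hd, DirectSum.of_eq_of_ne _ _ _ (by omega)]; simp
    · intro m
      have h : m ∈ ⨆ d, P.gr d := by rw [P.internal.submodule_iSup_eq_top]; trivial
      refine (iSup_le fun d => ?_ : ⨆ d, P.gr d ≤ ⨆ d, P.gr (d - i)) h
      have := le_iSup (fun d => P.gr (d - i)) (d + i)
      simpa using this
  smul_mem {a b _ _} ha hm := by
    have := P.smul_mem ha hm
    rwa [← add_sub_assoc] at this
  finite := P.finite
  projective := P.projective

lemma shift_congr (P : GrProj 𝒜) (gr' : ℤ → Submodule K P.carrier) (h : gr' = P.gr) (h1 h2) :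
    (⟨P.carrier, gr', h1, h2, P.finite, P.projective⟩ : GrProj 𝒜) = P := by
  subst h; rfl

lemma shift_zero (P : GrProj 𝒜) : P.shift 0 = P :=
  shift_congr P _ (by funext j; simp) _ _

lemma shift_shift (i j : ℤ) (P : GrProj 𝒜) : (P.shift j).shift i = P.shift (i + j) :=
  shift_congr (P.shift (i + j)) _ (by
    funext d
    change P.gr (d - i - j) = P.gr (d - (i + j))
    rw [sub_sub]) _ _

/-- The projective module `A e`, where `e` is an idempotent of degree `0`. -/
def ofIdem (h𝒜 : DirectSum.IsInternal 𝒜)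
    (hmul : ∀ {i j : ℤ} {a b : A}, a ∈ 𝒜 i → b ∈ 𝒜 j → a * b ∈ 𝒜 (i + j))
    {e : A} (he : e * e = e) (he0 : e ∈ 𝒜 0) : GrProj 𝒜 :=
  let p : A →ₗ[A] Submodule.span A {e} := (LinearMap.toSpanSingleton A A e).codRestrict _
    (fun a => Submodule.smul_mem _ _ (Submodule.mem_span_singleton_self e))
  have hp : ∀ x : Submodule.span A {e}, p x.1 = x := by
    intro x
    obtain ⟨a, ha⟩ := Submodule.mem_span_singleton.1 x.2
    refine Subtype.ext ?_
    change x.1 * e = x.1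
    rw [← ha, smul_eq_mul, mul_assoc, he]
  { carrier := Submodule.span A {e}
    gr := fun d => (𝒜 d).comap ((Submodule.span A {e}).subtype.restrictScalars K)
    internal := isInternal_of_retract h𝒜 _ Subtype.val_injective p.toAddMonoidHom hp
      (fun d m hm => by
        change m * e ∈ 𝒜 d
        have := hmul hm he0
        rwa [add_zero] at this)
    smul_mem := fun ha hm => hmul ha hm
    finite := Module.Finite.span_singleton A e
    projective := Module.Projective.of_split (Submodule.span A {e}).subtype p
      (LinearMap.ext hp) }

end GrProj

/-- The relations `[P] = [P'] + [P'']` of the Grothendieck group, one for each short exact sequence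
`0 → P' → P → P'' → 0` whose maps are `A`-linear of degree zero. -/
def relK0 (𝒜 : ℤ → Submodule K A) : Set (FreeAbelianGroup (GrProj 𝒜)) :=
  {r | ∃ (P' P P'' : GrProj 𝒜) (a : P'.carrier →ₗ[A] P.carrier) (b : P.carrier →ₗ[A] P''.carrier),
    (∀ d, ∀ m ∈ P'.gr d, a m ∈ P.gr d) ∧ (∀ d, ∀ m ∈ P.gr d, b m ∈ P''.gr d) ∧
    Function.Injective a ∧ Function.Exact a b ∧ Function.Surjective b ∧
    r = FreeAbelianGroup.of P - FreeAbelianGroup.of P' - FreeAbelianGroup.of P''}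

/-- The Grothendieck group `K_0` of finitely generated projective graded left `A`-modules. -/
def K0 (𝒜 : ℤ → Submodule K A) : Type (u + 1) :=
  FreeAbelianGroup (GrProj 𝒜) ⧸ AddSubgroup.closure (relK0 𝒜)

instance : AddCommGroup (K0 𝒜) :=
  inferInstanceAs (AddCommGroup (FreeAbelianGroup (GrProj 𝒜) ⧸ AddSubgroup.closure (relK0 𝒜)))

/-- The class `[P]` in `K_0`. -/
def GrProj.cls (P : GrProj 𝒜) : K0 𝒜 :=
  QuotientAddGroup.mk (FreeAbelianGroup.of P)

variable (𝒜) in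
/-- The map of `K_0` that sends `[P]` to `[q ^ i P]`. -/
def shiftK0 (i : ℤ) : K0 𝒜 →+ K0 𝒜 :=
  QuotientAddGroup.map _ _ (FreeAbelianGroup.map (GrProj.shift i)) (by
    rw [AddSubgroup.closure_le]
    rintro _ ⟨P', P, P'', a, b, ha, hb, h1, h2, h3, rfl⟩
    apply AddSubgroup.subset_closure
    refine ⟨P'.shift i, P.shift i, P''.shift i, a, b, fun d => ha (d - i), fun d => hb (d - i),
      h1, h2, h3, ?_⟩
    simp)

lemma shiftK0_cls (i : ℤ) (P : GrProj 𝒜) : shiftK0 𝒜 i P.cls = (P.shift i).cls := by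
  change QuotientAddGroup.mk (FreeAbelianGroup.map (GrProj.shift i) (FreeAbelianGroup.of P)) = _
  rw [FreeAbelianGroup.map_of_apply]
  rfl

lemma K0_hom_ext {f g : K0 𝒜 →+ K0 𝒜} (h : ∀ P : GrProj 𝒜, f P.cls = g P.cls) : f = g :=
  QuotientAddGroup.addMonoidHom_ext _ (FreeAbelianGroup.lift_ext _ _ h)

variable (𝒜) in
/-- The action of the powers of `q` on `K_0`. -/
def shiftHom : Multiplicative ℤ →* Module.End ℤ (K0 𝒜) where
  toFun i := (shiftK0 𝒜 i.toAdd).toIntLinearMap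
  map_one' := by
    apply LinearMap.toAddMonoidHom_injective
    refine K0_hom_ext fun P => ?_
    change shiftK0 𝒜 0 P.cls = P.cls
    rw [shiftK0_cls, GrProj.shift_zero]
  map_mul' i j := by
    apply LinearMap.toAddMonoidHom_injective
    refine K0_hom_ext fun P => ?_
    change shiftK0 𝒜 (i.toAdd + j.toAdd) P.cls = shiftK0 𝒜 i.toAdd (shiftK0 𝒜 j.toAdd P.cls)
    rw [shiftK0_cls, shiftK0_cls, shiftK0_cls, GrProj.shift_shift]

/-- `K_0` is a module over `ℤ[q, q⁻¹]`, with `q ^ i [P] = [q ^ i P]`. -/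
instance : Module (LaurentPolynomial ℤ) (K0 𝒜) :=
  Module.compHom (K0 𝒜) (AddMonoidAlgebra.lift ℤ (Module.End ℤ (K0 𝒜)) ℤ (shiftHom 𝒜)).toRingHom

lemma T_smul_cls (i : ℤ) (P : GrProj 𝒜) :
    (LaurentPolynomial.T i : LaurentPolynomial ℤ) • P.cls = (P.shift i).cls := by
  change AddMonoidAlgebra.lift ℤ (Module.End ℤ (K0 𝒜)) ℤ (shiftHom 𝒜)
    (AddMonoidAlgebra.single i 1) P.cls = _
  rw [AddMonoidAlgebra.lift_single, one_smul]
  exact shiftK0_cls i P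

/-- `K_0^{ℂ(q)} = K_0 ⊗_{ℤ[q, q⁻¹]} ℂ(q)`, written with the factors exchanged. -/
abbrev K0q (𝒜 : ℤ → Submodule K A) : Type (u + 1) :=
  RatFunc ℂ ⊗[LaurentPolynomial ℤ] K0 𝒜

/-- The class `[P] ⊗ 1`. -/
def GrProj.clsq (P : GrProj 𝒜) : K0q 𝒜 := 1 ⊗ₜ P.cls

/-! ### The pairing on the Grothendieck group -/

/-- The space of `A`-linear maps `M → N` that raise degrees by `d`. -/
def homGr {M N : Type*} [AddCommGroup M] [AddCommGroup N] [Module A M] [Module A N] [Module K N]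
    [IsScalarTower K A N] {ι : Type*} [SetLike ι M] (grM : ℤ → ι)
    (grN : ℤ → Submodule K N) (d : ℤ) : Submodule K (M →ₗ[A] N) where
  carrier := {φ | ∀ j, ∀ m ∈ grM j, φ m ∈ grN (j + d)}
  add_mem' h h' j m hm := add_mem (h j m hm) (h' j m hm)
  zero_mem' j _ _ := zero_mem (grN (j + d))
  smul_mem' c _ h j m hm := (grN (j + d)).smul_mem c (h j m hm)

/-- The left `A`-module `^∨P^ψ`: the dual `^∨P = Hom_A(P, A)` of `P` is a right `A`-module by
`(φ b)(p) = φ(p) b`, and becomes a left `A`-module through the anti-automorphism `ψ` of `A`, so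
that `(a φ)(p) = φ(p) ψ(a)`. -/
def TwDual (_ψ : A →+* Aᵐᵒᵖ) (P : GrProj 𝒜) : Type u := P.carrier →ₗ[A] A

instance (ψ : A →+* Aᵐᵒᵖ) (P : GrProj 𝒜) : AddCommGroup (TwDual ψ P) :=
  inferInstanceAs (AddCommGroup (P.carrier →ₗ[A] A))

instance (ψ : A →+* Aᵐᵒᵖ) (P : GrProj 𝒜) : Module A (TwDual ψ P) :=
  Module.compHom (P.carrier →ₗ[A] A) ψ

/-- The grading of `^∨P^ψ`: the maps `P → A` that raise degrees by `d` have degree `d`. -/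
def TwDual.gr (ψ : A →+* Aᵐᵒᵖ) (P : GrProj 𝒜) (d : ℤ) : AddSubgroup (TwDual ψ P) :=
  (homGr P.gr 𝒜 d : Submodule K (P.carrier →ₗ[A] A)).toAddSubgroup

lemma TwDual.smul_apply (ψ : A →+* Aᵐᵒᵖ) (P : GrProj 𝒜) (a : A) (φ : TwDual ψ P)
    (p : P.carrier) :
    (show P.carrier →ₗ[A] A from a • φ) p =
      (show P.carrier →ₗ[A] A from φ) p * (ψ a).unop := rfl

/-- `β` is the `ℂ(q)`-bilinear pairing with `β([P], [P']) = dim_q Hom_A(^∨P^ψ, P')` for all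
finitely generated projective graded modules `P`, `P'`. -/
def IsHomPairing (𝒜 : ℤ → Submodule K A) (ψ : A →+* Aᵐᵒᵖ)
    (β : LinearMap.BilinForm (RatFunc ℂ) (K0q 𝒜)) : Prop :=
  ∀ P P' : GrProj 𝒜, HasGrDim (homGr (A := A) (TwDual.gr ψ P) P'.gr) (β P.clsq P'.clsq)

end Modules

/-! ### The weight space `(V^{⊗ n})_k` -/

/-- `V = ℂ(q)⟨v_0, v_1⟩`, with `v_i = Pi.single i 1`. -/
abbrev V : Type := Fin 2 → RatFunc ℂ

/-- `V^{⊗ n}`. -/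
abbrev VT (n : ℕ) : Type := ⨂[RatFunc ℂ] _ : Fin n, V

/-- The action of the generator `K_1` on `V`: the weights of `v_0`, `v_1` are `ε_1`, `ε_2`. -/
def actK1 : V →ₗ[RatFunc ℂ] V := Matrix.toLin' (Matrix.diagonal ![q, 1])

/-- The action of the generator `K_2` on `V`. -/
def actK2 : V →ₗ[RatFunc ℂ] V := Matrix.toLin' (Matrix.diagonal ![1, q])

/-- The weight space `(V^{⊗ n})_k` of weight `k ε_1 + (n - k) ε_2`, on which `K_1` acts as `q ^ k`
and `K_2` as `q ^ (n - k)`; here `K_i` acts on `V^{⊗ n}` as `K_i ⊗ … ⊗ K_i`. -/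
def weightSpace (n k : ℕ) : Submodule (RatFunc ℂ) (VT n) :=
  Module.End.eigenspace (PiTensorProduct.map fun _ : Fin n => actK1) (q ^ k) ⊓
    Module.End.eigenspace (PiTensorProduct.map fun _ : Fin n => actK2) (q ^ (n - k))

/-- The standard basis `v_{ε_1} ⊗ … ⊗ v_{ε_n}` of `V^{⊗ n}`. -/
def stdBasis (n : ℕ) : Module.Basis (Fin n → Fin 2) (RatFunc ℂ) (VT n) :=
  Basis.piTensorProduct fun _ : Fin n => Pi.basisFun (RatFunc ℂ) (Fin 2)

/-- The standard basis vector `v_x` with `v_0` in the positions `a + 1`, `a ∈ x`, and `v_1` in all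
other positions. -/
def stdVec (n : ℕ) (x : Finset ℕ) : VT n :=
  stdBasis n fun p => if (p : ℕ) ∈ x then 0 else 1

/-- The canonical basis vector `v_x^◇ = ℓ_{x_k + 1} ∧ … ∧ ℓ_{x_1 + 1}`, where `ℓ_1 = e_1`,
`ℓ_i = e_i + q e_{i-1}` for `i ≥ 2`, and `e_{i_k} ∧ … ∧ e_{i_1}` with `i_k > … > i_1` is the standard
basis vector with `v_0` in the positions `i_1, …, i_k`.  In the expansion of the product, `S` is the
set of the factors `a ∈ x`, `a ≠ 0`, from which the term `q e_a` is chosen instead of `e_{a+1}`.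
The indices of the chosen terms are always weakly decreasing, so no signs occur, and a term with a
repeated index vanishes. -/
def canVec (n : ℕ) (x : Finset ℕ) : VT n :=
  ∑ S ∈ (x.erase 0).powerset,
    if Set.InjOn (fun a => if a ∈ S then a - 1 else a) (x : Set ℕ) then
      q ^ S.card • stdVec n (x.image fun a => if a ∈ S then a - 1 else a)
    else 0

/-- The bilinear form on `(V^{⊗ n})_k` for which the standard basis is orthonormal. -/
def stdForm (n k : ℕ) : LinearMap.BilinForm (RatFunc ℂ) (weightSpace n k) :=
  LinearMap.BilinForm.restrict (stdBasis n).toDual (weightSpace n k)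

/-- `(m)_{q²} = 1 + q² + … + q^{2(m-1)}`. -/
def qNum (m : ℕ) : RatFunc ℂ := ∑ i ∈ Finset.range m, q ^ (2 * i)

/-- `(m)^!_{q²} = (m)_{q²} ⋯ (1)_{q²}`. -/
def qFact (m : ℕ) : RatFunc ℂ := ∏ i ∈ Finset.range m, qNum (i + 1)

/-- The Ozsváth–Szabó form on `(V^{⊗ n})_k`. -/
def ozForm (n k : ℕ) : LinearMap.BilinForm (RatFunc ℂ) (weightSpace n k) :=
  ((1 - q ^ 2) ^ k)⁻¹ • stdForm n k

/-- Sartori's form on `(V^{⊗ n})_k`. -/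
def sartoriForm (n k : ℕ) : LinearMap.BilinForm (RatFunc ℂ) (weightSpace n k) :=
  qFact k • stdForm n k

/-! ### The case of `B_l(n, k)` -/

section Final

variable (K : Type u) [Field K] {n k : ℕ}

/-- The space `I_x B_l(n, k) I_y`, in degree `d`. -/
def cornerGr (x y : LeftIState n k) (d : ℤ) : Submodule K (Bl K n k) :=
  LinearMap.range (LinearMap.mulLeftRight K (Il K x, Il K y)) ⊓ grBl K n k d

/-- The indecomposable projective module `P(x) = B_l(n, k) I_x`. -/
def projP (x : LeftIState n k) : GrProj (grBl K n k) :=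
  GrProj.ofIdem (grBl_internal K n k) (grBl_mul K) (Il_idem K x) (Il_mem K x)

/-- `Φ` is the identification of `K_0^{ℂ(q)}(B_l(n, k))` with `(V^{⊗ n})_k`: it sends `[P(x)]` to
the canonical basis vector `v_x^◇`. -/
def IsIdentification (Φ : K0q (grBl K n k) ≃ₗ[RatFunc ℂ] weightSpace n k) : Prop :=
  ∀ x : LeftIState n k, (Φ (projP K x).clsq : VT n) = canVec n x.1.1

end Final

end OSz

end

noncomputable section

open scoped TensorProduct

namespace OSz

universe u

/-! ### I-states: positions, counting functions and admissible pairs. -/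

namespace IState

variable {n k : ℕ}

/-! Both sides of the theorem are governed by one finite set: for left I-states `x`, `y`, the left
I-states `s` with `Adm s x` and `Adm s y`, read as sets of lines that can be matched with adjacent
regions of `x` and of `y`.

On the side of the weight space, expanding the wedge product shows that `v_x^◇` is the sum of `q ^
wt s x` times the standard basis vector of `s`, over the `s` admissible for `x` (`canVec_eq`). So
the standard form of two canonical basis vectors is a sum over the common admissible `s`. These `s`
are exactly the complements of choices of one line in each generating interval (`IsChoice.adm`,
`exists_not_mem_of_adm`). Moving a chosen line one step to the right raises the exponent by two,
which turns the sum into `q ^ d` times the product of the `(l_i)_{q²}` (`sum_adm_eq`).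

On the side of the algebra, `I_x B_l I_y` is spanned by the elements `U^m f_{x,y}`. If `x`, `y` are
too far then `f_{x,y} = 0`, because it factors through some `R_{i-1} R_i` or `L_i L_{i-1}`.
Otherwise the product of the `U_i` over a generating interval kills `f_{x,y}`
(`Umon_blockInd_smul`), so the monomials that omit some variable of each interval suffice. They are
independent: each `s` gives a matrix representation in which `U_i` becomes a square `X_i ^ 2` for
lines in `s` and zero for the others, and a monomial is detected by an `s` whose missing lines are
lines that it omits (`linearIndependent_Umon_smul`). Counting these monomials gives the same
rational function, so the Gram matrix of the canonical basis for the Ozsváth–Szabó form is the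
matrix of graded dimensions of the `I_x B_l I_y` (`hasGrDim_gram`).

The rest is formal. Degrees of `B_l` are nonnegative and its degree zero part is spanned by the
`I_x`, so every finitely generated graded projective has a homogeneous basis (`exists_gradedBasis`).
Hence the `[P(x)]` span, and the Hom spaces can be computed on bases. The graded dimension of `I_x
P` is additive on exact sequences and gives linear forms on `K_0` whose values on the `[P(y)]` are
the Gram entries; since the form is nondegenerate, the `[P(x)]` are independent. Thus `Φ` exists,
and the pull-back of the Ozsváth–Szabó form along it is the Hom pairing. -/

lemma elt_strictMono (x : IState n k) : StrictMono x.elt :=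
  (x.1.orderEmbOfFin x.card_eq).strictMono

lemma elt_mem (x : IState n k) (i : Fin k) : x.elt i ∈ x.1 := Finset.orderEmbOfFin_mem _ _ _

lemma mem_iff (x : IState n k) (a : ℕ) : a ∈ x.1 ↔ ∃ i, x.elt i = a := by
  have := Finset.range_orderEmbOfFin x.1 x.card_eq
  rw [← Finset.mem_coe, ← this]
  rfl

lemma le_of_mem (x : IState n k) {a : ℕ} (ha : a ∈ x.1) : a ≤ n := by
  have := (Finset.mem_powersetCard.1 x.2).1 ha
  rw [Finset.mem_range] at this
  omega

lemma elt_le (x : IState n k) (i : Fin k) : x.elt i ≤ n := x.le_of_mem (x.elt_mem i)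

lemma ext_elt {x y : IState n k} (h : ∀ i, x.elt i = y.elt i) : x = y := by
  refine Subtype.ext (Finset.ext fun a => ?_)
  simp only [mem_iff, h]

/-- The I-state with the elements `e 0 < e 1 < …`. -/
def ofFun (e : Fin k → ℕ) (he : StrictMono e) (hn : ∀ i, e i ≤ n) : IState n k :=
  ⟨Finset.univ.image e, Finset.mem_powersetCard.2
    ⟨fun a ha => by
      obtain ⟨i, -, rfl⟩ := Finset.mem_image.1 ha
      rw [Finset.mem_range]
      have := hn i
      omega, by rw [Finset.card_image_of_injective _ he.injective]; simp⟩⟩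

lemma elt_ofFun (e : Fin k → ℕ) (he : StrictMono e) (hn : ∀ i, e i ≤ n) (i : Fin k) :
    (ofFun e he hn).elt i = e i := by
  have := Finset.orderEmbOfFin_unique (ofFun e he hn).card_eq (f := e)
    (fun i => Finset.mem_image_of_mem _ (Finset.mem_univ i)) he
  exact (congrFun this i).symm

lemma image_elt (x : IState n k) : Finset.univ.image x.elt = x.1 := by
  ext a; simp [mem_iff]

lemma v_eq (x : IState n k) (m : ℕ) : x.v m = (Finset.univ.filter fun i => m ≤ x.elt i).card := by
  rw [← Finset.card_image_of_injective _ x.elt_strictMono.injective]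
  unfold v
  congr 1
  ext a
  simp only [Finset.mem_inter, Finset.mem_Icc, Finset.mem_image, Finset.mem_filter,
    Finset.mem_univ, true_and, mem_iff]
  constructor
  · rintro ⟨⟨i, rfl⟩, h, -⟩; exact ⟨i, h, rfl⟩
  · rintro ⟨i, h, rfl⟩; exact ⟨⟨i, rfl⟩, h, x.elt_le i⟩

/-- Since `elt` is increasing, the indices `i` with `m ≤ x_i` form a final segment of `Fin k`, of
length `v_m`. This is the dictionary between the positions of an I-state and its counting function.
-/
lemma le_elt_iff (x : IState n k) (m : ℕ) (i : Fin k) : m ≤ x.elt i ↔ k ≤ x.v m + i := by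
  rw [v_eq]
  constructor
  · intro h
    have : Finset.Ici i ⊆ Finset.univ.filter fun i => m ≤ x.elt i := fun j hj => by
      simp only [Finset.mem_filter, Finset.mem_univ, true_and]
      exact h.trans (x.elt_strictMono.monotone (Finset.mem_Ici.1 hj))
    have := Finset.card_le_card this
    rw [Fin.card_Ici] at this
    omega
  · intro h
    by_contra hlt
    have : (Finset.univ.filter fun i => m ≤ x.elt i) ⊆ Finset.Ioi i := fun j hj => by
      simp only [Finset.mem_filter, Finset.mem_univ, true_and] at hj
      rw [Finset.mem_Ioi]
      by_contra hji
      exact hlt (hj.trans (x.elt_strictMono.monotone (not_lt.1 hji)))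
    have := Finset.card_le_card this
    rw [Fin.card_Ioi] at this
    have := i.2
    omega

lemma v_le_v_of {x : IState n k} {y : IState n k} {a b : ℕ}
    (h : ∀ i, a ≤ x.elt i → b ≤ y.elt i) : x.v a ≤ y.v b := by
  rw [v_eq, v_eq]
  refine Finset.card_le_card fun i hi => ?_
  simp only [Finset.mem_filter, Finset.mem_univ, true_and] at hi ⊢
  exact h i hi

lemma v_zero (x : IState n k) : x.v 0 = k := by simp [v_eq]

lemma v_of_lt (x : IState n k) {m : ℕ} (h : n < m) : x.v m = 0 := by
  rw [v_eq, Finset.card_eq_zero, Finset.filter_eq_empty_iff]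
  intro i _
  have := x.elt_le i
  omega

lemma v_step (x : IState n k) (m : ℕ) : x.v m = x.v (m + 1) + if m ∈ x.1 then 1 else 0 := by
  by_cases h : m ∈ x.1
  · have : x.1 ∩ Finset.Icc m n = insert m (x.1 ∩ Finset.Icc (m + 1) n) := by
      ext a
      simp only [Finset.mem_inter, Finset.mem_insert, Finset.mem_Icc]
      constructor
      · rintro ⟨h1, h2, h3⟩
        rcases h2.eq_or_lt with h | h
        · exact Or.inl h.symm
        · exact Or.inr ⟨h1, h, h3⟩
      · rintro (rfl | ⟨h1, h2, h3⟩)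
        · exact ⟨h, le_rfl, x.le_of_mem h⟩
        · exact ⟨h1, by omega, h3⟩
    rw [if_pos h]
    unfold v
    rw [this, Finset.card_insert_of_notMem (by simp)]
  · have : x.1 ∩ Finset.Icc m n = x.1 ∩ Finset.Icc (m + 1) n := by
      ext a
      simp only [Finset.mem_inter, Finset.mem_Icc]
      constructor
      · rintro ⟨h1, h2, h3⟩
        rcases h2.eq_or_lt with e | e
        · exact absurd (e ▸ h1) h
        · exact ⟨h1, e, h3⟩
      · rintro ⟨h1, h2, h3⟩
        exact ⟨h1, by omega, h3⟩
    rw [if_neg h]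
    unfold v
    rw [this, add_zero]

lemma v_between {x y z : IState n k}
    (h : ∀ i, min (x.elt i) (y.elt i) ≤ z.elt i ∧ z.elt i ≤ max (x.elt i) (y.elt i)) (m : ℕ) :
    min (x.v m) (y.v m) ≤ z.v m ∧ z.v m ≤ max (x.v m) (y.v m) := by
  rcases le_total (x.v m) (y.v m) with hle | hle
  · have key : ∀ i, m ≤ x.elt i → m ≤ y.elt i := fun i hi => by
      rw [le_elt_iff] at hi ⊢; omega
    rw [min_eq_left hle, max_eq_right hle]
    refine ⟨v_le_v_of fun i hi => ?_, v_le_v_of fun i hi => ?_⟩ <;>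
      have := h i <;> have := key i <;> omega
  · have key : ∀ i, m ≤ y.elt i → m ≤ x.elt i := fun i hi => by
      rw [le_elt_iff] at hi ⊢; omega
    rw [min_eq_right hle, max_eq_left hle]
    refine ⟨v_le_v_of fun i hi => ?_, v_le_v_of fun i hi => ?_⟩ <;>
      have := h i <;> have := key i <;> omega

/-- If `z` lies between `x` and `y` in every coordinate, so does its counting function on every
line, and `|v^x - v^y|` is additive along `z`. This is what allows `f_{x,y}` to be factored through
`z` without a power of any `U_i`. -/
lemma g_eq_zero {x y z : IState n k}
    (h : ∀ i, min (x.elt i) (y.elt i) ≤ z.elt i ∧ z.elt i ≤ max (x.elt i) (y.elt i)) (m : ℕ) :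
    x.g z y m = 0 := by
  have := v_between h m
  unfold g twoW
  omega

lemma v_succ_le_of_not_tooFar {x y : IState n k} (h : ¬ x.TooFar y) (m : ℕ) :
    x.v (m + 1) ≤ y.v m ∧ y.v (m + 1) ≤ x.v m := by
  simp only [TooFar, not_exists, not_lt] at h
  constructor <;> refine v_le_v_of fun i hi => ?_ <;> have := h i <;> omega

lemma sum_range_le (a : ℕ) (ha : a ≤ n) :
    (∑ m : Fin n, if (m : ℕ) + 1 ≤ a then 1 else 0) = a := by
  rw [Fin.sum_univ_eq_sum_range (fun m => if m + 1 ≤ a then 1 else 0), Finset.sum_boole]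
  have : (Finset.range n).filter (fun m => m + 1 ≤ a) = Finset.range a := by
    ext m; simp only [Finset.mem_filter, Finset.mem_range]; omega
  rw [this]; simp

/-- Double counting of the pairs (index `i`, line `m`) for which exactly one of `m ≤ x_i`, `m ≤ y_i`
holds. For fixed `m` the two sets of indices are final segments, hence nested, so their symmetric
difference has `|v_m^x - v_m^y|` elements. -/
lemma dist_eq_deg (x y : IState n k) : x.dist y = x.deg y := by
  have h1 : ∀ i, ((x.elt i : ℤ) - y.elt i).natAbs = ∑ m : Fin n,
      (if (m : ℕ) + 1 ≤ x.elt i ∧ ¬ (m : ℕ) + 1 ≤ y.elt i ∨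
        (m : ℕ) + 1 ≤ y.elt i ∧ ¬ (m : ℕ) + 1 ≤ x.elt i then 1 else 0) := by
    intro i
    have a := sum_range_le (n := n) (x.elt i) (x.elt_le i)
    have b := sum_range_le (n := n) (y.elt i) (y.elt_le i)
    rcases le_total (x.elt i) (y.elt i) with h | h
    · have : ((x.elt i : ℤ) - y.elt i).natAbs + x.elt i = y.elt i := by omega
      refine Nat.add_right_cancel (m := x.elt i) (this.trans ?_)
      conv_lhs => rw [← b]
      conv_rhs => rw [← a, ← Finset.sum_add_distrib]
      simp only [a]
      refine Finset.sum_congr rfl fun m _ => ?_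
      split_ifs <;> omega
    · have : ((x.elt i : ℤ) - y.elt i).natAbs + y.elt i = x.elt i := by omega
      refine Nat.add_right_cancel (m := y.elt i) (this.trans ?_)
      conv_lhs => rw [← a]
      conv_rhs => rw [← b, ← Finset.sum_add_distrib]
      simp only [b]
      refine Finset.sum_congr rfl fun m _ => ?_
      split_ifs <;> omega
  simp only [dist, h1, deg]
  rw [Finset.sum_comm]
  refine Finset.sum_congr rfl fun m _ => ?_
  unfold twoW
  have key : ∀ a b : IState n k, a.v (m + 1) ≤ b.v (m + 1) →
      (∑ i : Fin k, if (m : ℕ) + 1 ≤ a.elt i ∧ ¬ (m : ℕ) + 1 ≤ b.elt i ∨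
        (m : ℕ) + 1 ≤ b.elt i ∧ ¬ (m : ℕ) + 1 ≤ a.elt i then 1 else 0) =
      ((a.v (m + 1) : ℤ) - b.v (m + 1)).natAbs := by
    intro a b h
    have hi : ∀ i, (m : ℕ) + 1 ≤ a.elt i → (m : ℕ) + 1 ≤ b.elt i := fun i hi => by
      rw [le_elt_iff] at hi ⊢; omega
    have : ((a.v (m + 1) : ℤ) - b.v (m + 1)).natAbs + a.v (m + 1) = b.v (m + 1) := by omega
    refine Nat.add_right_cancel (m := a.v (m + 1)) (Eq.trans ?_ this.symm)
    rw [v_eq, v_eq, Finset.card_filter, Finset.card_filter, ← Finset.sum_add_distrib]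
    refine Finset.sum_congr rfl fun i _ => ?_
    have := hi i
    split_ifs <;> omega
  rcases le_total (x.v (m + 1)) (y.v (m + 1)) with h | h
  · exact key x y h
  · have := key y x h
    rw [← Int.natAbs_neg, neg_sub, ← this]
    refine Finset.sum_congr rfl fun i _ => ?_
    simp only [or_comm]

/-- The positions of `s`, shifted to lines, can be matched with adjacent regions of `x`. -/
def Adm (s x : IState n k) : Prop := ∀ i, s.elt i ≤ x.elt i ∧ x.elt i ≤ s.elt i + 1

instance (s x : IState n k) : Decidable (Adm s x) := by unfold Adm; infer_instance

lemma Adm.v_le {s x : IState n k} (h : Adm s x) (t : ℕ) : x.v (t + 1) ≤ s.v t ∧ s.v t ≤ x.v t := by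
  constructor <;> refine v_le_v_of fun i hi => ?_ <;> have := h i <;> omega

/-- Position `t` of `s` stands for line `t + 1`, between the regions `t` and `t + 1`. When it is
missing from `s` the counts of `s` at `t` and `t + 1` agree, and the two bounds of `Adm.v_le`
squeeze `x.v (t + 1)` between them. -/
lemma Adm.v_eq {s x : IState n k} (h : Adm s x) {t : ℕ} (ht : t ∉ s.1) : x.v (t + 1) = s.v t := by
  have h1 := h.v_le t
  have h2 := h.v_le (t + 1)
  have := s.v_step t
  rw [if_neg ht] at this
  omega

/-- Converse of `Adm.v_eq`: equality at the lines missing from `s` is enough. At a line of `s` the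
count of `s` drops by exactly one and that of `x` by at most one, so the two inequalities needed
propagate from line to line, one from the right end and one from the left end. -/
lemma adm_of_v {s x : IState n k}
    (h : ∀ t < n, t ∉ s.1 → x.v (t + 1) = s.v t) : Adm s x := by
  have h1 : ∀ r t, t + r = n → x.v (t + 1) ≤ s.v t := by
    intro r
    induction r with
    | zero => intro t ht; rw [x.v_of_lt (by omega)]; exact Nat.zero_le _
    | succ r ih =>
      intro t ht
      by_cases hm : t ∈ s.1
      · have a := ih (t + 1) (by omega)
        have b := s.v_step t
        have c := x.v_step (t + 1)
        rw [if_pos hm] at b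
        split_ifs at c <;> omega
      · exact (h t (by omega) hm).le
  have h2 : ∀ t ≤ n, s.v t ≤ x.v t := by
    intro t
    induction t with
    | zero => intro _; rw [v_zero, v_zero]
    | succ t ih =>
      intro ht
      have a := ih (by omega)
      have b := s.v_step t
      have c := x.v_step t
      by_cases hm : t ∈ s.1
      · rw [if_pos hm] at b
        split_ifs at c <;> omega
      · rw [if_neg hm] at b
        have := h t (by omega) hm
        omega
  intro i
  constructor
  · have a := h2 (s.elt i) (s.elt_le i)
    have b := (s.le_elt_iff (s.elt i) i).1 le_rfl
    rw [le_elt_iff]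
    omega
  · rcases Nat.eq_zero_or_pos (x.elt i) with h0 | h0
    · omega
    · have := x.elt_le i
      obtain ⟨t, ht⟩ := Nat.exists_eq_add_of_le' h0
      have a := h1 (n - t) t (by omega)
      have b := (x.le_elt_iff (x.elt i) i).1 le_rfl
      rw [ht]
      have : t ≤ s.elt i := by
        rw [le_elt_iff]
        rw [ht] at b
        simp only [Nat.succ_eq_add_one, zero_add] at b
        omega
      omega

lemma not_tooFar_of_adm {s x y : IState n k} (hx : Adm s x) (hy : Adm s y) : ¬ x.TooFar y := by
  rintro ⟨i, hi⟩
  have := hx i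
  have := hy i
  omega

end IState

/-! ### Generating intervals: disjointness and number. -/

namespace IState

variable {n k : ℕ} {x y : IState n k}

lemma mem_genIntervals {G : ℕ × ℕ} : G ∈ x.genIntervals y ↔ 1 ≤ G.2 ∧ G.1 + G.2 ≤ n ∧
    G.1 ∉ x.1 ∩ y.1 ∧ G.1 + G.2 ∉ x.1 ∩ y.1 ∧
    (∀ m, G.1 < m → m < G.1 + G.2 → m ∈ x.1 ∩ y.1) ∧
    ∀ m, G.1 ≤ m → m < G.1 + G.2 → x.v (m + 1) = y.v (m + 1) := by
  unfold genIntervals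
  rw [Finset.mem_filter, Finset.mem_product, Finset.mem_range, Finset.mem_Icc]
  constructor
  · rintro ⟨⟨h1, h2, h3⟩, h4, h5, h6, h7, h8⟩
    exact ⟨h2, h4, h5, h6, fun m a b => h7 m (Finset.mem_Ioo.2 ⟨a, b⟩),
      fun m a b => h8 _ (Finset.mem_Icc.2 (by omega))⟩
  · rintro ⟨h2, h4, h5, h6, h7, h8⟩
    refine ⟨⟨by omega, h2, by omega⟩, h4, h5, h6, fun m hm => ?_, fun m hm => ?_⟩
    · rw [Finset.mem_Ioo] at hm; exact h7 m hm.1 hm.2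
    · rw [Finset.mem_Icc] at hm
      obtain ⟨m, rfl⟩ := Nat.exists_eq_add_of_le' (show 1 ≤ m by omega)
      exact h8 m (by omega) (by omega)

/-- If two generating intervals share a line but differ at an end, an end of one is an interior
region of the other, so it is both fully used and not fully used. Here `i` stands for the line `i +
1`. -/
lemma genIntervals_unique {G G' : ℕ × ℕ} (hG : G ∈ x.genIntervals y) (hG' : G' ∈ x.genIntervals y)
    {i : ℕ} (h1 : G.1 ≤ i) (h2 : i < G.1 + G.2) (h1' : G'.1 ≤ i) (h2' : i < G'.1 + G'.2) :
    G = G' := by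
  rw [mem_genIntervals] at hG hG'
  obtain ⟨-, -, a1, a2, a3, -⟩ := hG
  obtain ⟨-, -, b1, b2, b3, -⟩ := hG'
  have e1 : G.1 = G'.1 := by
    rcases lt_trichotomy G.1 G'.1 with h | h | h
    · exact absurd (a3 _ h (by omega)) b1
    · exact h
    · exact absurd (b3 _ h (by omega)) a1
  have e2 : G.1 + G.2 = G'.1 + G'.2 := by
    rcases lt_trichotomy (G.1 + G.2) (G'.1 + G'.2) with h | h | h
    · exact absurd (b3 _ (by omega) h) a2
    · exact h
    · exact absurd (a3 _ (by omega) h) b2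
  exact Prod.ext e1 (by omega)

/-- The regions at the left ends of the generating intervals. -/
def leftEnds (x y : IState n k) : Finset ℕ :=
  {t ∈ Finset.range n | t ∉ x.1 ∩ y.1 ∧ x.v (t + 1) = y.v (t + 1)}

/-- The right end is the next region that is not fully used; it exists because `n ∉ x`. All regions
in between lie in both states, so both counts drop together and the equality at line `t + 1` spreads
over the whole interval. -/
lemma exists_genInterval (hx : n ∉ x.1) {t : ℕ} (ht : t ∈ leftEnds x y) :
    ∃ l, (t, l) ∈ x.genIntervals y := by
  rw [leftEnds, Finset.mem_filter, Finset.mem_range] at ht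
  obtain ⟨htn, ht1, ht2⟩ := ht
  have hex : ∃ l, 1 ≤ l ∧ t + l ∉ x.1 ∩ y.1 :=
    ⟨n - t, by omega, fun h => hx (by
      have : t + (n - t) = n := by omega
      rw [this] at h
      exact (Finset.mem_inter.1 h).1)⟩
  classical
  let l := Nat.find hex
  have hl : 1 ≤ l ∧ t + l ∉ x.1 ∩ y.1 := Nat.find_spec hex
  have hln : l ≤ n - t := Nat.find_min' hex ⟨by omega, fun h => hx (by
      have : t + (n - t) = n := by omega
      rw [this] at h
      exact (Finset.mem_inter.1 h).1)⟩
  have hfull : ∀ m, t < m → m < t + l → m ∈ x.1 ∩ y.1 := by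
    intro m h1 h2
    have := Nat.find_min hex (m := m - t) (by omega)
    by_contra hm
    exact this ⟨by omega, by rwa [show t + (m - t) = m by omega]⟩
  refine ⟨l, mem_genIntervals.2 ⟨hl.1, by simp only; omega, ht1, hl.2, hfull, ?_⟩⟩
  have key : ∀ r, r < l → x.v (t + r + 1) = y.v (t + r + 1) := by
    intro r
    induction r with
    | zero => intro _; exact ht2
    | succ r ih =>
      intro hr
      have a := ih (by omega)
      have b := Finset.mem_inter.1 (hfull (t + r + 1) (by omega) (by omega))
      have c := x.v_step (t + r + 1)
      have d := y.v_step (t + r + 1)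
      rw [if_pos b.1] at c
      rw [if_pos b.2] at d
      rw [← add_assoc]
      omega
  intro m h1 h2
  have := key (m - t) (by simp only at h1 h2; omega)
  simp only at h1
  rwa [show t + (m - t) = m by omega] at this

lemma fst_mem_leftEnds {G : ℕ × ℕ} (hG : G ∈ x.genIntervals y) : G.1 ∈ leftEnds x y := by
  rw [mem_genIntervals] at hG
  obtain ⟨a, b, c, -, -, d⟩ := hG
  rw [leftEnds, Finset.mem_filter, Finset.mem_range]
  exact ⟨by omega, c, d _ le_rfl (by omega)⟩

lemma fst_injOn_genIntervals : Set.InjOn Prod.fst (x.genIntervals y : Set (ℕ × ℕ)) := by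
  intro G hG G' hG' h
  have a := (mem_genIntervals.1 hG).1
  have b := (mem_genIntervals.1 hG').1
  exact genIntervals_unique (i := G.1) hG hG' le_rfl (by omega) h.ge (by omega)

/-- Going down from `n`, the minimum of the two counts grows by one exactly at the regions that are
not left ends. If `t` is in neither state, not being too far forces equal counts at `t + 1`, so `t`
is a left end. If `t` is in one state only and the counts at `t + 1` differ, the state containing
`t` is the one with the smaller count. At `t = 0` this gives the number `n - k`; the refined version
for all `t` serves to locate the choices below. -/
lemma card_leftEnds_ge (hx : n ∉ x.1) (hf : ¬ x.TooFar y) {t : ℕ} (ht : t ≤ n) :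
    ((leftEnds x y).filter (t ≤ ·)).card + min (x.v t) (y.v t) = n - t := by
  induction ht using Nat.decreasingInduction with
  | self =>
    have : (leftEnds x y).filter (n ≤ ·) = ∅ := by
      rw [Finset.filter_eq_empty_iff]
      intro t ht
      rw [leftEnds, Finset.mem_filter, Finset.mem_range] at ht
      omega
    have h := x.v_step n
    rw [if_neg hx, x.v_of_lt (Nat.lt_succ_self n)] at h
    rw [this, h]; simp
  | of_succ t ht ih =>
    have c := x.v_step t
    have d := y.v_step t
    have e := v_succ_le_of_not_tooFar hf t
    by_cases hm : t ∈ leftEnds x y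
    · have : (leftEnds x y).filter (t ≤ ·) = insert t ((leftEnds x y).filter (t + 1 ≤ ·)) := by
        ext a
        simp only [Finset.mem_filter, Finset.mem_insert]
        constructor
        · rintro ⟨h1, h2⟩
          rcases h2.eq_or_lt with h | h
          · exact Or.inl h.symm
          · exact Or.inr ⟨h1, h⟩
        · rintro (rfl | ⟨h1, h2⟩)
          · exact ⟨hm, le_rfl⟩
          · exact ⟨h1, by omega⟩
      rw [this, Finset.card_insert_of_notMem (by simp)]
      rw [leftEnds, Finset.mem_filter, Finset.mem_inter] at hm
      obtain ⟨-, h1, h2⟩ := hm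
      split_ifs at c d <;> first | omega | exact absurd ⟨‹_›, ‹_›⟩ h1
    · have : (leftEnds x y).filter (t ≤ ·) = (leftEnds x y).filter (t + 1 ≤ ·) := by
        refine Finset.filter_congr fun a ha => ?_
        have : a ≠ t := fun h => hm (h ▸ ha)
        omega
      rw [this]
      rw [leftEnds, Finset.mem_filter, Finset.mem_inter, Finset.mem_range] at hm
      by_cases ha : t ∈ x.1 <;> by_cases hb : t ∈ y.1 <;>
        simp only [ha, hb, if_true, if_false, ht, true_and, and_true, and_false,
          not_false_eq_true, not_true_eq_false, false_and] at c d hm <;> omega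

lemma card_genIntervals_ge (hx : n ∉ x.1) (hf : ¬ x.TooFar y) {t : ℕ} (ht : t ≤ n) :
    ((x.genIntervals y).filter (t ≤ ·.1)).card + min (x.v t) (y.v t) = n - t := by
  rw [← card_leftEnds_ge hx hf ht]
  congr 1
  have hinj : Set.InjOn Prod.fst ((x.genIntervals y).filter (t ≤ ·.1) : Set (ℕ × ℕ)) :=
    fst_injOn_genIntervals.mono (fun G hG => (Finset.mem_filter.1 hG).1)
  rw [← Finset.card_image_of_injOn hinj]
  congr 1
  ext a
  simp only [Finset.mem_image, Finset.mem_filter]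
  constructor
  · rintro ⟨G, ⟨h1, h2⟩, rfl⟩; exact ⟨fst_mem_leftEnds h1, h2⟩
  · rintro ⟨h1, h2⟩
    obtain ⟨l, hl⟩ := exists_genInterval hx h1
    exact ⟨(a, l), ⟨hl, h2⟩, rfl⟩

lemma card_genIntervals (hx : n ∉ x.1) (hf : ¬ x.TooFar y) : (x.genIntervals y).card = n - k := by
  have := card_genIntervals_ge hx hf (Nat.zero_le n)
  rw [v_zero, v_zero, Finset.filter_true_of_mem (by simp)] at this
  omega

end IState

/-! ### Choices of one line in each generating interval. -/

namespace LeftIState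

variable {n k : ℕ}

lemma elt_lt (x : LeftIState n k) (i : Fin k) : x.1.elt i < n := by
  have := x.1.elt_le i
  rcases this.eq_or_lt with h | h
  · exact absurd (x.1.elt_mem i) (by rw [h]; exact x.2)
  · exact h

lemma k_le (x : LeftIState n k) : k ≤ n := by
  have h : x.1.1 ⊆ Finset.range n := fun a ha => by
    rw [Finset.mem_range]
    exact lt_of_le_of_ne (x.1.le_of_mem ha) (fun h => x.2 (h ▸ ha))
  have := Finset.card_le_card h
  rwa [x.1.card_eq, Finset.card_range] at this

lemma mem_lt (x : LeftIState n k) {a : ℕ} (ha : a ∈ x.1.1) : a < n :=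
  lt_of_le_of_ne (x.1.le_of_mem ha) (fun h => x.2 (h ▸ ha))

/-- A left I-state from a set of positions. -/
def ofSet (s : Finset ℕ) (hs : ∀ a ∈ s, a < n) (hc : s.card = k) : LeftIState n k :=
  ⟨⟨s, Finset.mem_powersetCard.2 ⟨fun a ha => Finset.mem_range.2 ((hs a ha).trans (Nat.lt_succ_self n)), hc⟩⟩,
    fun h => lt_irrefl _ (hs n h)⟩

/-- `c` selects a line in each generating interval. -/
def IsChoice (x y : LeftIState n k) (c : ℕ × ℕ → ℕ) : Prop :=
  ∀ G ∈ x.1.genIntervals y.1, G.1 ≤ c G ∧ c G < G.1 + G.2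

variable {x y : LeftIState n k} {c : ℕ × ℕ → ℕ}

lemma IsChoice.injOn (hc : IsChoice x y c) :
    Set.InjOn c (x.1.genIntervals y.1 : Set (ℕ × ℕ)) := by
  intro G hG G' hG' h
  have a := hc G hG
  have b := hc G' hG'
  exact IState.genIntervals_unique hG hG' a.1 a.2 (h ▸ b.1) (h ▸ b.2)

lemma IsChoice.lt (hc : IsChoice x y c) {G : ℕ × ℕ} (hG : G ∈ x.1.genIntervals y.1) :
    c G < n := by
  have := hc G hG
  have := (IState.mem_genIntervals.1 hG).2.1
  omega

/-- The complement of the set of selected lines. -/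
def choiceSet (x y : LeftIState n k) (c : ℕ × ℕ → ℕ) : Finset ℕ :=
  Finset.range n \ (x.1.genIntervals y.1).image c

lemma IsChoice.card_ge (hc : IsChoice x y c) (t : ℕ) :
    ((choiceSet x y c).filter (t ≤ ·)).card +
      ((x.1.genIntervals y.1).filter (t ≤ c ·)).card = n - t := by
  rw [← Finset.card_image_of_injOn (s := (x.1.genIntervals y.1).filter (t ≤ c ·)) (f := c)
    (hc.injOn.mono (fun G hG => (Finset.mem_filter.1 hG).1)),
    ← Finset.card_union_of_disjoint]
  · rw [← Nat.card_Ico]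
    congr 1
    ext a
    simp only [choiceSet, Finset.mem_union, Finset.mem_filter, Finset.mem_sdiff, Finset.mem_range,
      Finset.mem_image, Finset.mem_Ico]
    constructor
    · rintro (⟨⟨h1, -⟩, h2⟩ | ⟨G, ⟨h1, h2⟩, rfl⟩)
      · exact ⟨h2, h1⟩
      · exact ⟨h2, hc.lt h1⟩
    · rintro ⟨h1, h2⟩
      by_cases h : ∃ G ∈ x.1.genIntervals y.1, c G = a
      · obtain ⟨G, hG, rfl⟩ := h
        exact Or.inr ⟨G, ⟨hG, h1⟩, rfl⟩
      · exact Or.inl ⟨⟨h2, h⟩, h1⟩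
  · rw [Finset.disjoint_left]
    intro a h1 h2
    rw [Finset.mem_filter, choiceSet, Finset.mem_sdiff] at h1
    obtain ⟨G, hG, rfl⟩ := Finset.mem_image.1 h2
    exact h1.1.2 (Finset.mem_image_of_mem _ (Finset.mem_filter.1 hG).1)

lemma IsChoice.card_choiceSet (hc : IsChoice x y c) (hf : ¬ x.1.TooFar y.1) :
    (choiceSet x y c).card = k := by
  have h := hc.card_ge 0
  rw [Finset.filter_true_of_mem (by simp), Finset.filter_true_of_mem (by simp),
    IState.card_genIntervals x.2 hf] at h
  have := x.k_le
  omega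

/-- The left I-state of a choice of lines. -/
def IsChoice.state (hc : IsChoice x y c) (hf : ¬ x.1.TooFar y.1) : LeftIState n k :=
  ofSet (choiceSet x y c)
    (fun _ ha => Finset.mem_range.1 (Finset.mem_sdiff.1 ha).1) (hc.card_choiceSet hf)

lemma IsChoice.state_v (hc : IsChoice x y c) (hf : ¬ x.1.TooFar y.1) (t : ℕ) :
    (hc.state hf).1.v t = ((choiceSet x y c).filter (t ≤ ·)).card := by
  unfold IState.v
  congr 1
  ext a
  change a ∈ choiceSet x y c ∩ _ ↔ _
  rw [Finset.mem_inter, Finset.mem_filter, Finset.mem_Icc]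
  constructor
  · rintro ⟨h1, h2, -⟩; exact ⟨h1, h2⟩
  · rintro ⟨h1, h2⟩
    exact ⟨h1, h2, (Finset.mem_range.1 (Finset.mem_sdiff.1 h1).1).le⟩

/-- Both sides are compared with the number of intervals to the right of the chosen line: `card_ge`
expresses the count of the state in terms of the chosen lines, and `card_genIntervals_ge` the
minimum of the counts of `x` and `y` in terms of the left ends. -/
lemma IsChoice.v_eq (hc : IsChoice x y c) (hf : ¬ x.1.TooFar y.1) {t : ℕ} (ht : t < n)
    (hts : t ∉ (hc.state hf).1.1) :
    x.1.v (t + 1) = (hc.state hf).1.v t ∧ y.1.v (t + 1) = (hc.state hf).1.v t := by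
  have : t ∈ (x.1.genIntervals y.1).image c := by
    by_contra h
    exact hts (Finset.mem_sdiff.2 ⟨Finset.mem_range.2 ht, h⟩)
  obtain ⟨G, hG, rfl⟩ := Finset.mem_image.1 this
  have hGc := hc G hG
  have e1 := hc.card_ge (c G)
  rw [← hc.state_v hf] at e1
  have e2 := IState.card_genIntervals_ge x.2 hf ht.le
  obtain ⟨-, g1, g2, -, g3, g4⟩ := IState.mem_genIntervals.1 hG
  have hv := g4 (c G) hGc.1 hGc.2
  have c1 := x.1.v_step (c G)
  have c2 := y.1.v_step (c G)
  -- By disjointness, an interval other than `G` has its chosen line at or after `c G` exactly when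
  -- the whole interval starts there.
  have hcong : (x.1.genIntervals y.1).filter (c G ≤ c ·) =
      insert G ((x.1.genIntervals y.1).filter (c G ≤ ·.1)) := by
    ext G'
    simp only [Finset.mem_filter, Finset.mem_insert]
    constructor
    · rintro ⟨h1, h2⟩
      by_cases e : G' = G
      · exact Or.inl e
      · refine Or.inr ⟨h1, ?_⟩
        by_contra hlt
        have := hc G' h1
        exact e (IState.genIntervals_unique (i := c G) h1 hG (by omega) (by omega) hGc.1 hGc.2)
    · rintro (rfl | ⟨h1, h2⟩)
      · exact ⟨hG, le_rfl⟩
      · exact ⟨h1, h2.trans (hc _ h1).1⟩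
  -- At the left end, `G` is already among the intervals starting at or after `c G`, and the region
  -- is not fully used. Inside `G`, it is one extra interval, compensated by the fully used region
  -- `c G`, which raises both counts by one.
  rcases hGc.1.eq_or_lt with h | h
  · have : G ∈ (x.1.genIntervals y.1).filter (c G ≤ ·.1) :=
      Finset.mem_filter.2 ⟨hG, h.ge⟩
    rw [hcong, Finset.insert_eq_self.2 this] at e1
    rw [h, Finset.mem_inter] at g2
    split_ifs at c1 c2 <;> first | omega | exact absurd ⟨‹_›, ‹_›⟩ g2
  · have : G ∉ (x.1.genIntervals y.1).filter (c G ≤ ·.1) := fun h' => by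
      have := (Finset.mem_filter.1 h').2
      omega
    rw [hcong, Finset.card_insert_of_notMem this] at e1
    have hm := Finset.mem_inter.1 (g3 _ h hGc.2)
    rw [if_pos hm.1] at c1
    rw [if_pos hm.2] at c2
    omega

lemma IsChoice.adm (hc : IsChoice x y c) (hf : ¬ x.1.TooFar y.1) :
    IState.Adm (hc.state hf).1 x.1 ∧ IState.Adm (hc.state hf).1 y.1 :=
  ⟨IState.adm_of_v fun _ ht hts => (hc.v_eq hf ht hts).1,
    IState.adm_of_v fun _ ht hts => (hc.v_eq hf ht hts).2⟩

end LeftIState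

/-! ### Products that vanish in `B(n, k)`. -/

section Vanishing

variable {K : Type u} [CommRing K] {n k : ℕ}

lemma f_mul_f_of_between {x y z : IState n k}
    (h : ∀ i, min (x.elt i) (y.elt i) ≤ z.elt i ∧ z.elt i ≤ max (x.elt i) (y.elt i)) :
    f K x z * f K z y = f K x y := by
  rw [f_comp]
  simp [IState.g_eq_zero h]

lemma RArrow_of_elt {z z' : IState n k} {i : Fin k} (h1 : z'.elt i = z.elt i + 1)
    (h2 : ∀ j, j ≠ i → z'.elt j = z.elt j) : RArrow (z.elt i + 1) z z' := by
  have hne : ∀ j, z.elt j ≠ z.elt i + 1 := fun j hj => by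
    by_cases e : j = i
    · subst e; omega
    · exact e (z'.elt_strictMono.injective (by rw [h1, h2 j e, hj]))
  constructor
  · ext a
    simp only [Finset.mem_inter, Finset.mem_insert, Finset.mem_singleton, Nat.add_sub_cancel,
      z.mem_iff]
    constructor
    · rintro ⟨⟨j, rfl⟩, h | h⟩
      · exact h
      · exact absurd h (hne j)
    · rintro rfl; exact ⟨⟨i, rfl⟩, Or.inl rfl⟩
  · ext a
    simp only [Finset.mem_union, Finset.mem_sdiff, Finset.mem_singleton, Nat.add_sub_cancel,
      IState.mem_iff]
    constructor
    · rintro ⟨j, rfl⟩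
      by_cases e : j = i
      · subst e; exact Or.inr h1
      · exact Or.inl ⟨⟨j, (h2 j e).symm⟩, fun h => e (z.elt_strictMono.injective (by
          rw [← h2 j e, h]))⟩
    · rintro (⟨⟨j, rfl⟩, h⟩ | rfl)
      · have e : j ≠ i := fun e => h (by rw [e])
        exact ⟨j, h2 j e⟩
      · exact ⟨i, h1⟩

/-- The arrow `f_{x,y}` factors through two consecutive right moves of the `i`-th element, hence
through a product of an `R_{a+1}` arrow and an `R_{a+2}` arrow with `a = x_i`, which is zero. -/
lemma f_eq_zero_of_add_two_le {x y : IState n k} {i : Fin k} (h : x.elt i + 2 ≤ y.elt i) :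
    f K x y = 0 := by
  -- The elements above the `i`-th are moved to their places in `y` first, which makes room for it;
  -- those below still sit where they are in `x`. Only `t = 0, 1, 2` matter, and the cap `min t 2`
  -- keeps the sequence valid for every `t`.
  let e : ℕ → Fin k → ℕ := fun t j =>
    if j < i then x.elt j else if j = i then x.elt i + min t 2 else y.elt j
  have he : ∀ t, StrictMono (e t) := by
    intro t a b hab
    have := x.elt_strictMono hab
    have := y.elt_strictMono hab
    simp only [e]
    by_cases ha : a < i
    · by_cases hb : b < i
      · rwa [if_pos ha, if_pos hb]
      · rw [if_pos ha, if_neg hb]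
        have := x.elt_strictMono ha
        split_ifs with hb'
        · omega
        · have := y.elt_strictMono (lt_of_le_of_ne (not_lt.1 hb) (Ne.symm hb'))
          omega
    · have hb : i < b := lt_of_le_of_lt (not_lt.1 ha) hab
      rw [if_neg ha, if_neg hb.not_gt, if_neg hb.ne']
      have := y.elt_strictMono hb
      split_ifs
      · omega
      · assumption
  have hn : ∀ t j, e t j ≤ n := by
    intro t j
    have := x.elt_le j
    have := y.elt_le j
    have := y.elt_le i
    simp only [e]
    split_ifs <;> omega
  let z : ℕ → IState n k := fun t => IState.ofFun (e t) (he t) (hn t)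
  have hz : ∀ t j, (z t).elt j = e t j := fun t j => IState.elt_ofFun _ _ _ j
  have hi : ∀ t, (z t).elt i = x.elt i + min t 2 := fun t => by
    rw [hz]; simp [e]
  have hj : ∀ t t' j, j ≠ i → (z t).elt j = (z t').elt j := by
    intro t t' j hj
    rw [hz, hz]; simp [e, hj]
  have hR : ∀ t, t + 1 ≤ 2 → RArrow (x.elt i + t + 1) (z t) (z (t + 1)) := by
    intro t ht
    have h0 := hi t
    rw [min_eq_left (by omega)] at h0
    rw [← h0]
    refine RArrow_of_elt ?_ (fun j h' => hj _ _ j h')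
    rw [hi, hi]
    omega
  have key : f K (z 0) (z 2) = 0 := by
    rw [← f_mul_f_of_between (z := z 1)]
    · have := y.elt_le i
      exact f_RR (x.elt i + 1 + 1) (by omega) (by omega) (hR 0 (by omega)) (hR 1 le_rfl)
    · intro j
      by_cases e : j = i
      · subst e; rw [hi, hi, hi]; omega
      · rw [hj 1 0 j e, hj 2 0 j e]; simp
  have key2 : f K (z 0) y = 0 := by
    rw [← f_mul_f_of_between (z := z 2), key, zero_mul]
    intro j
    rw [hz, hz]
    simp only [e]
    split_ifs with h1 h2
    · simp
    · subst h2; omega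
    · simp
  rw [← f_mul_f_of_between (z := z 0), key2, mul_zero]
  intro j
  rw [hz]
  simp only [e]
  split_ifs with h1 h2
  · simp
  · subst h2; simp
  · simp

lemma f_eq_zero_symm {x y : IState n k} (h : f K x y = 0) : f K y x = 0 := by
  have := psiB_f (K := K) x y
  rw [h, map_zero] at this
  exact (MulOpposite.op_eq_zero_iff _).1 this.symm

lemma f_eq_zero_of_tooFar {x y : IState n k} (h : x.TooFar y) : f K x y = 0 := by
  obtain ⟨i, hi⟩ := h
  rcases le_total (x.elt i) (y.elt i) with hle | hle
  · exact f_eq_zero_of_add_two_le (i := i) (by omega)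
  · exact f_eq_zero_symm (f_eq_zero_of_add_two_le (i := i) (by omega))

/-- The indicator function of the lines `j + 1, …, j + l`. -/
def blockInd (n j l : ℕ) (i : Fin n) : ℕ := if j ≤ i ∧ (i : ℕ) < j + l then 1 else 0

/-- Induction on the length. For one line this is the defining relation `U_i I_z = 0`. Otherwise
`U_{j+1} I_z` is the round trip that moves the element `j + 1` to the empty region `j` and back. At
the intermediate state region `j + 1` is empty, so the remaining variables form a shorter block that
kills its idempotent. -/
lemma Umon_blockInd_smul_idem (l : ℕ) : ∀ (j : ℕ) (z : IState n k), j + (l + 1) ≤ n → j ∉ z.1 →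
    j + (l + 1) ∉ z.1 → (∀ m, j < m → m < j + (l + 1) → m ∈ z.1) →
    Umon K (blockInd n j (l + 1)) • f K z z = 0 := by
  induction l with
  | zero =>
    intro j z hn h1 h2 _
    have : Umon K (blockInd n j (0 + 1)) = (MvPolynomial.X ⟨j, by omega⟩ : URing K n) := by
      rw [Umon, Finset.prod_eq_single ⟨j, by omega⟩]
      · simp [blockInd]
      · intro b _ hb
        have : ¬ (j ≤ b ∧ (b : ℕ) < j + (0 + 1)) := fun h => hb (Fin.ext (by simp only; omega))
        rw [blockInd, if_neg this, pow_zero]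
      · simp
    rw [this]
    refine f_U _ _ ?_
    ext a
    simp only [Finset.mem_inter, Finset.mem_insert, Finset.mem_singleton, Finset.notMem_empty,
      iff_false]
    rintro ⟨ha, rfl | rfl⟩
    · exact h1 ha
    · exact h2 ha
  | succ l ih =>
    intro j z hn h1 h2 h3
    obtain ⟨i, hi⟩ := (z.mem_iff (j + 1)).1 (h3 (j + 1) (by omega) (by omega))
    let e : Fin k → ℕ := fun a => if a = i then j else z.elt a
    have hlt : ∀ a, a < i → z.elt a < j := fun a ha => by
      have h := z.elt_strictMono ha
      have : z.elt a ≠ j := fun h => h1 (h ▸ z.elt_mem a)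
      omega
    have he : StrictMono e := by
      intro a b hab
      have := z.elt_strictMono hab
      have := hlt a
      simp only [e]
      split_ifs with ha hb hb
      · subst ha; subst hb; exact absurd hab (lt_irrefl _)
      · subst ha; omega
      · subst hb; exact this hab
      · assumption
    have hen : ∀ a, e a ≤ n := fun a => by
      have := z.elt_le a
      simp only [e]; split_ifs <;> omega
    let z' : IState n k := IState.ofFun e he hen
    have hz' : ∀ a, z'.elt a = e a := IState.elt_ofFun e he hen
    have hmem : ∀ a, a ≠ j → a ≠ j + 1 → (a ∈ z'.1 ↔ a ∈ z.1) := by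
      intro a ha ha'
      rw [z.mem_iff, z'.mem_iff]
      simp only [hz', e]
      constructor
      · rintro ⟨b, hb⟩
        split_ifs at hb
        · omega
        · exact ⟨b, hb⟩
      · rintro ⟨b, hb⟩
        refine ⟨b, ?_⟩
        rw [if_neg, hb]
        rintro rfl; omega
    have hj1 : j + 1 ∉ z'.1 := by
      rw [z'.mem_iff]
      rintro ⟨b, hb⟩
      rw [hz'] at hb
      simp only [e] at hb
      split_ifs at hb with h
      · omega
      · exact h (z.elt_strictMono.injective (hb.trans hi.symm))
    have hv : ∀ m, m ≠ j + 1 → z.v m = z'.v m := by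
      intro m hm
      refine le_antisymm (IState.v_le_v_of fun a ha => ?_) (IState.v_le_v_of fun a ha => ?_)
      · rw [hz']; simp only [e]; split_ifs with h
        · subst h; omega
        · exact ha
      · rw [hz'] at ha; simp only [e] at ha; split_ifs at ha with h
        · subst h; omega
        · exact ha
    have hv1 : z.v (j + 1) = z'.v (j + 1) + 1 := by
      have a := z.v_step (j + 1)
      have b := z'.v_step (j + 1)
      rw [if_pos (hi ▸ z.elt_mem i)] at a
      rw [if_neg hj1] at b
      have := hv (j + 1 + 1) (by omega)
      omega
    -- The counting functions of `z` and `z'` differ only at line `j + 1`, and there by one, so the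
    -- exponent of the round trip is one at this line and zero elsewhere.
    have hX : f K z z' * f K z' z = (MvPolynomial.X ⟨j, by omega⟩ : URing K n) • f K z z := by
      rw [f_comp]
      congr 1
      rw [Finset.prod_eq_single ⟨j, by omega⟩]
      · have : z.g z' z (j + 1) = 1 := by
          unfold IState.g IState.twoW; omega
        simp only [this, pow_one]
      · intro b _ hb
        have hb' : (b : ℕ) + 1 ≠ j + 1 := fun h => hb (Fin.ext (by simp only; omega))
        have : z.g z' z (b + 1) = 0 := by
          have := hv _ hb'
          unfold IState.g IState.twoW; omega
        rw [this, pow_zero]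
      · simp
    have hU : Umon K (blockInd n j (l + 1 + 1)) =
        Umon K (blockInd n (j + 1) (l + 1)) * (MvPolynomial.X ⟨j, by omega⟩ : URing K n) := by
      have : (MvPolynomial.X ⟨j, by omega⟩ : URing K n) = Umon K (Pi.single ⟨j, by omega⟩ 1) := by
        simp [Umon, Pi.single_apply, Finset.prod_ite_eq', pow_ite]
      rw [this, Umon_mul]
      congr 1
      funext b
      simp only [Pi.add_apply, Pi.single_apply, blockInd, Fin.ext_iff]
      split_ifs <;> omega
    rw [hU, mul_smul, ← hX, ← f_right z z', mul_assoc, ← mul_smul_comm, ← smul_mul_assoc,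
      ih (j + 1) z' (by omega) hj1 ?_ ?_, zero_mul, mul_zero]
    · rw [hmem _ (by omega) (by omega), show j + 1 + (l + 1) = j + (l + 1 + 1) by omega]
      exact h2
    · intro m hm1 hm2
      rw [hmem _ (by omega) (by omega)]
      exact h3 m (by omega) (by omega)

/-- The arrow `f_{x,y}` factors through a state `z` between `x` and `y` that avoids both ends of the
interval and contains its interior, and the block of variables already kills `I_z`. -/
lemma Umon_blockInd_smul {x y : IState n k} {G : ℕ × ℕ} (hG : G ∈ x.genIntervals y) :
    Umon K (blockInd n G.1 G.2) • f K x y = 0 := by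
  obtain ⟨j, l⟩ := G
  obtain ⟨h1, h2, h3, h4, h5, h6⟩ := IState.mem_genIntervals.1 hG
  simp only at h1 h2 h3 h4 h5 h6
  have hleft : ∀ i, j + 1 ≤ x.elt i ↔ j + 1 ≤ y.elt i := fun i => by
    rw [IState.le_elt_iff, IState.le_elt_iff, h6 j le_rfl (by omega)]
  have hright : ∀ i, j + l ≤ x.elt i ↔ j + l ≤ y.elt i := fun i => by
    obtain ⟨l, rfl⟩ := Nat.exists_eq_add_of_le' h1
    rw [IState.le_elt_iff, IState.le_elt_iff, ← add_assoc, h6 (j + l) (by omega) (by omega)]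
  have hsrc : ∀ a, a ∉ x.1 ∩ y.1 → ∃ w : IState n k, (w = x ∨ w = y) ∧ a ∉ w.1 := by
    intro a ha
    by_cases h : a ∈ x.1
    · exact ⟨y, Or.inr rfl, fun h' => ha (Finset.mem_inter.2 ⟨h, h'⟩)⟩
    · exact ⟨x, Or.inl rfl, h⟩
  obtain ⟨wl, hwl, hjl⟩ := hsrc _ h3
  obtain ⟨wr, hwr, hjr⟩ := hsrc _ h4
  have hwl1 : ∀ i, j + 1 ≤ wl.elt i ↔ j + 1 ≤ x.elt i := by
    rcases hwl with rfl | rfl <;> simp [hleft]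
  have hwr1 : ∀ i, j + l ≤ wr.elt i ↔ j + l ≤ x.elt i := by
    rcases hwr with rfl | rfl <;> simp [hright]
  have hwl2 : ∀ i, wl.elt i ≠ j := fun i h => hjl (h ▸ wl.elt_mem i)
  have hwr2 : ∀ i, wr.elt i ≠ j + l := fun i h => hjr (h ▸ wr.elt_mem i)
  -- One of `x`, `y` misses region `j` and one misses `j + l`; these are `wl` and `wr`. Since no
  -- line of the interval is crossed, `x` and `y` have the same indices to its left, inside and to
  -- its right, so the left part of `wl`, the interior and the right part of `wr` can be glued.
  let e : Fin k → ℕ := fun i =>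
    if j + l ≤ x.elt i then wr.elt i else if j + 1 ≤ x.elt i then x.elt i else wl.elt i
  have he : StrictMono e := by
    intro a b hab
    have := x.elt_strictMono hab
    have := wl.elt_strictMono hab
    have := wr.elt_strictMono hab
    have := hwl1 a
    have := hwl1 b
    have := hwr1 a
    have := hwr1 b
    have := hwl2 a
    have := hwr2 b
    simp only [e]
    split_ifs <;> omega
  have hen : ∀ i, e i ≤ n := fun i => by
    have := x.elt_le i
    have := wl.elt_le i
    have := wr.elt_le i
    simp only [e]
    split_ifs <;> omega
  let z : IState n k := IState.ofFun e he hen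
  have hz : ∀ a, z.elt a = e a := IState.elt_ofFun e he hen
  have hbet : ∀ i, min (x.elt i) (y.elt i) ≤ z.elt i ∧ z.elt i ≤ max (x.elt i) (y.elt i) := by
    intro i
    rw [hz]
    simp only [e]
    split_ifs
    · rcases hwr with rfl | rfl <;> simp
    · simp
    · rcases hwl with rfl | rfl <;> simp
  have hzj : j ∉ z.1 := by
    rw [z.mem_iff]
    rintro ⟨i, hi⟩
    have := hwl2 i
    have := hwr1 i
    rw [hz] at hi
    simp only [e] at hi
    split_ifs at hi <;> omega
  have hzl : j + l ∉ z.1 := by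
    rw [z.mem_iff]
    rintro ⟨i, hi⟩
    have := hwr2 i
    have := hwl1 i
    rw [hz] at hi
    simp only [e] at hi
    split_ifs at hi <;> omega
  have hzm : ∀ m, j < m → m < j + l → m ∈ z.1 := by
    intro m a b
    obtain ⟨i, hi⟩ := (x.mem_iff m).1 (Finset.mem_inter.1 (h5 m a b)).1
    rw [z.mem_iff]
    refine ⟨i, ?_⟩
    rw [hz]
    simp only [e]
    split_ifs <;> omega
  obtain ⟨l, rfl⟩ := Nat.exists_eq_add_of_le' h1
  rw [← f_mul_f_of_between hbet, ← f_left z y, ← mul_smul_comm, ← smul_mul_assoc,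
    Umon_blockInd_smul_idem l j z h2 hzj hzl hzm, zero_mul, mul_zero]

lemma Umon_smul_eq_zero {x y : IState n k} {m : Fin n → ℕ} {G : ℕ × ℕ}
    (hG : G ∈ x.genIntervals y) (h : ∀ i : Fin n, G.1 ≤ i → (i : ℕ) < G.1 + G.2 → m i ≠ 0) :
    Umon K m • f K x y = 0 := by
  have : m = (m - blockInd n G.1 G.2) + blockInd n G.1 G.2 := by
    funext i
    have := h i
    simp only [Pi.add_apply, Pi.sub_apply, blockInd]
    split_ifs with h'
    · have := this h'.1 h'.2; omega
    · omega
  rw [this, ← Umon_mul, mul_smul, Umon_blockInd_smul hG, smul_zero]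

end Vanishing

/-! ### Matrix representations of `B(n, k)` that detect monomials. -/

section Representation

variable (K : Type u) [CommRing K] {n k : ℕ}

/-- Polynomials in square roots of the variables `U_1, …, U_n`. -/
def RootRing (_s : IState n k) : Type u := MvPolynomial (Fin n) K

instance (s : IState n k) : CommRing (RootRing K s) :=
  inferInstanceAs (CommRing (MvPolynomial (Fin n) K))

/-- The ring map that takes `U_i` to the square of a variable if `i` is a position of `s`, and to
zero otherwise. -/
def rootHom (s : IState n k) : URing K n →+* URing K n :=
  MvPolynomial.eval₂Hom MvPolynomial.C
    (fun i => if (i : ℕ) ∈ s.1 then MvPolynomial.X i ^ 2 else 0)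

/-- The index `s` of `RootRing` makes room for this structure, which depends on `s` and differs from
the action of the polynomial ring on itself by multiplication. -/
instance (s : IState n k) : Algebra (URing K n) (RootRing K s) :=
  RingHom.toAlgebra (show URing K n →+* RootRing K s from rootHom K s)

/-- A monomial in the square roots. -/
def rootMon (s : IState n k) (m : Fin n → ℕ) : RootRing K s := Umon K m

lemma rootMon_mul (s : IState n k) (m m' : Fin n → ℕ) :
    rootMon K s m * rootMon K s m' = rootMon K s (m + m') :=
  Umon_mul (K := K) m m'

lemma smul_rootMon (s : IState n k) (p : URing K n) (m : Fin n → ℕ) :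
    p • rootMon K s m = (show RootRing K s from rootHom K s p * Umon K m) := rfl

lemma rootHom_X (s : IState n k) (i : Fin n) : rootHom K s (MvPolynomial.X i) =
    if (i : ℕ) ∈ s.1 then MvPolynomial.X i ^ 2 else 0 := by
  rw [rootHom, MvPolynomial.coe_eval₂Hom, MvPolynomial.eval₂_X]

lemma rootHom_Umon (s : IState n k) (m : Fin n → ℕ) (hm : ∀ i : Fin n, (i : ℕ) ∉ s.1 → m i = 0) :
    rootHom K s (Umon K m) = Umon K (2 * m) := by
  rw [Umon, Umon, map_prod]
  refine Finset.prod_congr rfl fun i _ => ?_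
  rw [map_pow, rootHom_X]
  by_cases h : (i : ℕ) ∈ s.1
  · rw [if_pos h, ← pow_mul]; rfl
  · simp [hm i h]

lemma rootHom_Umon_zero (s : IState n k) (m : Fin n → ℕ) (i : Fin n) (hi : (i : ℕ) ∉ s.1)
    (hm : m i ≠ 0) : rootHom K s (Umon K m) = 0 := by
  rw [Umon, map_prod]
  refine Finset.prod_eq_zero (Finset.mem_univ i) ?_
  rw [map_pow, rootHom_X, if_neg hi, zero_pow hm]

lemma Umon_smul_rootMon (s : IState n k) (m m' : Fin n → ℕ)
    (hm : ∀ i : Fin n, (i : ℕ) ∉ s.1 → m i = 0) :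
    Umon K m • rootMon K s m' = rootMon K s (2 * m + m') := by
  have h : rootHom K s (Umon K m) * Umon K m' = Umon K (2 * m + m') := by
    rw [rootHom_Umon K s m hm, Umon_mul]
  exact h

lemma Umon_smul_rootMon_zero (s : IState n k) (m m' : Fin n → ℕ) (i : Fin n)
    (hi : (i : ℕ) ∉ s.1) (hm : m i ≠ 0) : Umon K m • rootMon K s m' = 0 := by
  have h : rootHom K s (Umon K m) * Umon K m' = 0 := by
    rw [rootHom_Umon_zero K s m i hi hm, zero_mul]
  exact h

lemma IState.Adm.twoW_eq_zero {s x y : IState n k} (hx : s.Adm x) (hy : s.Adm y) {i : ℕ}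
    (hi : i ∉ s.1) : x.twoW y (i + 1) = 0 := by
  have := hx.v_eq hi
  have := hy.v_eq hi
  unfold IState.twoW
  omega

open Classical in
/-- The matrix by which `f_{x,y}` acts in the representation attached to `s`. -/
def repMat (s x y : IState n k) :
    Matrix {x : IState n k // s.Adm x} {x : IState n k // s.Adm x} (RootRing K s) :=
  if h : s.Adm x ∧ s.Adm y then
    Matrix.single ⟨x, h.1⟩ ⟨y, h.2⟩ (rootMon K s fun i => x.twoW y (i + 1)) else 0

/-- For admissible states this is `two_g` written with exponents of square roots: `U_i` acts as `X_i
^ 2`, and twice `g` is the defect of additivity of `twoW`. Lines outside `s` cause no trouble, since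
all admissible states have the same count there. -/
lemma repMat_comp (s x y z : IState n k) : repMat K s x y * repMat K s y z =
    (∏ i : Fin n, (MvPolynomial.X i : URing K n) ^ x.g y z (i + 1)) • repMat K s x z := by
  classical
  change _ = Umon K (fun i : Fin n => x.g y z (i + 1)) • _
  by_cases hx : s.Adm x
  swap
  · simp [repMat, hx]
  by_cases hz : s.Adm z
  swap
  · simp [repMat, hz]
  have hxz : repMat K s x z = Matrix.single ⟨x, hx⟩ ⟨z, hz⟩
      (rootMon K s fun i => x.twoW z (i + 1)) := by
    rw [repMat, dif_pos ⟨hx, hz⟩]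
  rw [hxz, Matrix.smul_single]
  by_cases hy : s.Adm y
  · rw [repMat, repMat, dif_pos ⟨hx, hy⟩, dif_pos ⟨hy, hz⟩, Matrix.single_mul_single_same,
      rootMon_mul, Umon_smul_rootMon]
    · congr 2
      funext i
      simp only [Pi.add_apply, Pi.mul_apply]
      exact (IState.two_g x y z (i + 1)).symm
    · intro i hi
      have := IState.two_g x y z (i + 1)
      rw [hx.twoW_eq_zero hy hi, hy.twoW_eq_zero hz hi] at this
      omega
  -- The left side is zero when the middle state is not admissible. By `adm_of_v` its count then
  -- differs from the common count of `x` and `z` at some line outside `s`, so the exponent of the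
  -- corresponding variable, which acts as zero, is positive.
  · have : ∃ t < n, t ∉ s.1 ∧ y.v (t + 1) ≠ s.v t := by
      by_contra hcon
      push Not at hcon
      exact hy (IState.adm_of_v hcon)
    obtain ⟨t, htn, hts, hyt⟩ := this
    rw [Umon_smul_rootMon_zero K s _ _ ⟨t, htn⟩ hts]
    · simp [repMat, hy]
    · have := hx.v_eq hts
      have := hz.v_eq hts
      simp only
      unfold IState.g IState.twoW
      omega

lemma repMat_not_comp (s x y y' z : IState n k) (h : y ≠ y') :
    repMat K s x y * repMat K s y' z = 0 := by
  classical
  unfold repMat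
  split_ifs
  · rw [Matrix.single_mul_single_of_ne]
    intro e
    exact h (congrArg Subtype.val e)
  all_goals simp

lemma repMat_one (s : IState n k) : ∑ x, repMat K s x x = 1 := by
  classical
  have : ∀ x : IState n k, repMat K s x x =
      if h : s.Adm x then Matrix.single ⟨x, h⟩ ⟨x, h⟩ (1 : RootRing K s) else 0 := by
    intro x
    unfold repMat
    by_cases h : s.Adm x
    · rw [dif_pos ⟨h, h⟩, dif_pos h]
      congr 1
      simp only [IState.twoW_self]
      have h1 : Umon K (fun _ : Fin n => 0) = 1 := Finset.prod_eq_one fun i _ => pow_zero _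
      exact h1
    · simp [h]
  simp only [this]
  rw [Finset.sum_dite, Finset.sum_const_zero, add_zero]
  ext a b
  rw [Matrix.sum_apply, Matrix.one_apply]
  simp only [Matrix.single_apply]
  split_ifs with hab
  · subst hab
    rw [Finset.sum_eq_single ⟨a.1, by simp [a.2]⟩]
    · simp
    · intro c _ hc
      rw [if_neg]
      rintro ⟨rfl, -⟩
      exact hc rfl
    · simp
  · refine Finset.sum_eq_zero fun c _ => ?_
    rw [if_neg]
    rintro ⟨rfl, h⟩
    exact hab h

lemma repMat_mul_eq_zero {s x y z : IState n k} (h : s.Adm x → s.Adm z → False) :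
    repMat K s x y * repMat K s y z = 0 := by
  unfold repMat
  split_ifs with h1 h2
  · exact (h h1.1 h2.2).elim
  all_goals simp

lemma RArrow.mem_mem {i : ℕ} (hi : 1 ≤ i) {x y : IState n k} (h : RArrow i x y) :
    i - 1 ∈ x.1 ∧ i ∉ x.1 ∧ i ∈ y.1 ∧ i - 1 ∉ y.1 ∧ ∀ a, a ≠ i → a ≠ i - 1 → (a ∈ x.1 ↔ a ∈ y.1) := by
  obtain ⟨h1, h2⟩ := h
  have e : ∀ a, a ∈ x.1 ∩ {i - 1, i} ↔ a ∈ ({i - 1} : Finset ℕ) := fun a => by rw [h1]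
  simp only [Finset.mem_inter, Finset.mem_insert, Finset.mem_singleton] at e
  have a1 := e i
  have a2 := e (i - 1)
  have hne : i ≠ i - 1 := by omega
  rw [h2]
  simp only [Finset.mem_union, Finset.mem_sdiff, Finset.mem_singleton]
  refine ⟨by tauto, by tauto, by tauto, ?_, fun a h h' => by tauto⟩
  rintro (h | h)
  · simp at h
  · exact hne h.symm

lemma RArrow.v_eq {i : ℕ} (hi : 1 ≤ i) {x y : IState n k} (h : RArrow i x y) :
    y.v i = x.v i + 1 ∧ ∀ m, m ≠ i → y.v m = x.v m := by
  obtain ⟨h1, h2, h3, h4, h5⟩ := h.mem_mem hi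
  have key : ∀ r m, n + 1 ≤ m + r → i < m → y.v m = x.v m := by
    intro r
    induction r with
    | zero => intro m hm _; rw [x.v_of_lt (by omega), y.v_of_lt (by omega)]
    | succ r ih =>
      intro m hm hi
      rw [x.v_step, y.v_step, ih (m + 1) (by omega) (by omega)]
      simp only [h5 m (by omega) (by omega)]
  have ki : y.v i = x.v i + 1 := by
    rw [x.v_step, y.v_step, key (n + 1) (i + 1) (by omega) (by omega), if_neg h2, if_pos h3]
  refine ⟨ki, ?_⟩
  have key2 : ∀ r, ∀ m, m + r = i - 1 → y.v m = x.v m := by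
    intro r
    induction r with
    | zero =>
      intro m hm
      have a := x.v_step m
      have b := y.v_step m
      rw [add_zero] at hm
      rw [show m + 1 = i by omega] at a b
      subst hm
      rw [if_pos h1] at a
      rw [if_neg h4] at b
      omega
    | succ r ih =>
      intro m hm
      rw [x.v_step, y.v_step, ih (m + 1) (by omega)]
      simp only [h5 m (by omega) (by omega)]
  intro m hm
  rcases lt_or_gt_of_ne hm with h | h
  · exact key2 (i - 1 - m) m (by omega)
  · exact key (n + 1) m (by omega) h

/-- With `i = j + 2`, the second move raises the count at line `j + 2` by one and the first does not
change it. Admissibility of `x` and `z` gives `z.v (j + 2) ≤ s.v (j + 1) ≤ x.v (j + 1)`, and the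
last equals `x.v (j + 2)` because `j + 1 ∉ x`. -/
lemma repMat_RR {s : IState n k} {i : ℕ} (hi : 2 ≤ i) {x y z : IState n k}
    (hx : RArrow (i - 1) x y) (hy : RArrow i y z) (h1 : s.Adm x) (h3 : s.Adm z) :
    False := by
  obtain ⟨j, rfl⟩ := Nat.exists_eq_add_of_le' hi
  rw [show j + 2 - 1 = j + 1 by omega] at hx
  have a : y.v (j + 2) = x.v (j + 2) := (hx.v_eq (by omega)).2 _ (by omega)
  have b : z.v (j + 2) = y.v (j + 2) + 1 := (hy.v_eq (by omega)).1
  have c : s.v (j + 1) ≤ x.v (j + 1) := (h1.v_le _).2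
  have d : z.v (j + 2) ≤ s.v (j + 1) := (h3.v_le _).1
  have e := x.v_step (j + 1)
  rw [if_neg (hx.mem_mem (by omega)).2.1, add_zero] at e
  have e' : x.v (j + 1) = x.v (j + 2) := e
  omega

/-- A line of `s` is matched with one of its two adjacent regions in `x`; if both are unused the
line is not in `s`, and its variable acts as zero. -/
lemma repMat_U {s : IState n k} {i : ℕ} {x : IState n k} (hx : s.Adm x)
    (h : x.1 ∩ {i, i + 1} = ∅) : i ∉ s.1 := by
  intro hi
  have e : ∀ a, a ∉ x.1 ∩ {i, i + 1} := fun a => by rw [h]; simp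
  simp only [Finset.mem_inter, Finset.mem_insert, Finset.mem_singleton] at e
  have s1 := s.v_step i
  have s2 := x.v_step i
  have s3 := x.v_step (i + 1)
  rw [if_pos hi] at s1
  rw [if_neg (by have := e i; tauto)] at s2
  rw [if_neg (by have := e (i + 1); tauto)] at s3
  have := hx.v_le i
  have := hx.v_le (i + 1)
  omega

open Classical in
/-- The representation of `B(n, k)` attached to `s`. -/
def rep (s : IState n k) : B K n k →ₐ[URing K n]
    Matrix {x : IState n k // s.Adm x} {x : IState n k // s.Adm x} (RootRing K s) :=
  liftB' (repMat K s) (repMat_comp K s) (repMat_not_comp K s) (repMat_one K s)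
    (fun _ hi _ _ _ _ hx hy => repMat_mul_eq_zero K (repMat_RR hi hx hy))
    (fun i hi _ _ _ _ hx hy => repMat_mul_eq_zero K fun h1 h3 =>
      repMat_RR hi ((arrow_symm _ (by omega) _ _).2 hy) ((arrow_symm _ (by omega) _ _).2 hx) h3 h1)
    (fun i x hx => by
      by_cases h : s.Adm x
      · rw [repMat, dif_pos ⟨h, h⟩, Matrix.smul_single]
        have : (MvPolynomial.X i : URing K n) • (rootMon K s fun i => x.twoW x (i + 1)) = 0 := by
          rw [smul_rootMon, rootHom_X, if_neg (repMat_U h hx), zero_mul]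
          rfl
        rw [this, Matrix.single_zero]
      · simp [repMat, h])

lemma rep_f (s x y : IState n k) : rep K s (f K x y) = repMat K s x y :=
  liftB'_f _ _ _ _ _ _ _ _ _

/-- The entry at `(x, y)` of the matrix of `p f_{x,y}` is `rootHom K s p` times a nonzero monomial,
which can be cancelled in the polynomial ring. -/
lemma rootHom_eq_zero_of_smul_f {s x y : IState n k} [IsDomain K] (hx : s.Adm x) (hy : s.Adm y)
    {p : URing K n} (h : p • f K x y = 0) : rootHom K s p = 0 := by
  classical
  have := congrArg (rep K s) h
  rw [map_smul, map_zero, rep_f, repMat, dif_pos ⟨hx, hy⟩, Matrix.smul_single] at this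
  have := congrFun (congrFun this ⟨x, hx⟩) ⟨y, hy⟩
  rw [Matrix.single_apply_same, smul_rootMon, Matrix.zero_apply] at this
  have h' : rootHom K s p * Umon K (fun i : Fin n => x.twoW y (i + 1)) = 0 := this
  refine (mul_eq_zero.1 h').resolve_right ?_
  exact Finset.prod_ne_zero_iff.2 fun i _ => pow_ne_zero _ (MvPolynomial.X_ne_zero i)

end Representation

/-! ### Graded dimensions as Laurent expansions in `q`. -/

section GradedDimension

variable {K : Type*} [Field K] {M : Type*} [AddCommGroup M] [Module K M]

lemma coe_q : ((q : RatFunc ℂ) : LaurentSeries ℂ) = HahnSeries.single 1 1 := RatFunc.coe_X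

lemma coe_q_zpow (a : ℤ) : ((q ^ a : RatFunc ℂ) : LaurentSeries ℂ) = HahnSeries.single a 1 := by
  rw [map_zpow₀, coe_q, ← RatFunc.single_zpow]

lemma coeff_q_zpow_mul (a : ℤ) (r : RatFunc ℂ) (d : ℤ) :
    HahnSeries.coeff ((q ^ a * r : RatFunc ℂ) : LaurentSeries ℂ) d =
      HahnSeries.coeff (r : LaurentSeries ℂ) (d - a) := by
  rw [map_mul, coe_q_zpow, HahnSeries.coeff_single_mul, one_mul]

lemma HasGrDim.unique {ℳ : ℤ → Submodule K M} {r r' : RatFunc ℂ} (h : HasGrDim ℳ r)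
    (h' : HasGrDim ℳ r') : r = r' := by
  refine RingHom.injective _ (?_ : (r : LaurentSeries ℂ) = (r' : LaurentSeries ℂ))
  ext d
  rw [(h d).2, (h' d).2]

lemma HasGrDim.shift {ℳ : ℤ → Submodule K M} {r : RatFunc ℂ} (h : HasGrDim ℳ r) (a : ℤ) :
    HasGrDim (fun d => ℳ (d - a)) (q ^ a * r) := fun d =>
  ⟨(h (d - a)).1, by rw [coeff_q_zpow_mul, (h (d - a)).2]⟩

end GradedDimension

/-! ### Counting monomials that omit a variable of each block. -/

section Counting

open Finset in
/-- The set of monomials that vanish somewhere on each block and have a given degree. -/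
def avoiding {n : ℕ} {ι : Type*} (T : Finset ι) (b : ι → Finset (Fin n)) (e : ℕ) :
    Set (Fin n → ℕ) := {m | (∀ G ∈ T, ∃ i ∈ b G, m i = 0) ∧ 2 * ∑ i, m i = e}

lemma avoiding_finite {n : ℕ} {ι : Type*} (T : Finset ι) (b : ι → Finset (Fin n)) (e : ℕ) :
    (avoiding T b e).Finite := by
  refine (Set.Finite.pi' (t := fun _ : Fin n => Set.Iic e) fun _ => Set.finite_Iic e).subset ?_
  rintro m ⟨-, hm⟩ i
  have := Finset.single_le_sum (f := m) (fun _ _ => Nat.zero_le _) (Finset.mem_univ i)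
  rw [Set.mem_Iic]
  omega

/-- The generating function of the monomials that vanish somewhere on each block. -/
def avoidingSeries {n : ℕ} {ι : Type*} (T : Finset ι) (b : ι → Finset (Fin n)) : PowerSeries ℂ :=
  PowerSeries.mk fun e => ((avoiding T b e).ncard : ℂ)

/-- A monomial that does not vanish anywhere on the new block is divisible by the product of its
variables. Dividing by this product lowers the degree by `2 * (b G).card` and, as the blocks are
disjoint, does not affect the conditions at the other blocks. -/
lemma avoiding_card_insert {n : ℕ} {ι : Type*} [DecidableEq ι] (T : Finset ι)
    (b : ι → Finset (Fin n)) (G : ι) (hG : ∀ G' ∈ T, Disjoint (b G') (b G)) (e : ℕ) :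
    (avoiding T b e).ncard = (avoiding (insert G T) b e).ncard +
      if 2 * (b G).card ≤ e then (avoiding T b (e - 2 * (b G).card)).ncard else 0 := by
  let ind : Fin n → ℕ := fun i => if i ∈ b G then 1 else 0
  have hind : ∑ i, ind i = (b G).card := by simp [ind]
  have hsplit : avoiding T b e = avoiding (insert G T) b e ∪
      {m | m ∈ avoiding T b e ∧ ∀ i ∈ b G, m i ≠ 0} := by
    ext m
    simp only [avoiding, Set.mem_union, Set.mem_ofPred_eq, Finset.forall_mem_insert]
    constructor
    · rintro ⟨h1, h2⟩
      by_cases h : ∃ i ∈ b G, m i = 0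
      · exact Or.inl ⟨⟨h, h1⟩, h2⟩
      · push Not at h
        exact Or.inr ⟨⟨h1, h2⟩, h⟩
    · rintro (⟨⟨-, h1⟩, h2⟩ | ⟨h, -⟩)
      · exact ⟨h1, h2⟩
      · exact h
  have hdis : Disjoint (avoiding (insert G T) b e)
      {m | m ∈ avoiding T b e ∧ ∀ i ∈ b G, m i ≠ 0} := by
    rw [Set.disjoint_left]
    rintro m ⟨h, -⟩ ⟨-, h'⟩
    obtain ⟨i, hi, h0⟩ := h G (Finset.mem_insert_self _ _)
    exact h' i hi h0
  rw [hsplit, Set.ncard_union_eq hdis (avoiding_finite _ _ _)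
    ((avoiding_finite T b e).subset fun m hm => hm.1)]
  congr 1
  split_ifs with he
  · rw [← Set.ncard_image_of_injective (avoiding T b (e - 2 * (b G).card))
      (add_left_injective ind)]
    congr 1
    ext m
    simp only [Set.mem_ofPred_eq, Set.mem_image, avoiding]
    constructor
    · rintro ⟨⟨h1, h2⟩, h3⟩
      have hle : m - ind + ind = m := by
        funext i
        have := h3 i
        simp only [Pi.add_apply, Pi.sub_apply, ind]
        split_ifs with hi
        · have := this hi; omega
        · omega
      refine ⟨m - ind, ⟨fun G' hG' => ?_, ?_⟩, hle⟩
      · obtain ⟨i, hi, h0⟩ := h1 G' hG'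
        exact ⟨i, hi, by simp [h0]⟩
      · have : ∑ i, m i = ∑ i, (m - ind) i + ∑ i, ind i := by
          rw [← Finset.sum_add_distrib]
          conv_lhs => rw [← hle]
          rfl
        omega
    · rintro ⟨m, ⟨h1, h2⟩, rfl⟩
      refine ⟨⟨fun G' hG' => ?_, ?_⟩, fun i hi => ?_⟩
      · obtain ⟨i, hi, h0⟩ := h1 G' hG'
        refine ⟨i, hi, ?_⟩
        have : i ∉ b G := Finset.disjoint_left.1 (hG G' hG') hi
        simp [ind, this, h0]
      · simp only [Pi.add_apply, Finset.sum_add_distrib]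
        omega
      · simp [ind, hi]
  · rw [Set.ncard_eq_zero ((avoiding_finite T b e).subset fun m hm => hm.1)]
    ext m
    simp only [Set.mem_ofPred_eq, Set.mem_empty_iff_false, iff_false, avoiding]
    rintro ⟨⟨-, h2⟩, h3⟩
    have : ∑ i, ind i ≤ ∑ i, m i := Finset.sum_le_sum fun i _ => by
      have := h3 i
      simp only [ind]
      split_ifs with hi
      · have := this hi; omega
      · omega
    omega

lemma avoidingSeries_eq {n : ℕ} {ι : Type*} [DecidableEq ι] (b : ι → Finset (Fin n))
    (T : Finset ι) (hT : (T : Set ι).PairwiseDisjoint b) :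
    avoidingSeries T b =
      (∏ G ∈ T, (1 - (PowerSeries.X : PowerSeries ℂ) ^ (2 * (b G).card))) * avoidingSeries ∅ b := by
  induction T using Finset.induction_on with
  | empty => simp
  | insert G T hG ih =>
    rw [Finset.coe_insert] at hT
    rw [Finset.prod_insert hG, mul_assoc,
      ← ih (hT.subset (Set.subset_insert _ _)), sub_mul, one_mul]
    ext e
    have := avoiding_card_insert T b G (fun G' hG' =>
      hT (Set.mem_insert_of_mem _ hG') (Set.mem_insert _ _) (fun h => hG (h ▸ hG'))) e
    rw [map_sub, PowerSeries.coeff_X_pow_mul']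
    simp only [avoidingSeries, PowerSeries.coeff_mk]
    rw [this]
    split_ifs <;> push_cast <;> ring

/-- The series of all monomials is computed from `avoidingSeries_eq` itself: if every single line is
a block, only the monomial `1` survives. -/
lemma avoidingSeries_empty {n : ℕ} {ι : Type*} (b : ι → Finset (Fin n)) :
    (1 - (PowerSeries.X : PowerSeries ℂ) ^ 2) ^ n * avoidingSeries ∅ b = 1 := by
  have h := avoidingSeries_eq (fun i : Fin n => ({i} : Finset (Fin n))) Finset.univ (by
    intro i _ j _ hij
    simpa [Function.onFun] using hij)
  have h1 : avoidingSeries Finset.univ (fun i : Fin n => ({i} : Finset (Fin n))) = 1 := by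
    ext e
    rw [avoidingSeries, PowerSeries.coeff_mk, PowerSeries.coeff_one]
    split_ifs with he
    · subst he
      have : avoiding Finset.univ (fun i : Fin n => ({i} : Finset (Fin n))) 0 = {0} := by
        ext m
        simp only [avoiding, Finset.mem_univ, Finset.mem_singleton, exists_eq_left, forall_const,
          Set.mem_ofPred_eq, Set.mem_singleton_iff]
        constructor
        · rintro ⟨h, -⟩; exact funext h
        · rintro rfl; simp
      simp [this]
    · have : avoiding Finset.univ (fun i : Fin n => ({i} : Finset (Fin n))) e = ∅ := by
        ext m
        simp only [avoiding, Finset.mem_univ, Finset.mem_singleton, exists_eq_left, forall_const,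
          Set.mem_ofPred_eq, Set.mem_empty_iff_false, iff_false]
        rintro ⟨h, h2⟩
        simp only [h, Finset.sum_const_zero, mul_zero] at h2
        exact he h2.symm
      simp [this]
  rw [h1] at h
  simp only [Finset.card_singleton, mul_one, Finset.prod_const, Finset.card_univ,
    Fintype.card_fin] at h
  have hb : avoidingSeries ∅ b = avoidingSeries ∅ fun i : Fin n => ({i} : Finset (Fin n)) := by
    ext e
    simp [avoidingSeries, avoiding]
  rw [hb]
  exact h.symm

lemma one_sub_q_sq_ne_zero : (1 - q ^ 2 : RatFunc ℂ) ≠ 0 := by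
  have h : (1 - Polynomial.X ^ 2 : Polynomial ℂ) ≠ 0 := fun h => by
    have := congrArg (Polynomial.eval 0) h
    simp at this
  have := (map_ne_zero_iff _ (RatFunc.algebraMap_injective ℂ)).2 h
  simpa using this

lemma one_sub_mul_qNum (m : ℕ) : (1 - q ^ 2) * qNum m = 1 - q ^ (2 * m) := by
  simp only [qNum, pow_mul]
  exact mul_neg_geom_sum _ _

/-- Each of the `n - k` factors `1 - q ^ (2 * l)` is `1 - q ^ 2` times `qNum l`, which leaves `k` of
the `n` factors in the denominator. -/
lemma coe_avoidingSeries {n k : ℕ} (hk : k ≤ n) {ι : Type*} [DecidableEq ι]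
    (b : ι → Finset (Fin n)) (T : Finset ι) (hT : (T : Set ι).PairwiseDisjoint b)
    (hc : T.card = n - k) :
    ((∏ G ∈ T, qNum (b G).card) / (1 - q ^ 2) ^ k : RatFunc ℂ) =
      (avoidingSeries T b : LaurentSeries ℂ) := by
  have hX : ∀ m : ℕ, (((1 - q ^ m : RatFunc ℂ)) : LaurentSeries ℂ) =
      ((1 - PowerSeries.X ^ m : PowerSeries ℂ) : LaurentSeries ℂ) := by
    intro m
    rw [map_sub, map_one, map_pow, coe_q, PowerSeries.coe_sub, PowerSeries.coe_one,
      PowerSeries.coe_pow]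
    erw [PowerSeries.coe_X]
  have h0 : (((1 - q ^ 2 : RatFunc ℂ)) : LaurentSeries ℂ) ≠ 0 :=
    (map_ne_zero _).2 one_sub_q_sq_ne_zero
  have h1 : (((1 - q ^ 2 : RatFunc ℂ)) : LaurentSeries ℂ) ^ n *
      ((avoidingSeries ∅ b : PowerSeries ℂ) : LaurentSeries ℂ) = 1 := by
    rw [hX, ← PowerSeries.coe_pow, ← PowerSeries.coe_mul, avoidingSeries_empty, PowerSeries.coe_one]
  have h2 : ((avoidingSeries T b : PowerSeries ℂ) : LaurentSeries ℂ) =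
      (((1 - q ^ 2) ^ (n - k) * ∏ G ∈ T, qNum (b G).card : RatFunc ℂ) : LaurentSeries ℂ) *
        ((avoidingSeries ∅ b : PowerSeries ℂ) : LaurentSeries ℂ) := by
    rw [avoidingSeries_eq b T hT, PowerSeries.coe_mul, ← hc, ← Finset.prod_const,
      ← Finset.prod_mul_distrib]
    congr 1
    rw [Finset.prod_congr rfl fun G _ => one_sub_mul_qNum (b G).card, map_prod]
    exact (Finset.prod_congr rfl fun G _ => (hX _).symm).trans (map_prod _ _ _).symm
  rw [h2, map_div₀, div_eq_iff (by rw [map_pow]; exact pow_ne_zero _ h0), map_mul, map_pow, map_pow]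
  have hp : ∀ c : LaurentSeries ℂ, c ^ n = c ^ (n - k) * c ^ k := fun c => by
    rw [← pow_add]; congr 1; omega
  rw [hp] at h1
  calc _ = ((∏ G ∈ T, qNum (b G).card : RatFunc ℂ) : LaurentSeries ℂ) * 1 := (mul_one _).symm
    _ = _ := by rw [← h1]; ring_nf

end Counting

/-! ### A basis and the graded dimension of `I_x B_l I_y`. -/

section Corner

variable {K : Type u} [Field K] {n k : ℕ}

lemma coeff_Umon (m m' : Fin n → ℕ) :
    MvPolynomial.coeff (Finsupp.equivFunOnFinite.symm m') (Umon K m) = if m = m' then 1 else 0 := by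
  have : Umon K m = MvPolynomial.monomial (Finsupp.equivFunOnFinite.symm m) 1 := by
    rw [MvPolynomial.monomial_eq, Finsupp.prod_fintype _ _ (fun _ => pow_zero _), map_one, one_mul]
    rfl
  rw [this, MvPolynomial.coeff_monomial]
  simp

/-- The lines of an interval. -/
def block (n : ℕ) (G : ℕ × ℕ) : Finset (Fin n) :=
  Finset.univ.filter fun i => G.1 ≤ i ∧ (i : ℕ) < G.1 + G.2

lemma mem_block {G : ℕ × ℕ} {i : Fin n} : i ∈ block n G ↔ G.1 ≤ i ∧ (i : ℕ) < G.1 + G.2 := by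
  simp [block]

lemma block_card {G : ℕ × ℕ} (h : G.1 + G.2 ≤ n) : (block n G).card = G.2 := by
  have : (block n G).map Fin.valEmbedding = Finset.Ico G.1 (G.1 + G.2) := by
    ext a
    simp only [Finset.mem_map, mem_block, Finset.mem_Ico]
    constructor
    · rintro ⟨i, hi, rfl⟩; exact hi
    · intro h'; exact ⟨⟨a, by omega⟩, h', rfl⟩
  rw [← Finset.card_map, this]
  simp

/-- The monomials that vanish somewhere on each generating interval. -/
def goodMon (x y : IState n k) : Set (Fin n → ℕ) :=
  {m | ∀ G ∈ x.genIntervals y, ∃ i ∈ block n G, m i = 0}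

/-- In each generating interval a line where `m` vanishes is chosen. The complement of the chosen
lines is admissible for both states, and its missing lines are lines at which `m` vanishes. -/
lemma exists_state_of_good {x y : LeftIState n k} (hf : ¬ x.1.TooFar y.1) {m : Fin n → ℕ}
    (hm : m ∈ goodMon x.1 y.1) : ∃ s : LeftIState n k, s.1.Adm x.1 ∧ s.1.Adm y.1 ∧
      ∀ i : Fin n, (i : ℕ) ∉ s.1.1 → m i = 0 := by
  classical
  let c : ℕ × ℕ → ℕ := fun G => if h : ∃ i ∈ block n G, m i = 0 then h.choose else 0
  have hcG : ∀ G ∈ x.1.genIntervals y.1, ∃ i ∈ block n G, m i = 0 ∧ c G = i := by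
    intro G hG
    have h := hm G hG
    refine ⟨h.choose, h.choose_spec.1, h.choose_spec.2, ?_⟩
    simp only [c]
    rw [dif_pos h]
  have hc : LeftIState.IsChoice x y c := by
    intro G hG
    obtain ⟨i, hi, -, h⟩ := hcG G hG
    rw [h]
    exact mem_block.1 hi
  refine ⟨hc.state hf, (hc.adm hf).1, (hc.adm hf).2, fun i hi => ?_⟩
  have : (i : ℕ) ∈ (x.1.genIntervals y.1).image c := by
    by_contra h
    exact hi (Finset.mem_sdiff.2 ⟨Finset.mem_range.2 i.2, h⟩)
  obtain ⟨G, hG, h⟩ := Finset.mem_image.1 this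
  obtain ⟨j, -, h0, hj⟩ := hcG G hG
  have : i = j := Fin.ext (by rw [← h, hj])
  rw [this, h0]

lemma rootHom_smul (s : IState n k) (c : K) (p : URing K n) :
    rootHom K s (c • p) = c • rootHom K s p := by
  rw [MvPolynomial.smul_eq_C_mul, MvPolynomial.smul_eq_C_mul, map_mul, rootHom,
    MvPolynomial.coe_eval₂Hom, MvPolynomial.eval₂_C]

/-- Each monomial `m0` of a relation is tested in the representation of a state `s` adapted to it.
There `U^{m0}` becomes the monomial with exponents `2 * m0`, and any other monomial becomes either
zero or a different one, so the coefficient of `m0` vanishes. -/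
lemma linearIndependent_Umon_smul {x y : LeftIState n k} (hf : ¬ x.1.TooFar y.1) :
    LinearIndependent K fun m : goodMon x.1 y.1 => Umon K m.1 • f K x.1 y.1 := by
  rw [linearIndependent_iff']
  intro S g hS m0 hm0
  obtain ⟨s, hx, hy, hs⟩ := exists_state_of_good hf m0.2
  have h1 : (∑ m ∈ S, g m • Umon K m.1) • f K x.1 y.1 = 0 := by
    rw [← hS, Finset.sum_smul]
    exact Finset.sum_congr rfl fun m _ => smul_assoc _ _ _
  have h2 := rootHom_eq_zero_of_smul_f K hx hy h1
  rw [map_sum] at h2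
  have h3 := congrArg (MvPolynomial.coeff (Finsupp.equivFunOnFinite.symm (2 * m0.1))) h2
  rw [MvPolynomial.coeff_sum, MvPolynomial.coeff_zero, Finset.sum_eq_single m0] at h3
  · rw [rootHom_smul, rootHom_Umon K s.1 _ hs, MvPolynomial.coeff_smul, coeff_Umon,
      if_pos rfl, smul_eq_mul, mul_one] at h3
    exact h3
  · intro m _ hne
    rw [rootHom_smul]
    by_cases h : ∀ i : Fin n, (i : ℕ) ∉ s.1.1 → m.1 i = 0
    · rw [rootHom_Umon K s.1 _ h, MvPolynomial.coeff_smul, coeff_Umon, if_neg, smul_zero]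
      intro e
      refine hne (Subtype.ext (funext fun i => ?_))
      have : 2 * m.1 i = 2 * m0.1 i := congrFun e i
      omega
    · push Not at h
      obtain ⟨i, hi, h0⟩ := h
      rw [rootHom_Umon_zero K s.1 _ i hi h0, smul_zero, MvPolynomial.coeff_zero]
  · exact fun h => absurd hm0 h

lemma map_cornerGr (x y : LeftIState n k) (d : ℤ) :
    (cornerGr K x y d).map (inclBl K n k) = Submodule.span K {b | ∃ m : Fin n → ℕ,
      ((2 * ∑ i, m i + x.1.deg y.1 : ℕ) : ℤ) = d ∧ b = Umon K m • f K x.1 y.1} := by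
  apply le_antisymm
  · rintro _ ⟨b, ⟨⟨c, rfl⟩, hb⟩, rfl⟩
    have hb' : inclBl K n k (Il K x * c * Il K y) ∈ grB K n k d := hb
    have e : inclBl K n k (Il K x * c * Il K y) =
        f K x.1 x.1 * inclBl K n k (Il K x * c * Il K y) * f K y.1 y.1 := by
      change f K x.1 x.1 * inclBl K n k c * f K y.1 y.1 =
        f K x.1 x.1 * (f K x.1 x.1 * inclBl K n k c * f K y.1 y.1) * f K y.1 y.1
      simp only [← mul_assoc, f_idem]
      rw [mul_assoc _ (f K y.1 y.1), f_idem]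
    have key : ∀ b ∈ grB K n k d, f K x.1 x.1 * b * f K y.1 y.1 ∈
        Submodule.span K {b | ∃ m : Fin n → ℕ,
      ((2 * ∑ i, m i + x.1.deg y.1 : ℕ) : ℤ) = d ∧ b = Umon K m • f K x.1 y.1} := by
      intro b hb
      induction hb using Submodule.span_induction with
      | mem b hb =>
        obtain ⟨m, x', y', hd, rfl⟩ := hb
        rw [mul_smul_comm, smul_mul_assoc]
        by_cases hx : x.1 = x'
        · by_cases hy : y' = y.1
          · subst hx hy
            rw [f_left, f_right]
            exact Submodule.subset_span ⟨m, hd, rfl⟩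
          · rw [mul_assoc, f_not_comp _ _ _ _ hy]; simp
        · rw [f_not_comp _ _ _ _ hx]; simp
      | zero => simp
      | add b b' _ _ h h' => rw [mul_add, add_mul]; exact add_mem h h'
      | smul c b _ h => rw [mul_smul_comm, smul_mul_assoc]; exact Submodule.smul_mem _ _ h
    have := key _ hb'
    rw [← e] at this
    exact this
  · rw [Submodule.span_le]
    rintro _ ⟨m, hd, rfl⟩
    have hmem : Umon K m • f K x.1 y.1 ∈ grB K n k d :=
      Submodule.subset_span ⟨m, x.1, y.1, hd, rfl⟩
    have he : inclBl K n k (cut K (Umon K m • f K x.1 y.1)) = Umon K m • f K x.1 y.1 := by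
      rw [incl_cut, mul_smul_comm, eLeft_mul, smul_mul_assoc, mul_eLeft]
    refine ⟨cut K (Umon K m • f K x.1 y.1), ⟨⟨cut K (Umon K m • f K x.1 y.1), ?_⟩, ?_⟩, he⟩
    · apply inclBl_injective K
      rw [LinearMap.mulLeftRight_apply]
      change f K x.1 x.1 * inclBl K n k (cut K (Umon K m • f K x.1 y.1)) * f K y.1 y.1 = _
      rw [he, mul_smul_comm, f_left, smul_mul_assoc, f_right]
    · change inclBl K n k (cut K (Umon K m • f K x.1 y.1)) ∈ grB K n k d
      rw [he]
      exact hmem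

lemma map_cornerGr_good {x y : LeftIState n k} (d : ℤ) :
    (cornerGr K x y d).map (inclBl K n k) = Submodule.span K (Set.range
      fun m : {m : goodMon x.1 y.1 // ((2 * ∑ i, m.1 i + x.1.deg y.1 : ℕ) : ℤ) = d} =>
        Umon K m.1.1 • f K x.1 y.1) := by
  rw [map_cornerGr]
  apply le_antisymm
  · rw [Submodule.span_le]
    rintro _ ⟨m, hd, rfl⟩
    by_cases hm : m ∈ goodMon x.1 y.1
    · exact Submodule.subset_span ⟨⟨⟨m, hm⟩, hd⟩, rfl⟩
    · simp only [goodMon, Set.mem_ofPred_eq, not_forall, not_exists, not_and] at hm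
      obtain ⟨G, hG, h⟩ := hm
      rw [Umon_smul_eq_zero hG fun i h1 h2 => h i (mem_block.2 ⟨h1, h2⟩)]
      exact zero_mem _
  · rw [Submodule.span_le]
    rintro _ ⟨m, rfl⟩
    exact Submodule.subset_span ⟨m.1.1, m.2, rfl⟩

/-- The good monomials times `f_{x,y}` form a basis of the space. In degree `d` they are the members
of `avoiding` in degree `d - deg`, so the series is that of the disjoint blocks given by the
generating intervals, shifted by `dist = deg`. -/
theorem hasGrDim_cornerGr {x y : LeftIState n k} (hf : ¬ x.1.TooFar y.1) :
    HasGrDim (cornerGr K x y) (q ^ x.1.dist y.1 *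
      ((∏ G ∈ x.1.genIntervals y.1, qNum G.2) / (1 - q ^ 2) ^ k)) := by
  have hprod : ∏ G ∈ x.1.genIntervals y.1, qNum G.2 =
      ∏ G ∈ x.1.genIntervals y.1, qNum (block n G).card :=
    Finset.prod_congr rfl fun G hG => by
      rw [block_card (IState.mem_genIntervals.1 hG).2.1]
  have hdisj : (x.1.genIntervals y.1 : Set (ℕ × ℕ)).PairwiseDisjoint (block n) := by
    intro G hG G' hG' hne
    rw [Function.onFun, Finset.disjoint_left]
    intro i hi hi'
    rw [mem_block] at hi hi'
    exact hne (IState.genIntervals_unique hG hG' hi.1 hi.2 hi'.1 hi'.2)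
  intro d
  let I := {m : goodMon x.1 y.1 // ((2 * ∑ i, m.1 i + x.1.deg y.1 : ℕ) : ℤ) = d}
  have hli : LinearIndependent K fun m : I => Umon K m.1.1 • f K x.1 y.1 :=
    (linearIndependent_Umon_smul hf).comp _ Subtype.val_injective
  let φ : I → (Fin n → ℕ) := fun m => m.1.1
  have hφ : Function.Injective φ := fun a b h => Subtype.ext (Subtype.ext h)
  -- If `d` is smaller than the degree of `f_{x,y}`, the truncation by `toNat` is harmless because
  -- the index type is empty.
  have hfin : Finite I := by
    have hfin := (avoiding_finite (x.1.genIntervals y.1) (block n)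
      (d - x.1.deg y.1).toNat).to_subtype
    exact Finite.of_injective (β := avoiding (x.1.genIntervals y.1) (block n)
      (d - x.1.deg y.1).toNat) (fun m => ⟨m.1.1, m.1.2, by have := m.2; omega⟩)
      fun a b h => hφ (Subtype.mk.inj h)
  have := Fintype.ofFinite I
  have e := Submodule.equivMapOfInjective (inclBl K n k) (inclBl_injective K) (cornerGr K x y d)
  rw [map_cornerGr_good] at e
  have : Module.Finite K (Submodule.span K (Set.range fun m : I => Umon K m.1.1 • f K x.1 y.1)) :=
    Module.Finite.span_of_finite K (Set.finite_range _)
  refine ⟨Module.Finite.equiv e.symm, ?_⟩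
  rw [e.finrank_eq, finrank_span_eq_card hli]
  have hz := coeff_q_zpow_mul (x.1.dist y.1) ((∏ G ∈ x.1.genIntervals y.1, qNum G.2) / (1 - q ^ 2) ^ k) d
  rw [zpow_natCast] at hz
  rw [hz, hprod, coe_avoidingSeries x.k_le _ _ hdisj (IState.card_genIntervals x.2 hf),
    IState.dist_eq_deg]
  rw [PowerSeries.coeff_coe]
  split_ifs with hneg
  · have : IsEmpty I := ⟨fun m => by have := m.2; omega⟩
    simp
  · rw [avoidingSeries, PowerSeries.coeff_mk, ← Nat.card_eq_fintype_card]
    congr 1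
    rw [← Set.ncard_univ, ← Set.ncard_image_of_injective _ hφ]
    congr 1
    ext m
    simp only [Set.image_univ, Set.mem_range]
    constructor
    · rintro ⟨h1, h2⟩
      exact ⟨⟨⟨m, h1⟩, by simp only; omega⟩, rfl⟩
    · rintro ⟨m, rfl⟩
      refine ⟨m.1.2, ?_⟩
      have := m.2
      simp only [φ]
      omega

theorem hasGrDim_cornerGr_tooFar {x y : LeftIState n k} (hf : x.1.TooFar y.1) :
    HasGrDim (cornerGr K x y) 0 := by
  intro d
  have e := Submodule.equivMapOfInjective (inclBl K n k) (inclBl_injective K) (cornerGr K x y d)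
  have : (cornerGr K x y d).map (inclBl K n k) = ⊥ := by
    rw [map_cornerGr, Submodule.span_eq_bot]
    rintro _ ⟨m, -, rfl⟩
    rw [f_eq_zero_of_tooFar hf, smul_zero]
  rw [this] at e
  refine ⟨Module.Finite.equiv e.symm, ?_⟩
  rw [e.finrank_eq]
  simp

end Corner

/-! ### The weighted sum over common admissible states. -/

section Choices

variable {n k : ℕ}

/-- `∑ (x_i - s_i)`. -/
def IState.wt (s x : IState n k) : ℕ := ∑ i, (x.elt i - s.elt i)

lemma IState.Adm.wt_add {s x : IState n k} (h : s.Adm x) :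
    s.wt x + ∑ i, s.elt i = ∑ i, x.elt i := by
  rw [IState.wt, ← Finset.sum_add_distrib]
  exact Finset.sum_congr rfl fun i _ => Nat.sub_add_cancel (h i).1

lemma IState.sum_elt (x : IState n k) : ∑ i, x.elt i = ∑ a ∈ x.1, a := by
  rw [← Finset.sum_image (f := fun a => a) (g := x.elt) (s := Finset.univ)
    x.elt_strictMono.injective.injOn, x.image_elt]

namespace LeftIState

variable {x y : LeftIState n k} {c : ℕ × ℕ → ℕ}

lemma IsChoice.sum_elt (hc : IsChoice x y c) (hf : ¬ x.1.TooFar y.1) :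
    ∑ i, (hc.state hf).1.elt i + ∑ G ∈ x.1.genIntervals y.1, c G = ∑ t ∈ Finset.range n, t := by
  rw [IState.sum_elt]
  change ∑ a ∈ choiceSet x y c, a + _ = _
  rw [← Finset.sum_image (f := fun a => a) hc.injOn, choiceSet]
  refine Finset.sum_sdiff fun a ha => ?_
  obtain ⟨G, hG, rfl⟩ := Finset.mem_image.1 ha
  exact Finset.mem_range.2 (hc.lt hG)

lemma isChoice_fst (x y : LeftIState n k) : IsChoice x y Prod.fst := fun G hG =>
  ⟨le_rfl, by have := (IState.mem_genIntervals.1 hG).1; omega⟩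

/-- When the left ends are chosen, `card_ge` and `card_genIntervals_ge` count the same intervals, so
the counting function of the state is the minimum of those of `x` and `y`. By `le_elt_iff` the same
holds for the positions. -/
lemma state_fst_elt (hf : ¬ x.1.TooFar y.1) (i : Fin k) :
    ((isChoice_fst x y).state hf).1.elt i = min (x.1.elt i) (y.1.elt i) := by
  have hv : ∀ t ≤ n, ((isChoice_fst x y).state hf).1.v t = min (x.1.v t) (y.1.v t) := by
    intro t ht
    have a := (isChoice_fst x y).card_ge t
    have b := IState.card_genIntervals_ge x.2 hf ht
    rw [← (isChoice_fst x y).state_v hf] at a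
    omega
  refine le_antisymm ?_ ?_
  · have h := (IState.le_elt_iff _ _ i).1 (le_refl (((isChoice_fst x y).state hf).1.elt i))
    rw [hv _ (IState.elt_le _ _)] at h
    rw [le_min_iff, IState.le_elt_iff, IState.le_elt_iff]
    omega
  · rw [IState.le_elt_iff, hv _ ((min_le_left _ _).trans (x.1.elt_le i))]
    have a := (x.1.le_elt_iff _ i).1 (min_le_left (x.1.elt i) (y.1.elt i))
    have b := (y.1.le_elt_iff _ i).1 (min_le_right (x.1.elt i) (y.1.elt i))
    omega

/-- The state and the chosen lines partition all lines, so moving a choice to the right by `r`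
lowers the sum of the positions of the state by `r` and raises each of the two weights by `r`. For
the choice of left ends the sum of the weights is `∑ |x_i - y_i|` by `state_fst_elt`. -/
lemma IsChoice.wt_add_wt (hc : IsChoice x y c) (hf : ¬ x.1.TooFar y.1) :
    (hc.state hf).1.wt x.1 + (hc.state hf).1.wt y.1 =
      x.1.dist y.1 + 2 * ∑ G ∈ x.1.genIntervals y.1, (c G - G.1) := by
  have a := hc.sum_elt hf
  have b := (isChoice_fst x y).sum_elt hf
  have c1 := (hc.adm hf).1.wt_add
  have c2 := (hc.adm hf).2.wt_add
  have d : ∑ G ∈ x.1.genIntervals y.1, c G =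
      ∑ G ∈ x.1.genIntervals y.1, (c G - G.1) + ∑ G ∈ x.1.genIntervals y.1, G.1 := by
    rw [← Finset.sum_add_distrib]
    exact Finset.sum_congr rfl fun G hG => (Nat.sub_add_cancel (hc G hG).1).symm
  have e : x.1.dist y.1 + 2 * ∑ i, ((isChoice_fst x y).state hf).1.elt i =
      ∑ i, x.1.elt i + ∑ i, y.1.elt i := by
    rw [IState.dist, Finset.mul_sum, ← Finset.sum_add_distrib, ← Finset.sum_add_distrib]
    refine Finset.sum_congr rfl fun i _ => ?_
    rw [state_fst_elt]
    omega
  omega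

/-- Suppose `s` contains every line of the interval. Its count then drops by the length of the
interval, whereas the common count of `x` and `y` drops by one less between the first and the last
line. The bounds of `Adm.v_le` then leave room only if one of the end regions lies in both states.
-/
lemma exists_not_mem_of_adm {s : LeftIState n k} (hx : s.1.Adm x.1) (hy : s.1.Adm y.1)
    {G : ℕ × ℕ} (hG : G ∈ x.1.genIntervals y.1) : ∃ t, G.1 ≤ t ∧ t < G.1 + G.2 ∧ t ∉ s.1.1 := by
  obtain ⟨j, l⟩ := G
  obtain ⟨h1, h2, h3, h4, h5, h6⟩ := IState.mem_genIntervals.1 hG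
  simp only at *
  by_contra hcon
  push Not at hcon
  obtain ⟨l, rfl⟩ := Nat.exists_eq_add_of_le' h1
  have hs : ∀ r, r ≤ l + 1 → s.1.v j = s.1.v (j + r) + r := by
    intro r
    induction r with
    | zero => intro _; rfl
    | succ r ih =>
      intro hr
      have a := ih (by omega)
      have b := s.1.v_step (j + r)
      rw [if_pos (hcon (j + r) (by omega) (by omega))] at b
      change _ = s.1.v (j + r + 1) + (r + 1)
      omega
  have hxv : ∀ r, r ≤ l → x.1.v (j + 1) = x.1.v (j + r + 1) + r := by
    intro r
    induction r with
    | zero => intro _; rfl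
    | succ r ih =>
      intro hr
      have a := ih (by omega)
      have b := x.1.v_step (j + r + 1)
      rw [if_pos (Finset.mem_inter.1 (h5 (j + r + 1) (by omega) (by omega))).1] at b
      change _ = x.1.v (j + r + 1 + 1) + (r + 1)
      omega
  have a : s.1.v j = s.1.v (j + l + 1) + (l + 1) := hs (l + 1) le_rfl
  have b := hxv l le_rfl
  change j + l + 1 ∉ _ at h4
  have c1 := (hx.v_le j).2
  have c2 := (hy.v_le j).2
  have d1 := (hx.v_le (j + l + 1)).1
  have d2 := (hy.v_le (j + l + 1)).1
  have e1 := x.1.v_step j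
  have e2 := y.1.v_step j
  have f1 := x.1.v_step (j + l + 1)
  have f2 := y.1.v_step (j + l + 1)
  have g1 := h6 j le_rfl (by omega)
  have g2 := h6 (j + l) (by omega) (by omega)
  rw [Finset.mem_inter] at h3 h4
  split_ifs at e1 e2 f1 f2 <;> first | omega | exact absurd ⟨‹_›, ‹_›⟩ h3 | exact absurd ⟨‹_›, ‹_›⟩ h4

/-- Expanding the product of the `qNum` gives a sum over families of offsets, one below the length
of each interval. Such families are the choices of lines, hence the common admissible states, and
`wt_add_wt` matches the exponents. -/
lemma sum_adm_eq (hf : ¬ x.1.TooFar y.1) :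
    ∑ s : LeftIState n k, (if s.1.Adm x.1 ∧ s.1.Adm y.1 then
      (q : RatFunc ℂ) ^ (s.1.wt x.1 + s.1.wt y.1) else 0) =
    q ^ x.1.dist y.1 * ∏ G ∈ x.1.genIntervals y.1, qNum G.2 := by
  classical
  rw [← Finset.prod_coe_sort]
  simp only [qNum]
  rw [Finset.prod_univ_sum, ← Finset.sum_filter, Finset.mul_sum]
  symm
  let c : (∀ _ : x.1.genIntervals y.1, ℕ) → ℕ × ℕ → ℕ := fun p G =>
    if h : G ∈ x.1.genIntervals y.1 then G.1 + p ⟨G, h⟩ else 0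
  have hcG : ∀ p (G : x.1.genIntervals y.1), c p G.1 = G.1.1 + p G := fun p G => by
    simp only [c]; rw [dif_pos G.2]
  have hc : ∀ p ∈ Fintype.piFinset (fun G : x.1.genIntervals y.1 => Finset.range G.1.2),
      IsChoice x y (c p) := by
    intro p hp G hG
    have := hcG p ⟨G, hG⟩
    have h2 := Finset.mem_range.1 (Fintype.mem_piFinset.1 hp ⟨G, hG⟩)
    simp only at this h2
    omega
  refine Finset.sum_bij (fun p hp => (hc p hp).state hf) ?_ ?_ ?_ ?_
  · intro p hp
    exact Finset.mem_filter.2 ⟨Finset.mem_univ _, (hc p hp).adm hf⟩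
  · intro p hp p' hp' h
    funext G
    have h' : choiceSet x y (c p) = choiceSet x y (c p') :=
      congrArg (fun s : LeftIState n k => s.1.1) h
    have hmem : c p G.1 ∈ (x.1.genIntervals y.1).image (c p') := by
      by_contra hn
      have : c p G.1 ∈ choiceSet x y (c p') :=
        Finset.mem_sdiff.2 ⟨Finset.mem_range.2 ((hc p hp).lt G.2), hn⟩
      rw [← h'] at this
      exact (Finset.mem_sdiff.1 this).2 (Finset.mem_image_of_mem _ G.2)
    obtain ⟨G', hG', e⟩ := Finset.mem_image.1 hmem
    have a := hc p hp G.1 G.2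
    have b := hc p' hp' G' hG'
    have : G' = G.1 := IState.genIntervals_unique hG' G.2 b.1 b.2 (e ▸ a.1) (e ▸ a.2)
    subst this
    rw [hcG, hcG] at e
    omega
  · intro s hs
    obtain ⟨hx, hy⟩ := (Finset.mem_filter.1 hs).2
    -- A missing line in each interval gives a choice. Its state contains `s` and has the same
    -- number `k` of elements, so it is `s`, and no other line is missing.
    choose! t ht using fun G (hG : G ∈ x.1.genIntervals y.1) => exists_not_mem_of_adm hx hy hG
    let p : ∀ _ : x.1.genIntervals y.1, ℕ := fun G => t G.1 - G.1.1
    have hp : p ∈ Fintype.piFinset (fun G : x.1.genIntervals y.1 => Finset.range G.1.2) := by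
      rw [Fintype.mem_piFinset]
      intro G
      have := ht G.1 G.2
      rw [Finset.mem_range]
      simp only [p]
      omega
    refine ⟨p, hp, ?_⟩
    have hct : ∀ G ∈ x.1.genIntervals y.1, c p G = t G := by
      intro G hG
      have := ht G hG
      rw [hcG p ⟨G, hG⟩]
      simp only [p]
      omega
    refine Subtype.ext (Subtype.ext ?_)
    change choiceSet x y (c p) = s.1.1
    symm
    refine Finset.eq_of_subset_of_card_le ?_ ?_
    · intro a ha
      refine Finset.mem_sdiff.2 ⟨Finset.mem_range.2 (s.mem_lt ha), fun h => ?_⟩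
      obtain ⟨G, hG, rfl⟩ := Finset.mem_image.1 h
      rw [hct G hG] at ha
      exact (ht G hG).2.2 ha
    · rw [(hc p hp).card_choiceSet hf, s.1.card_eq]
  · intro p hp
    rw [(hc p hp).wt_add_wt hf, pow_add, Finset.prod_pow_eq_pow_sum, ← Finset.mul_sum]
    congr 3
    rw [← Finset.sum_coe_sort (x.1.genIntervals y.1)]
    refine Finset.sum_congr rfl fun G _ => ?_
    rw [hcG]
    omega

end LeftIState

end Choices

/-! ### Standard and canonical bases of the weight space and the Gram matrix. -/

section WeightSpace

variable {n k : ℕ}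

lemma q_pow_injective : Function.Injective fun a : ℕ => (q ^ a : RatFunc ℂ) := by
  intro a b h
  have h' : algebraMap (Polynomial ℂ) (RatFunc ℂ) (Polynomial.X ^ a) =
      algebraMap (Polynomial ℂ) (RatFunc ℂ) (Polynomial.X ^ b) := by
    simpa using h
  have := congrArg Polynomial.natDegree (RatFunc.algebraMap_injective ℂ h')
  simpa using this

lemma map_diagonal_stdBasis (a b : RatFunc ℂ) (ε : Fin n → Fin 2) :
    PiTensorProduct.map (fun _ : Fin n => Matrix.toLin' (Matrix.diagonal ![a, b])) (stdBasis n ε) =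
      (∏ p, ![a, b] (ε p)) • stdBasis n ε := by
  rw [stdBasis, Basis.piTensorProduct_apply, PiTensorProduct.map_tprod,
    ← MultilinearMap.map_smul_univ]
  congr 1
  funext p
  ext j
  rw [Matrix.toLin'_apply, Matrix.mulVec_diagonal, Pi.smul_apply, smul_eq_mul, Pi.basisFun_apply]
  by_cases h : j = ε p
  · rw [h]
  · simp [Pi.single_eq_of_ne h]

/-- The number of factors `v_0` of a standard basis vector. -/
def zeros (ε : Fin n → Fin 2) : ℕ := (Finset.univ.filter fun p => ε p = 0).card

lemma zeros_add (ε : Fin n → Fin 2) :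
    zeros ε + (Finset.univ.filter fun p => ¬ ε p = 0).card = n := by
  rw [zeros, Finset.card_filter_add_card_filter_not]; simp

lemma actK1_stdBasis (ε : Fin n → Fin 2) :
    PiTensorProduct.map (fun _ : Fin n => actK1) (stdBasis n ε) = q ^ zeros ε • stdBasis n ε := by
  have h : ∀ p, (![q, 1] : Fin 2 → RatFunc ℂ) (ε p) = if ε p = 0 then q else 1 := fun p => by
    generalize ε p = j; fin_cases j <;> simp
  simp only [actK1]
  rw [map_diagonal_stdBasis, Finset.prod_congr rfl fun p _ => h p, Finset.prod_ite,
    Finset.prod_const, Finset.prod_const_one, mul_one, zeros]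

lemma actK2_stdBasis (ε : Fin n → Fin 2) :
    PiTensorProduct.map (fun _ : Fin n => actK2) (stdBasis n ε) =
      q ^ (n - zeros ε) • stdBasis n ε := by
  have h : ∀ p, (![1, q] : Fin 2 → RatFunc ℂ) (ε p) = if ε p = 0 then 1 else q := fun p => by
    generalize ε p = j; fin_cases j <;> simp
  simp only [actK2]
  rw [map_diagonal_stdBasis, Finset.prod_congr rfl fun p _ => h p, Finset.prod_ite]
  simp only [Finset.prod_const, one_pow, one_mul]
  congr 2
  have := zeros_add ε
  omega

/-- The sequence of factors of the standard basis vector of a left I-state. -/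
def seqOf (x : LeftIState n k) (p : Fin n) : Fin 2 := if (p : ℕ) ∈ x.1.1 then 0 else 1

lemma stdVec_eq (x : LeftIState n k) : stdVec n x.1.1 = stdBasis n (seqOf x) := rfl

lemma seqOf_injective : Function.Injective (seqOf (n := n) (k := k)) := by
  intro x y h
  refine Subtype.ext (Subtype.ext (Finset.ext fun a => ?_))
  by_cases ha : a < n
  · have := congrFun h ⟨a, ha⟩
    simp only [seqOf] at this
    split_ifs at this with h1 h2 h2
    · exact iff_of_true h1 h2
    · exact absurd this (by decide)
    · exact absurd this (by decide)
    · exact iff_of_false h1 h2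
  · exact iff_of_false (fun h => ha (x.mem_lt h)) (fun h => ha (y.mem_lt h))

lemma zeros_seqOf (x : LeftIState n k) : zeros (seqOf x) = k := by
  rw [zeros]
  conv_rhs => rw [← x.1.card_eq]
  rw [← Finset.card_map Fin.valEmbedding]
  congr 1
  ext a
  rw [Finset.mem_map]
  constructor
  · rintro ⟨p, hp, rfl⟩
    have hp : (if (p : ℕ) ∈ x.1.1 then 0 else 1 : Fin 2) = 0 := (Finset.mem_filter.1 hp).2
    by_contra h
    change (p : ℕ) ∉ x.1.1 at h
    rw [if_neg h] at hp
    exact absurd hp (by decide)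
  · intro h
    exact ⟨⟨a, x.mem_lt h⟩, Finset.mem_filter.2 ⟨Finset.mem_univ _, if_pos h⟩, rfl⟩

lemma exists_seqOf (ε : Fin n → Fin 2) (h : zeros ε = k) : ∃ x : LeftIState n k, seqOf x = ε := by
  refine ⟨LeftIState.ofSet ((Finset.univ.filter fun p => ε p = 0).map Fin.valEmbedding) ?_
    (by rw [Finset.card_map]; exact h), ?_⟩
  · intro a ha
    obtain ⟨p, -, rfl⟩ := Finset.mem_map.1 ha
    exact p.2
  · funext p
    have : (p : ℕ) ∈ (Finset.univ.filter fun p => ε p = 0).map Fin.valEmbedding ↔ ε p = 0 := by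
      rw [Finset.mem_map]
      constructor
      · rintro ⟨p', hp', e⟩
        rw [← Fin.val_injective e]
        exact (Finset.mem_filter.1 hp').2
      · intro h
        exact ⟨p, Finset.mem_filter.2 ⟨Finset.mem_univ _, h⟩, rfl⟩
    change (if (p : ℕ) ∈ (Finset.univ.filter fun p => ε p = 0).map Fin.valEmbedding then 0 else 1) = _
    generalize hj : ε p = j at *
    fin_cases j
    · rw [if_pos (this.2 rfl)]; rfl
    · rw [if_neg (fun h => absurd (this.1 h) (by decide))]; rfl

lemma stdVec_mem (x : LeftIState n k) : stdVec n x.1.1 ∈ weightSpace n k := by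
  rw [stdVec_eq]
  refine ⟨?_, ?_⟩
  · exact Module.End.mem_eigenspace_iff.2 (by rw [actK1_stdBasis, zeros_seqOf])
  · exact Module.End.mem_eigenspace_iff.2 (by rw [actK2_stdBasis, zeros_seqOf])

/-- The operator `K_1` is diagonal in the standard basis with eigenvalue `q ^ zeros ε`, and distinct
powers of `q` are distinct. -/
lemma zeros_eq_of_mem {w : VT n} (hw : w ∈ weightSpace n k) {ε : Fin n → Fin 2}
    (h : (stdBasis n).repr w ε ≠ 0) : zeros ε = k := by
  have hw1 := Module.End.mem_eigenspace_iff.1 hw.1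
  have key : (stdBasis n).repr (PiTensorProduct.map (fun _ : Fin n => actK1) w) ε =
      q ^ zeros ε * (stdBasis n).repr w ε := by
    have hlin : ((stdBasis n).coord ε) ∘ₗ (PiTensorProduct.map fun _ : Fin n => actK1) =
        q ^ zeros ε • (stdBasis n).coord ε := by
      refine (stdBasis n).ext fun ε' => ?_
      rw [LinearMap.comp_apply, actK1_stdBasis, map_smul, LinearMap.smul_apply,
        Module.Basis.coord_apply, Module.Basis.repr_self]
      by_cases e : ε' = ε
      · rw [e]
      · rw [Finsupp.single_eq_of_ne (Ne.symm e)]; simp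
    exact LinearMap.congr_fun hlin w
  rw [hw1, map_smul, Finsupp.smul_apply, smul_eq_mul] at key
  exact (q_pow_injective (mul_right_cancel₀ h key)).symm

variable (n k) in
/-- The standard basis of the weight space. -/
def stdB : Module.Basis (LeftIState n k) (RatFunc ℂ) (weightSpace n k) :=
  Module.Basis.mk (v := fun x => ⟨stdVec n x.1.1, stdVec_mem x⟩)
    (by
      refine LinearIndependent.of_comp (weightSpace n k).subtype ?_
      exact (stdBasis n).linearIndependent.comp _ seqOf_injective)
    (by
      rintro w -
      have hw : (w : VT n) = ∑ ε, (stdBasis n).repr w.1 ε • stdBasis n ε :=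
        ((stdBasis n).sum_repr w.1).symm
      have : w ∈ (Submodule.span (RatFunc ℂ) (Set.range fun x : LeftIState n k =>
          (⟨stdVec n x.1.1, stdVec_mem x⟩ : weightSpace n k))) ↔ (w : VT n) ∈
          (Submodule.span (RatFunc ℂ) (Set.range fun x : LeftIState n k =>
          (⟨stdVec n x.1.1, stdVec_mem x⟩ : weightSpace n k))).map (weightSpace n k).subtype := by
        rw [Submodule.mem_map]
        constructor
        · intro h; exact ⟨w, h, rfl⟩
        · rintro ⟨w', h, e⟩; rwa [← Subtype.ext e]
      rw [this, hw]
      refine sum_mem fun ε _ => ?_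
      by_cases h : (stdBasis n).repr w.1 ε = 0
      · rw [h, zero_smul]; exact zero_mem _
      · obtain ⟨x, rfl⟩ := exists_seqOf ε (zeros_eq_of_mem w.2 h)
        refine Submodule.smul_mem _ _ ⟨⟨stdVec n x.1.1, stdVec_mem x⟩, ?_, rfl⟩
        exact Submodule.subset_span ⟨x, rfl⟩)

lemma stdB_apply (x : LeftIState n k) : (stdB n k x : VT n) = stdVec n x.1.1 := by
  rw [stdB, Module.Basis.mk_apply]

lemma stdForm_stdB (x y : LeftIState n k) :
    stdForm n k (stdB n k x) (stdB n k y) = if x = y then 1 else 0 := by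
  change (stdBasis n).toDual (stdB n k x : VT n) (stdB n k y : VT n) = _
  rw [stdB_apply, stdB_apply, stdVec_eq, stdVec_eq, Module.Basis.toDual_apply]
  by_cases h : x = y
  · rw [if_pos h, if_pos (by rw [h])]
  · rw [if_neg h, if_neg fun e => h (seqOf_injective e)]

/-- The canonical basis vector as an element of the weight space. -/
def canW (x : LeftIState n k) : weightSpace n k :=
  ∑ s : LeftIState n k, (if s.1.Adm x.1 then q ^ s.1.wt x.1 else 0) • stdB n k s

/-- A nonvanishing term of the wedge product moves each element of a subset `S` of `x` one step to
the left without collisions. The result is an admissible state `s`, from which `S` is recovered as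
the set of the `x_i` with `s_i ≠ x_i`; its cardinality is the weight. The absence of collisions
corresponds to strict monotonicity of the positions of `s`. -/
lemma canVec_eq (x : LeftIState n k) : canVec n x.1.1 = canW x := by
  classical
  have hR : ((canW x : weightSpace n k) : VT n) =
      ∑ s ∈ (Finset.univ.filter fun s : LeftIState n k => s.1.Adm x.1),
        q ^ s.1.wt x.1 • stdVec n s.1.1 := by
    rw [canW, Finset.sum_filter, AddSubmonoidClass.coe_finsetSum]
    refine Finset.sum_congr rfl fun s _ => ?_
    split_ifs with h
    · rw [Submodule.coe_smul, stdB_apply]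
    · simp
  rw [hR, canVec, ← Finset.sum_filter]
  symm
  have hφ : ∀ (s : LeftIState n k), s.1.Adm x.1 → ∀ i,
      (if x.1.elt i ∈ (Finset.univ.filter fun i => s.1.elt i ≠ x.1.elt i).image x.1.elt then
        x.1.elt i - 1 else x.1.elt i) = s.1.elt i := by
    intro s hs i
    have hmem : x.1.elt i ∈ (Finset.univ.filter fun i => s.1.elt i ≠ x.1.elt i).image x.1.elt ↔
        s.1.elt i ≠ x.1.elt i := by
      rw [Finset.mem_image]
      constructor
      · rintro ⟨j, hj, e⟩
        rw [x.1.elt_strictMono.injective e] at hj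
        exact (Finset.mem_filter.1 hj).2
      · intro h; exact ⟨i, Finset.mem_filter.2 ⟨Finset.mem_univ _, h⟩, rfl⟩
    have := hs i
    by_cases h : s.1.elt i = x.1.elt i
    · rw [if_neg (fun h' => hmem.1 h' h), h]
    · rw [if_pos (hmem.2 h)]
      omega
  refine Finset.sum_bij (fun s _ => (Finset.univ.filter fun i => s.1.elt i ≠ x.1.elt i).image x.1.elt)
    ?_ ?_ ?_ ?_
  · intro s hs
    have hs := (Finset.mem_filter.1 hs).2
    refine Finset.mem_filter.2 ⟨Finset.mem_powerset.2 fun a ha => ?_, ?_⟩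
    · obtain ⟨i, hi, rfl⟩ := Finset.mem_image.1 ha
      have := hs i
      have := (Finset.mem_filter.1 hi).2
      exact Finset.mem_erase.2 ⟨by omega, x.1.elt_mem i⟩
    · intro a ha b hb hab
      obtain ⟨i, rfl⟩ := (x.1.mem_iff a).1 ha
      obtain ⟨j, rfl⟩ := (x.1.mem_iff b).1 hb
      simp only at hab
      rw [hφ s hs, hφ s hs] at hab
      rw [s.1.elt_strictMono.injective hab]
  · intro s hs t ht h
    refine Subtype.ext (IState.ext_elt fun i => ?_)
    rw [← hφ s (Finset.mem_filter.1 hs).2, ← hφ t (Finset.mem_filter.1 ht).2]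
    change Finset.image _ _ = Finset.image _ _ at h
    rw [h]
  · intro S hS
    obtain ⟨hS, hinj⟩ := Finset.mem_filter.1 hS
    rw [Finset.mem_powerset] at hS
    let e : Fin k → ℕ := fun i => if x.1.elt i ∈ S then x.1.elt i - 1 else x.1.elt i
    have hpos : ∀ i, x.1.elt i ∈ S → 1 ≤ x.1.elt i := fun i hi =>
      Nat.one_le_iff_ne_zero.2 (Finset.mem_erase.1 (hS hi)).1
    have he : StrictMono e := by
      intro i j hij
      have h1 := x.1.elt_strictMono hij
      have h2 : e i ≠ e j := fun h => h1.ne (hinj (x.1.elt_mem i) (x.1.elt_mem j) h)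
      have := hpos i
      have := hpos j
      refine lt_of_le_of_ne ?_ h2
      simp only [e]
      split_ifs <;> omega
    have hlt : ∀ i, e i < n := fun i => by
      have := x.elt_lt i
      simp only [e]
      split_ifs <;> omega
    have helt : ∀ i, (IState.ofFun e he fun i => (hlt i).le).elt i = e i := IState.elt_ofFun _ _ _
    let s : LeftIState n k := ⟨IState.ofFun e he fun i => (hlt i).le, fun h => by
      obtain ⟨i, hi⟩ := (IState.mem_iff _ _).1 h
      rw [helt] at hi
      exact (hlt i).ne hi⟩
    have hse : ∀ i, s.1.elt i = e i := helt
    refine ⟨s, Finset.mem_filter.2 ⟨Finset.mem_univ _, fun i => ?_⟩, ?_⟩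
    · have := hpos i
      rw [hse]
      simp only [e]
      split_ifs <;> omega
    · ext a
      simp only [Finset.mem_image, Finset.mem_filter, Finset.mem_univ, true_and, hse]
      constructor
      · rintro ⟨i, hi, rfl⟩
        by_contra h
        exact hi (by simp only [e]; rw [if_neg h])
      · intro ha
        obtain ⟨i, rfl⟩ := (x.1.mem_iff a).1 (Finset.mem_of_mem_erase (hS ha))
        refine ⟨i, ?_, rfl⟩
        have := hpos i ha
        simp only [e]
        rw [if_pos ha]
        omega
  · intro s hs
    have hs := (Finset.mem_filter.1 hs).2
    congr 2
    · rw [Finset.card_image_of_injective _ x.1.elt_strictMono.injective, Finset.card_filter,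
        IState.wt]
      refine Finset.sum_congr rfl fun i _ => ?_
      have := hs i
      split_ifs <;> omega
    · conv_rhs => rw [← x.1.image_elt]
      rw [Finset.image_image]
      conv_lhs => rw [← s.1.image_elt]
      refine Finset.image_congr fun i _ => ?_
      exact (hφ s hs i).symm

/-- The transition matrix is unitriangular for the sum of the positions: the term `s = x` has
coefficient one, and every other admissible `s` has a strictly smaller sum. -/
lemma stdB_mem_span_canW (x : LeftIState n k) :
    stdB n k x ∈ Submodule.span (RatFunc ℂ) (Set.range (canW (n := n) (k := k))) := by
  induction h : ∑ i, x.1.elt i using Nat.strong_induction_on generalizing x with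
  | _ N ih =>
    have hself : x.1.Adm x.1 := fun i => ⟨le_rfl, Nat.le_succ _⟩
    have hx : canW x = stdB n k x + ∑ s ∈ Finset.univ.erase x,
        (if s.1.Adm x.1 then q ^ s.1.wt x.1 else 0) • stdB n k s := by
      rw [canW, ← Finset.add_sum_erase _ _ (Finset.mem_univ x), if_pos hself]
      have : x.1.wt x.1 = 0 := by simp [IState.wt]
      rw [this, pow_zero, one_smul]
    have hx' : stdB n k x = canW x + (-1 : RatFunc ℂ) • ∑ s ∈ Finset.univ.erase x,
        (if s.1.Adm x.1 then q ^ s.1.wt x.1 else 0) • stdB n k s := by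
      rw [hx, add_assoc]
      generalize (∑ s ∈ Finset.univ.erase x,
        (if s.1.Adm x.1 then q ^ s.1.wt x.1 else 0) • stdB n k s) = S
      nth_rewrite 1 [← one_smul (RatFunc ℂ) S]
      rw [← add_smul, add_neg_cancel, zero_smul, add_zero]
    rw [hx']
    refine Submodule.add_mem _ (Submodule.subset_span ⟨x, rfl⟩)
      (Submodule.smul_mem _ _ (sum_mem fun s hs => ?_))
    split_ifs with hadm
    · refine Submodule.smul_mem _ _ (ih _ ?_ s rfl)
      rw [← h]
      refine Finset.sum_lt_sum (fun i _ => (hadm i).1) ?_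
      by_contra hcon
      push Not at hcon
      exact (Finset.mem_erase.1 hs).1 (Subtype.ext (IState.ext_elt fun i =>
        le_antisymm (hadm i).1 (hcon i (Finset.mem_univ i))))
    · rw [zero_smul]; exact zero_mem _

variable (n k) in
/-- The canonical basis of the weight space. -/
def canB : Module.Basis (LeftIState n k) (RatFunc ℂ) (weightSpace n k) :=
  basisOfTopLeSpanOfCardEqFinrank canW (by
    rw [← (stdB n k).span_eq, Submodule.span_le]
    rintro _ ⟨x, rfl⟩
    exact stdB_mem_span_canW x) (Module.finrank_eq_card_basis (stdB n k)).symm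

lemma canB_apply (x : LeftIState n k) : canB n k x = canW x := by
  rw [canB, coe_basisOfTopLeSpanOfCardEqFinrank]

lemma stdForm_canB (x y : LeftIState n k) : stdForm n k (canB n k x) (canB n k y) =
    ∑ s : LeftIState n k, if s.1.Adm x.1 ∧ s.1.Adm y.1 then
      (q : RatFunc ℂ) ^ (s.1.wt x.1 + s.1.wt y.1) else 0 := by
  rw [canB_apply, canB_apply, canW, canW]
  simp only [map_sum, map_smul, LinearMap.sum_apply, LinearMap.smul_apply, stdForm_stdB,
    smul_eq_mul, mul_ite, mul_one, mul_zero, Finset.sum_ite_eq',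
    Finset.mem_univ, if_true]
  refine Finset.sum_congr rfl fun s _ => ?_
  by_cases h1 : s.1.Adm x.1 <;> by_cases h2 : s.1.Adm y.1 <;> simp [h1, h2, pow_add, mul_comm]

/-- The graded dimension of `I_x B_l(n, k) I_y`. -/
def gram (x y : LeftIState n k) : RatFunc ℂ := ozForm n k (canB n k x) (canB n k y)

lemma gram_of_tooFar {x y : LeftIState n k} (h : x.1.TooFar y.1) : gram x y = 0 := by
  change ((1 - q ^ 2) ^ k)⁻¹ * stdForm n k (canB n k x) (canB n k y) = 0
  rw [stdForm_canB, Finset.sum_eq_zero, mul_zero]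
  intro s _
  rw [if_neg]
  rintro ⟨h1, h2⟩
  exact IState.not_tooFar_of_adm h1 h2 h

lemma gram_of_not_tooFar {x y : LeftIState n k} (h : ¬ x.1.TooFar y.1) :
    gram x y = q ^ x.1.dist y.1 *
      ((∏ G ∈ x.1.genIntervals y.1, qNum G.2) / (1 - q ^ 2) ^ k) := by
  change ((1 - q ^ 2) ^ k)⁻¹ * stdForm n k (canB n k x) (canB n k y) = _
  rw [stdForm_canB, LeftIState.sum_adm_eq h, div_eq_mul_inv]
  ring

/-- The two computations meet here: the graded dimensions obtained from monomials in the algebra are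
the entries of the Gram matrix obtained from admissible states. For states that are too far both
vanish, since no state is admissible for both. -/
lemma hasGrDim_gram (K : Type u) [Field K] (x y : LeftIState n k) :
    HasGrDim (cornerGr K x y) (gram x y) := by
  by_cases h : x.1.TooFar y.1
  · rw [gram_of_tooFar h]; exact hasGrDim_cornerGr_tooFar h
  · rw [gram_of_not_tooFar h]; exact hasGrDim_cornerGr h

lemma ozForm_nondegenerate {w : weightSpace n k} (h : ∀ x, ozForm n k (canB n k x) w = 0) :
    w = 0 := by
  have h2 : (ozForm n k).flip w = 0 := (canB n k).ext fun x => h x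
  have h3 : ∀ x, stdForm n k (stdB n k x) w = 0 := by
    intro x
    have : ((1 - q ^ 2) ^ k)⁻¹ * stdForm n k (stdB n k x) w = 0 :=
      LinearMap.congr_fun h2 (stdB n k x)
    exact (mul_eq_zero.1 this).resolve_left (inv_ne_zero (pow_ne_zero _ one_sub_q_sq_ne_zero))
  have h4 : ∀ x, stdForm n k (stdB n k x) w = (stdB n k).repr w x := by
    intro x
    have : stdForm n k (stdB n k x) = (stdB n k).coord x := by
      refine (stdB n k).ext fun y => ?_
      rw [stdForm_stdB, Module.Basis.coord_apply, Module.Basis.repr_self, Finsupp.single_apply]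
      simp only [eq_comm]
    rw [this, Module.Basis.coord_apply]
  apply (stdB n k).repr.injective
  ext x
  rw [← h4, h3, map_zero, Finsupp.zero_apply]

end WeightSpace

/-! ### Homogeneous components in a graded module. -/

section Components

variable {K M : Type*} [CommRing K] [AddCommGroup M] [Module K M] {gr : ℤ → Submodule K M}

@[elab_as_elim]
lemma internal_induction (h : DirectSum.IsInternal gr) {p : M → Prop}
    (mem : ∀ d, ∀ m ∈ gr d, p m) (zero : p 0) (add : ∀ a b, p a → p b → p (a + b)) (m : M) :
    p m := by
  have hm : m ∈ ⨆ d, gr d := by rw [h.submodule_iSup_eq_top]; trivial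
  exact Submodule.iSup_induction gr (motive := p) hm mem zero add

/-- The decomposition of a graded module. -/
def decomp (h : DirectSum.IsInternal gr) : M ≃ₗ[K] DirectSum ℤ fun d => gr d :=
  (LinearEquiv.ofBijective (DirectSum.coeLinearMap gr) h).symm

lemma decomp_of_mem (h : DirectSum.IsInternal gr) {d : ℤ} {m : M} (hm : m ∈ gr d) :
    decomp h m = DirectSum.lof K ℤ (fun d => gr d) d ⟨m, hm⟩ := by
  rw [decomp, LinearEquiv.symm_apply_eq]
  exact (DirectSum.coeLinearMap_lof gr d ⟨m, hm⟩).symm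

/-- The component of degree `d`. -/
def comp (h : DirectSum.IsInternal gr) (d : ℤ) : M →ₗ[K] M :=
  (gr d).subtype ∘ₗ DirectSum.component K ℤ (fun d => gr d) d ∘ₗ (decomp h).toLinearMap

lemma comp_mem (h : DirectSum.IsInternal gr) (d : ℤ) (m : M) : comp h d m ∈ gr d :=
  (DirectSum.component K ℤ (fun d => gr d) d (decomp h m)).2

lemma comp_self (h : DirectSum.IsInternal gr) {d : ℤ} {m : M} (hm : m ∈ gr d) :
    comp h d m = m := by
  change ((DirectSum.component K ℤ (fun d => gr d) d (decomp h m) : gr d) : M) = m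
  rw [decomp_of_mem h hm, DirectSum.component.lof_self]

lemma comp_ne (h : DirectSum.IsInternal gr) {d e : ℤ} {m : M} (hm : m ∈ gr d) (hd : d ≠ e) :
    comp h e m = 0 := by
  change ((DirectSum.component K ℤ (fun d => gr d) e (decomp h m) : gr e) : M) = 0
  rw [decomp_of_mem h hm, DirectSum.component.of, dif_neg hd]
  rfl

end Components

/-! ### Homogeneous bases of graded projective modules. -/

section GradedBases

variable {K : Type u} [Field K] {A : Type u} [Ring A] [Algebra K A]

/-- The hypotheses on a graded algebra `A` with idempotents `I_x` under which finitely generated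
projective graded modules are direct sums of shifts of the modules `A I_x`: the degrees are
nonnegative, and `A_0` is spanned by the idempotents. -/
structure IdemGraded (𝒜 : ℤ → Submodule K A) {X : Type*} [Fintype X] (I : X → A) : Prop where
  internal : DirectSum.IsInternal 𝒜
  mul_mem : ∀ {i j : ℤ} {a b : A}, a ∈ 𝒜 i → b ∈ 𝒜 j → a * b ∈ 𝒜 (i + j)
  eq_zero_of_neg : ∀ {d : ℤ} {a : A}, a ∈ 𝒜 d → d < 0 → a = 0
  idem_mem : ∀ x, I x ∈ 𝒜 0
  idem : ∀ x, I x * I x = I x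
  sum_idem : ∑ x, I x = 1
  mul_idem : ∀ {a : A}, a ∈ 𝒜 0 → ∀ x, ∃ c : K, a * I x = c • I x

/-- A basis of a graded projective module `P`: homogeneous elements `m_i ∈ I_{x_i} P`, with
coordinate functions `c_i`. -/
structure GradedBasis (𝒜 : ℤ → Submodule K A) {X : Type*} (I : X → A) (P : GrProj 𝒜) where
  ι : Type u
  [fintype : Fintype ι]
  x : ι → X
  a : ι → ℤ
  m : ι → P.carrier
  c : ι → P.carrier →ₗ[A] A
  m_mem : ∀ i, m i ∈ P.gr (a i)
  idem_smul : ∀ i, I (x i) • m i = m i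
  c_mem : ∀ i {d : ℤ} {p : P.carrier}, p ∈ P.gr d → c i p ∈ 𝒜 (d - a i)
  c_mul : ∀ i p, c i p * I (x i) = c i p
  c_self : ∀ i, c i (m i) = I (x i)
  c_ne : ∀ i j, i ≠ j → c i (m j) = 0
  sum_smul : ∀ p, ∑ i, c i p • m i = p

attribute [instance] GradedBasis.fintype

variable {𝒜 : ℤ → Submodule K A} {X : Type*} [Fintype X] {I : X → A}

namespace IdemGraded

lemma comp_smul (h : IdemGraded 𝒜 I) (P : GrProj 𝒜) {a : ℤ} {m : P.carrier} (hm : m ∈ P.gr a)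
    (e : ℤ) (b : A) : comp P.internal (e + a) (b • m) = comp h.internal e b • m := by
  refine internal_induction h.internal ?_ ?_ ?_ b
  · intro d b hb
    by_cases hd : d = e
    · subst hd
      rw [comp_self _ hb, comp_self _ (P.smul_mem hb hm)]
    · rw [comp_ne _ hb hd, comp_ne _ (P.smul_mem hb hm) (by omega), zero_smul]
  · simp
  · intro b b' hb hb'
    rw [map_add, add_smul, add_smul, map_add, hb, hb']

lemma comp_mul (h : IdemGraded 𝒜 I) {i : ℤ} {a : A} (ha : a ∈ 𝒜 i) (j : ℤ) (b : A) :
    comp h.internal (i + j) (a * b) = a * comp h.internal j b := by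
  refine internal_induction h.internal ?_ ?_ ?_ b
  · intro d b hb
    by_cases hd : d = j
    · subst hd
      rw [comp_self _ hb, comp_self _ (h.mul_mem ha hb)]
    · rw [comp_ne _ hb hd, comp_ne _ (h.mul_mem ha hb) (by omega), mul_zero]
  · simp
  · intro b b' hb hb'
    rw [mul_add, map_add, map_add, mul_add, hb, hb']

/-- The component of degree `e` of a linear map `P → A`. -/
lemma exists_comp_hom (h : IdemGraded 𝒜 I) (P : GrProj 𝒜) (s : P.carrier →ₗ[A] A) (e : ℤ) :
    ∃ c : P.carrier →ₗ[A] A, ∀ d, ∀ p ∈ P.gr d, c p = comp h.internal (d + e) (s p) := by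
  -- The prescription on homogeneous elements defines a `K`-linear map on the direct sum; linearity
  -- over `A` is then checked on homogeneous scalars and vectors.
  let c : P.carrier →ₗ[K] A := DirectSum.toModule K ℤ A (fun d =>
    comp h.internal (d + e) ∘ₗ s.restrictScalars K ∘ₗ (P.gr d).subtype) ∘ₗ
      (decomp P.internal).toLinearMap
  have hc : ∀ d, ∀ p ∈ P.gr d, c p = comp h.internal (d + e) (s p) := by
    intro d p hp
    change DirectSum.toModule K ℤ A _ (decomp P.internal p) = _
    rw [decomp_of_mem _ hp, DirectSum.toModule_lof]
    rfl
  refine ⟨{ c with map_smul' := fun b p => ?_ }, hc⟩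
  change c (b • p) = b * c p
  refine internal_induction h.internal ?_ ?_ ?_ b
  · intro i b hb
    refine internal_induction P.internal ?_ ?_ ?_ p
    · intro d p hp
      rw [hc _ _ (P.smul_mem hb hp), hc _ _ hp, map_smul, smul_eq_mul, ← h.comp_mul hb, add_assoc]
    · simp
    · intro p p' hp hp'
      rw [smul_add, map_add, map_add, mul_add, hp, hp']
  · simp
  · intro b b' hb hb'
    rw [add_smul, map_add, add_mul, hb, hb']

/-- Cutting homogeneous elements by the idempotents gives generators of the form required, finitely
many suffice, and a generating set with the fewest elements has no redundant member. -/
lemma exists_minimal_generators (h : IdemGraded 𝒜 I) (P : GrProj 𝒜) :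
    ∃ S : Finset P.carrier, (∀ m ∈ S, ∃ a x, m ∈ P.gr a ∧ I x • m = m) ∧
      Submodule.span A (S : Set P.carrier) = ⊤ ∧
      ∀ m ∈ S, m ∉ Submodule.span A ((S : Set P.carrier) \ {m}) := by
  classical
  let H : Set P.carrier := {m | ∃ a x, m ∈ P.gr a ∧ I x • m = m}
  have hH : Submodule.span A H = ⊤ := by
    rw [eq_top_iff]
    rintro m -
    refine internal_induction P.internal ?_ ?_ ?_ m
    · intro d m hm
      rw [← one_smul A m, ← h.sum_idem, Finset.sum_smul]
      refine sum_mem fun x _ => Submodule.subset_span ⟨d, x, ?_, ?_⟩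
      · have := P.smul_mem (h.idem_mem x) hm
        rwa [zero_add] at this
      · rw [smul_smul, h.idem]
    · exact zero_mem _
    · intro a b ha hb
      exact add_mem ha hb
  have hfin : ∃ S : Finset P.carrier, (S : Set P.carrier) ⊆ H ∧
      Submodule.span A (S : Set P.carrier) = ⊤ := by
    have hfg : (Submodule.span A H).FG := by rw [hH]; exact P.finite.fg_top
    obtain ⟨S, hS, e⟩ := Submodule.fg_span_iff_fg_span_finset_subset H |>.1 hfg
    exact ⟨S, hS, by rw [← e, hH]⟩
  obtain ⟨S, ⟨hS, htop⟩, hmin⟩ := WellFounded.has_min (measure Finset.card).wf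
    {S : Finset P.carrier | (S : Set P.carrier) ⊆ H ∧
      Submodule.span A (S : Set P.carrier) = ⊤} hfin
  refine ⟨S, fun m hm => hS hm, htop, fun m hm hspan => ?_⟩
  refine hmin (S.erase m) ⟨fun a ha => hS (Finset.mem_of_mem_erase ha), ?_⟩
    (Finset.card_erase_lt_of_mem hm)
  rw [eq_top_iff, ← htop, Submodule.span_le, Finset.coe_erase]
  intro a ha
  by_cases e : a = m
  · rw [e]; exact hspan
  · exact Submodule.subset_span ⟨ha, e⟩

/-- A graded form of Nakayama's lemma. A homogeneous splitting of the presentation by minimal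
generators differs from the identity of the free cover by an idempotent matrix `w`. Minimality and
nonnegativity of the degrees make `w` strictly triangular, so `w = 0` and the generators form a
basis. -/
theorem exists_gradedBasis (h : IdemGraded 𝒜 I) (P : GrProj 𝒜) :
    Nonempty (GradedBasis 𝒜 I P) := by
  classical
  obtain ⟨S, hS, htop, hmin⟩ := h.exists_minimal_generators P
  choose a x hmem hidem using fun i : S => hS i.1 i.2
  have := P.projective
  obtain ⟨s, hs⟩ := Module.projective_lifting_property
    (Fintype.linearCombination A (fun i : S => i.1)) (LinearMap.id (R := A) (M := P.carrier)) (by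
      rw [← LinearMap.range_eq_top, Fintype.range_linearCombination]
      simpa using htop)
  have hs : ∀ p, ∑ i : S, s p i • i.1 = p := fun p => LinearMap.congr_fun hs p
  choose c₀ hc₀ using fun i : S => h.exists_comp_hom P (LinearMap.proj i ∘ₗ s) (- a i)
  -- The coordinates of the splitting are replaced by their components of degree `- a i` and
  -- multiplied on the right by `I (x i)`. The reconstruction formula survives because `m_i` is
  -- homogeneous of degree `a i` and fixed by `I (x i)`.
  let c : S → P.carrier →ₗ[A] A := fun i => LinearMap.toSpanSingleton A A (I (x i)) ∘ₗ c₀ i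
  have hc : ∀ i p, c i p = c₀ i p * I (x i) := fun i p => rfl
  have c_mem : ∀ i {d : ℤ} {p : P.carrier}, p ∈ P.gr d → c i p ∈ 𝒜 (d - a i) := by
    intro i d p hp
    rw [hc, hc₀ i d p hp]
    have := h.mul_mem (comp_mem h.internal (d + -a i) (s p i)) (h.idem_mem (x i))
    rwa [add_zero, ← sub_eq_add_neg] at this
  have c_mul : ∀ i p, c i p * I (x i) = c i p := by
    intro i p
    rw [hc, mul_assoc, h.idem]
  have hsum : ∀ p, ∑ i, c i p • i.1 = p := by
    intro p
    refine internal_induction P.internal ?_ ?_ ?_ p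
    · intro d p hp
      conv_rhs => rw [← comp_self P.internal hp, ← hs p, map_sum]
      refine Finset.sum_congr rfl fun i _ => ?_
      have := h.comp_smul P (hmem i) (d + -a i) (s p i)
      rw [neg_add_cancel_right] at this
      rw [this, hc, mul_smul, hidem i, hc₀ i d p hp]
      rfl
    · simp
    · intro p p' hp hp'
      simp only [map_add, add_smul, Finset.sum_add_distrib, hp, hp']
  let w : S → S → A := fun i j => (if i = j then I (x j) else 0) - c j i.1
  have w_mem : ∀ i j, w i j ∈ 𝒜 (a i - a j) := by
    intro i j
    refine sub_mem ?_ (c_mem j (hmem i))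
    split_ifs with e
    · rw [e, sub_self]; exact h.idem_mem _
    · exact zero_mem _
  have w_mul : ∀ i j, w i j * I (x j) = w i j := by
    intro i j
    simp only [w]
    rw [sub_mul, c_mul, ite_mul, h.idem, zero_mul]
  have w_sum : ∀ i, ∑ j, w i j • j.1 = 0 := by
    intro i
    simp only [w, sub_smul, Finset.sum_sub_distrib, hsum, ite_smul, zero_smul]
    rw [Finset.sum_ite_eq, if_pos (Finset.mem_univ _), hidem i, sub_self]
  -- The coordinate `c j` is applied to the relation `w_sum`.
  have w_idem : ∀ i j, w i j = ∑ l, w i l * w l j := by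
    intro i j
    have e := congrArg (c j) (w_sum i)
    rw [map_sum, map_zero] at e
    have e2 : ∀ l, c j (w i l • l.1) = (if l = j then w i l * I (x j) else 0) - w i l * w l j := by
      intro l
      have : c j l.1 = (if l = j then I (x j) else 0) - w l j := (sub_sub_cancel _ _).symm
      rw [map_smul, smul_eq_mul, this, mul_sub, mul_ite, mul_zero]
    rw [Finset.sum_congr rfl fun l _ => e2 l, Finset.sum_sub_distrib, Finset.sum_ite_eq',
      if_pos (Finset.mem_univ _), w_mul] at e
    exact sub_eq_zero.1 e
  have w_zero : ∀ i j, a i ≤ a j → w i j = 0 := by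
    intro i j hij
    rcases hij.lt_or_eq with hlt | heq
    · exact h.eq_zero_of_neg (w_mem i j) (by omega)
    -- In degree zero the entry is a scalar multiple of `I (x j)`. If the scalar were nonzero, the
    -- relation `w_sum` could be solved for the generator `m_j`, against minimality.
    · have h0 := w_mem i j
      rw [heq, sub_self] at h0
      obtain ⟨r, hr⟩ := h.mul_idem h0 (x j)
      rw [w_mul] at hr
      by_cases hr0 : r = 0
      · rw [hr, hr0, zero_smul]
      exfalso
      refine hmin j.1 j.2 ?_
      have e := w_sum i
      rw [← Finset.add_sum_erase _ _ (Finset.mem_univ j), hr, smul_assoc, hidem j] at e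
      have e2 : j.1 = (- algebraMap K A r⁻¹) • ∑ l ∈ Finset.univ.erase j, w i l • l.1 := by
        rw [neg_smul, algebraMap_smul, ← smul_neg, ← eq_neg_of_add_eq_zero_left e, smul_smul,
          inv_mul_cancel₀ hr0, one_smul]
      have hspan : ∑ l ∈ Finset.univ.erase j, w i l • l.1 ∈
          Submodule.span A ((S : Set P.carrier) \ {j.1}) :=
        sum_mem fun l hl => Submodule.smul_mem _ _
          (Submodule.subset_span ⟨l.2, fun e => (Finset.mem_erase.1 hl).1 (Subtype.ext e)⟩)
      have := Submodule.smul_mem _ (- algebraMap K A r⁻¹) hspan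
      rwa [← e2] at this
  -- A product `w i l * w l j` can be nonzero only if `a l > a j`, in which case the first factor
  -- has a smaller degree difference and is zero by induction.
  have w_all : ∀ N : ℕ, ∀ i j, a i - a j ≤ N → w i j = 0 := by
    intro N
    induction N with
    | zero => intro i j hij; exact w_zero i j (by push_cast at hij; omega)
    | succ N ih =>
      intro i j hij
      rw [w_idem]
      refine Finset.sum_eq_zero fun l _ => ?_
      by_cases hl : a l ≤ a j
      · rw [w_zero l j hl, mul_zero]
      · rw [ih i l (by push_cast at hij; omega), zero_mul]
  have hw : ∀ i j, w i j = 0 := fun i j => w_all (a i - a j).toNat i j (by omega)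
  exact ⟨{
    ι := S
    x := fun i => x i
    a := fun i => a i
    m := fun i => i.1
    c := c
    m_mem := fun i => hmem i
    idem_smul := fun i => hidem i
    c_mem := c_mem
    c_mul := c_mul
    c_self := fun i => by
      have := hw i i
      simp only [w, if_true] at this
      exact (sub_eq_zero.1 this).symm
    c_ne := fun i j hij => by
      have := hw j i
      simp only [w] at this
      rw [if_neg (Ne.symm hij), zero_sub, neg_eq_zero] at this
      exact this
    sum_smul := hsum }⟩

end IdemGraded

end GradedBases

/-! ### Additivity of graded dimensions. -/

section GradedDimension

variable {K : Type*} [Field K] {M : Type*} [AddCommGroup M] [Module K M]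

lemma HasGrDim.of_equiv_pi {ι : Type*} [Fintype ι] {N : ι → Type*} [∀ i, AddCommGroup (N i)]
    [∀ i, Module K (N i)] {ℳ : ℤ → Submodule K M} {𝒩 : ∀ i, ℤ → Submodule K (N i)}
    {r : ι → RatFunc ℂ} (h : ∀ i, HasGrDim (𝒩 i) (r i)) (e : ∀ d, ℳ d ≃ₗ[K] ∀ i, 𝒩 i d) :
    HasGrDim ℳ (∑ i, r i) := by
  intro d
  have : ∀ i, Module.Finite K (𝒩 i d) := fun i => (h i d).1
  refine ⟨Module.Finite.equiv (e d).symm, ?_⟩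
  rw [(e d).finrank_eq, Module.finrank_pi_fintype, map_sum, HahnSeries.coeff_sum, Nat.cast_sum]
  exact Finset.sum_congr rfl fun i _ => (h i d).2

lemma HasGrDim.add_of_exact {M' M'' : Type*} [AddCommGroup M'] [Module K M'] [AddCommGroup M'']
    [Module K M''] {ℳ : ℤ → Submodule K M} {ℳ' : ℤ → Submodule K M'}
    {ℳ'' : ℤ → Submodule K M''} {r r' r'' : RatFunc ℂ} (h : HasGrDim ℳ r) (h' : HasGrDim ℳ' r')
    (h'' : HasGrDim ℳ'' r'') (f : ∀ d, ℳ' d →ₗ[K] ℳ d) (g : ∀ d, ℳ d →ₗ[K] ℳ'' d)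
    (hf : ∀ d, Function.Injective (f d)) (hfg : ∀ d, Function.Exact (f d) (g d))
    (hg : ∀ d, Function.Surjective (g d)) : r = r' + r'' := by
  refine RingHom.injective _ (?_ : (r : LaurentSeries ℂ) = ((r' + r'' : RatFunc ℂ) :
    LaurentSeries ℂ))
  ext d
  have := (h d).1
  rw [map_add, HahnSeries.coeff_add, (h d).2, (h' d).2, (h'' d).2, ← Nat.cast_add,
    ← LinearMap.finrank_range_add_finrank_ker (g d), LinearMap.range_eq_top.2 (hg d), finrank_top,
    LinearMap.exact_iff.1 (hfg d), LinearMap.finrank_range_of_inj (hf d), add_comm]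

end GradedDimension

/-! ### The twisted dual and Hom spaces in coordinates. -/

section GradedBases

variable {K : Type u} [Field K] {A : Type u} [Ring A] [Algebra K A] {𝒜 : ℤ → Submodule K A}
  {X : Type*} {I : X → A}

/-- The space `I_x A I_y`, in degree `d`. -/
def corner (𝒜 : ℤ → Submodule K A) (I : X → A) (x y : X) (d : ℤ) : Submodule K A :=
  LinearMap.range (LinearMap.mulLeftRight K (I x, I y)) ⊓ 𝒜 d

/-- The space `I_x P`, in degree `d`. -/
def GrProj.isotypic (P : GrProj 𝒜) (I : X → A) (x : X) (d : ℤ) : Submodule K P.carrier where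
  carrier := {m | m ∈ P.gr d ∧ I x • m = m}
  add_mem' h h' := ⟨add_mem h.1 h'.1, by rw [smul_add, h.2, h'.2]⟩
  zero_mem' := ⟨zero_mem _, smul_zero _⟩
  smul_mem' c m h := ⟨(P.gr d).smul_mem c h.1, by rw [smul_comm, h.2]⟩

lemma IdemGraded.mem_corner [Fintype X] (h : IdemGraded 𝒜 I) {x y : X} {d : ℤ} {a : A} :
    a ∈ corner 𝒜 I x y d ↔ (I x * a = a ∧ a * I y = a) ∧ a ∈ 𝒜 d := by
  refine and_congr_left fun _ => ⟨?_, fun e => ⟨a, ?_⟩⟩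
  · rintro ⟨b, rfl⟩
    rw [LinearMap.mulLeftRight_apply]
    exact ⟨by rw [← mul_assoc, ← mul_assoc, h.idem], by rw [mul_assoc, h.idem]⟩
  · rw [LinearMap.mulLeftRight_apply, e.1, e.2]

variable {P : GrProj 𝒜}

/-- The coordinates of the elements of `I_x P`. -/
def GradedBasis.isotypicEquiv [Fintype X] (h : IdemGraded 𝒜 I) (b : GradedBasis 𝒜 I P) (x : X) (d : ℤ) :
    P.isotypic I x d ≃ₗ[K] ∀ i, corner 𝒜 I x (b.x i) (d - b.a i) :=
  LinearEquiv.ofBijective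
    (LinearMap.pi fun i => ((b.c i).restrictScalars K).restrict (fun m (hm : m ∈ P.isotypic I x d) =>
      h.mem_corner.2 ⟨⟨by
        change I x * b.c i m = b.c i m
        rw [← smul_eq_mul, ← map_smul, hm.2], b.c_mul i m⟩, b.c_mem i hm.1⟩)) (by
    classical
    constructor
    · rw [injective_iff_map_eq_zero]
      intro m hm
      refine Subtype.ext ?_
      rw [← b.sum_smul m.1]
      refine Finset.sum_eq_zero fun i _ => ?_
      have : b.c i m.1 = 0 := congrArg Subtype.val (congrFun hm i)
      rw [this, zero_smul]
    · intro f
      have hf := fun i => h.mem_corner.1 (f i).2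
      refine ⟨⟨∑ i, (f i).1 • b.m i, sum_mem fun i _ => ?_, ?_⟩, ?_⟩
      · have := P.smul_mem (hf i).2 (b.m_mem i)
        rwa [sub_add_cancel] at this
      · rw [Finset.smul_sum]
        exact Finset.sum_congr rfl fun i _ => by rw [smul_smul, (hf i).1.1]
      · funext j
        refine Subtype.ext ?_
        change b.c j (∑ i, (f i).1 • b.m i) = f j
        rw [map_sum, Finset.sum_eq_single j]
        · rw [map_smul, b.c_self, smul_eq_mul, (hf j).1.2]
        · intro i _ hi
          rw [map_smul, b.c_ne j i hi.symm, smul_zero]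
        · intro hj
          exact absurd (Finset.mem_univ j) hj)

lemma GradedBasis.hasGrDim_isotypic [Fintype X] (h : IdemGraded 𝒜 I) (b : GradedBasis 𝒜 I P)
    {G : X → X → RatFunc ℂ} (hG : ∀ x y, HasGrDim (corner 𝒜 I x y) (G x y)) (x : X) :
    HasGrDim (P.isotypic I x) (∑ i, q ^ b.a i * G x (b.x i)) :=
  HasGrDim.of_equiv_pi (fun i => (hG x (b.x i)).shift (b.a i)) (b.isotypicEquiv h x)

/-- An anti-involution `ψ` of a graded algebra that fixes the idempotents `I_x`. -/
structure AntiInvolution (𝒜 : ℤ → Submodule K A) (I : X → A) (ψ : A →+* Aᵐᵒᵖ) : Prop where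
  invol : ∀ a, (ψ (ψ a).unop).unop = a
  idem : ∀ x, (ψ (I x)).unop = I x
  mem : ∀ {d : ℤ} {a : A}, a ∈ 𝒜 d → (ψ a).unop ∈ 𝒜 d

variable {ψ : A →+* Aᵐᵒᵖ} {P' : GrProj 𝒜}

/-- The coordinate function `c_i` as an element of `^∨P^ψ`. -/
def GradedBasis.dual (b : GradedBasis 𝒜 I P) (ψ : A →+* Aᵐᵒᵖ) (i : b.ι) : TwDual ψ P := b.c i

/-- The value of an element of `^∨P^ψ`. -/
def TwDual.eval (τ : TwDual ψ P) (p : P.carrier) : A := (show P.carrier →ₗ[A] A from τ) p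

lemma TwDual.ext' {τ τ' : TwDual ψ P} (h : ∀ p, τ.eval p = τ'.eval p) : τ = τ' :=
  LinearMap.ext h

/-- Expanding `p` in the basis gives `τ(p) = ∑ c_i(p) τ(m_i)`. Right multiplication by `τ(m_i)` is
the twisted left action of `ψ(τ(m_i))`, because `ψ` is an involution. -/
lemma GradedBasis.sum_dual (hψ : AntiInvolution 𝒜 I ψ) (b : GradedBasis 𝒜 I P)
    (τ : TwDual ψ P) : ∑ i, (ψ (τ.eval (b.m i))).unop • b.dual ψ i = τ := by
  refine TwDual.ext' fun p => ?_
  have e : ∀ (S : Finset b.ι) (f : b.ι → TwDual ψ P),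
      TwDual.eval (∑ i ∈ S, f i) p = ∑ i ∈ S, (f i).eval p := fun S f =>
    LinearMap.sum_apply (M := P.carrier) (M₂ := A) S (fun i => (show P.carrier →ₗ[A] A from f i)) p
  rw [e]
  conv_rhs => rw [← b.sum_smul p]
  change _ = (show P.carrier →ₗ[A] A from τ) _
  rw [map_sum]
  refine Finset.sum_congr rfl fun i _ => ?_
  rw [map_smul]
  change b.c i p * (ψ (ψ _).unop).unop = _
  rw [hψ.invol]
  rfl

/-- The values of a graded homomorphism `^∨P^ψ → P'` on the dual basis. -/
def GradedBasis.homCoord (hψ : AntiInvolution 𝒜 I ψ) (b : GradedBasis 𝒜 I P) (P' : GrProj 𝒜)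
    (d : ℤ) :
    homGr (A := A) (TwDual.gr ψ P) P'.gr d →ₗ[K] ∀ i, P'.isotypic I (b.x i) (d - b.a i) where
  toFun φ i := ⟨φ.1 (b.dual ψ i), by
    have := φ.2 (- b.a i) (b.dual ψ i) (fun j p hp => by
      rw [← sub_eq_add_neg]; exact b.c_mem i hp)
    rwa [neg_add_eq_sub] at this, by
    -- The idempotent acts on the dual vector by right multiplication with `ψ(I_x) = I_x`, which
    -- fixes `c_i`.
    rw [← map_smul]
    congr 1
    refine TwDual.ext' fun p => ?_
    change b.c i p * (ψ _).unop = b.c i p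
    rw [hψ.idem, b.c_mul]⟩
  map_add' φ φ' := rfl
  map_smul' c φ := rfl

/-- A graded homomorphism `^∨P^ψ → P'` is determined by arbitrary values on the dual basis. -/
def GradedBasis.homEquiv (hψ : AntiInvolution 𝒜 I ψ) (b : GradedBasis 𝒜 I P) (d : ℤ) :
    homGr (A := A) (TwDual.gr ψ P) P'.gr d ≃ₗ[K] ∀ i, P'.isotypic I (b.x i) (d - b.a i) :=
  LinearEquiv.ofBijective (b.homCoord hψ P' d) (by
    classical
    constructor
    · rw [injective_iff_map_eq_zero]
      intro φ hφ
      refine Subtype.ext (LinearMap.ext fun τ => ?_)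
      have h0 : ∀ i, φ.1 (b.dual ψ i) = 0 := fun i => congrArg Subtype.val (congrFun hφ i)
      rw [← b.sum_dual hψ τ, map_sum]
      refine Finset.sum_eq_zero fun i _ => ?_
      rw [map_smul, h0, smul_zero]
    · intro f
      -- The formula is forced by `sum_dual`. It is linear because the anti-homomorphism `ψ` turns
      -- the twisted action back into left multiplication.
      let φ : TwDual ψ P →ₗ[A] P'.carrier :=
        { toFun := fun τ => ∑ i, (ψ (τ.eval (b.m i))).unop • (f i).1
          map_add' := fun τ τ' => by
            rw [← Finset.sum_add_distrib]
            refine Finset.sum_congr rfl fun i _ => ?_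
            change (ψ (τ.eval (b.m i) + τ'.eval (b.m i))).unop • _ = _
            rw [map_add, MulOpposite.unop_add, add_smul]
          map_smul' := fun a τ => by
            rw [RingHom.id_apply, Finset.smul_sum]
            refine Finset.sum_congr rfl fun i _ => ?_
            change (ψ (τ.eval (b.m i) * (ψ a).unop)).unop • _ = _
            rw [map_mul, MulOpposite.unop_mul, hψ.invol, mul_smul] }
      refine ⟨⟨φ, fun j τ hτ => sum_mem fun i _ => ?_⟩, ?_⟩
      · have := P'.smul_mem (hψ.mem (hτ _ _ (b.m_mem i))) (f i).2.1
        have e : b.a i + j + (d - b.a i) = j + d := by ring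
        rw [e] at this
        exact this
      · funext j
        refine Subtype.ext ?_
        change ∑ i, (ψ (b.c j (b.m i))).unop • (f i).1 = f j
        rw [Finset.sum_eq_single j]
        · rw [b.c_self, hψ.idem, (f j).2.2]
        · intro i _ hi
          rw [b.c_ne j i hi.symm, map_zero, MulOpposite.unop_zero, zero_smul]
        · intro hj
          exact absurd (Finset.mem_univ j) hj)

/-- The dual basis vector `c_i` has degree `- a_i`, so a map of degree `d` sends it to degree `d -
a_i`. Dualizing twice in this sense makes the result symmetric: the shifts of both modules enter
with positive sign, as bilinearity over `ℂ(q)` requires. -/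
lemma GradedBasis.hasGrDim_hom [Fintype X] (h : IdemGraded 𝒜 I) (hψ : AntiInvolution 𝒜 I ψ)
    (b : GradedBasis 𝒜 I P) (b' : GradedBasis 𝒜 I P')
    {G : X → X → RatFunc ℂ} (hG : ∀ x y, HasGrDim (corner 𝒜 I x y) (G x y)) :
    HasGrDim (homGr (A := A) (TwDual.gr ψ P) P'.gr)
      (∑ i, q ^ b.a i * ∑ j, q ^ b'.a j * G (b.x i) (b'.x j)) :=
  HasGrDim.of_equiv_pi (fun i => (b'.hasGrDim_isotypic h hG (b.x i)).shift (b.a i))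
    (b.homEquiv hψ)

end GradedBases

/-! ### Classes in `K_0` in terms of the modules `A I_x`. -/

section Classes

variable {K : Type u} [Field K] {A : Type u} [Ring A] [Algebra K A] {𝒜 : ℤ → Submodule K A}

lemma GrProj.cls_eq_add {P' P P'' : GrProj 𝒜} (a : P'.carrier →ₗ[A] P.carrier)
    (b : P.carrier →ₗ[A] P''.carrier) (ha : ∀ d, ∀ m ∈ P'.gr d, a m ∈ P.gr d)
    (hb : ∀ d, ∀ m ∈ P.gr d, b m ∈ P''.gr d) (h1 : Function.Injective a)
    (h2 : Function.Exact a b) (h3 : Function.Surjective b) : P.cls = P'.cls + P''.cls := by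
  have : (QuotientAddGroup.mk (FreeAbelianGroup.of P - FreeAbelianGroup.of P' -
      FreeAbelianGroup.of P'') : K0 𝒜) = 0 :=
    (QuotientAddGroup.eq_zero_iff _).2
      (AddSubgroup.subset_closure ⟨P', P, P'', a, b, ha, hb, h1, h2, h3, rfl⟩)
  have e : P.cls - P'.cls - P''.cls = 0 := this
  rw [sub_sub, sub_eq_zero] at e
  exact e

/-- The image of an idempotent endomorphism of degree zero. -/
def GrProj.image (P : GrProj 𝒜) (e : P.carrier →ₗ[A] P.carrier) (he : ∀ p, e (e p) = e p)
    (hgr : ∀ d, ∀ p ∈ P.gr d, e p ∈ P.gr d) : GrProj 𝒜 where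
  carrier := LinearMap.range e
  gr := fun d => (P.gr d).comap ((LinearMap.range e).subtype.restrictScalars K)
  internal := isInternal_of_retract P.internal _ Subtype.val_injective
    e.rangeRestrict.toAddMonoidHom (fun x => by
      obtain ⟨_, p, rfl⟩ := x
      exact Subtype.ext (he p)) hgr
  smul_mem := fun ha hm => P.smul_mem ha hm
  finite := have := P.finite; Module.Finite.range e
  projective := have := P.projective
    Module.Projective.of_split (LinearMap.range e).subtype e.rangeRestrict (LinearMap.ext fun x => by
      obtain ⟨_, p, rfl⟩ := x
      exact Subtype.ext (he p))

variable {X : Type*} {I : X → A} {P : GrProj 𝒜}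

namespace GradedBasis

/-- The projection of `P` on the span of some of the basis vectors. -/
def proj (b : GradedBasis 𝒜 I P) (S : Finset b.ι) : P.carrier →ₗ[A] P.carrier :=
  ∑ i ∈ S, LinearMap.toSpanSingleton A P.carrier (b.m i) ∘ₗ b.c i

lemma proj_apply (b : GradedBasis 𝒜 I P) (S : Finset b.ι) (p : P.carrier) :
    b.proj S p = ∑ i ∈ S, b.c i p • b.m i := by
  rw [proj, LinearMap.sum_apply]
  rfl

lemma c_proj (b : GradedBasis 𝒜 I P) [DecidableEq b.ι] (S : Finset b.ι) (p : P.carrier) (j : b.ι) :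
    b.c j (b.proj S p) = if j ∈ S then b.c j p else 0 := by
  rw [proj_apply, map_sum]
  have : ∀ i, b.c j (b.c i p • b.m i) = if j = i then b.c j p else 0 := by
    intro i
    rw [map_smul]
    split_ifs with e
    · rw [← e, b.c_self, smul_eq_mul, b.c_mul]
    · rw [b.c_ne _ _ e, smul_zero]
  rw [Finset.sum_congr rfl fun i _ => this i, Finset.sum_ite_eq]

lemma mem_range_proj (b : GradedBasis 𝒜 I P) {S : Finset b.ι} {p : P.carrier} :
    p ∈ LinearMap.range (b.proj S) ↔ ∀ j ∉ S, b.c j p = 0 := by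
  classical
  constructor
  · rintro ⟨p, rfl⟩ j hj
    rw [c_proj, if_neg hj]
  · intro h
    refine ⟨p, ?_⟩
    rw [proj_apply]
    conv_rhs => rw [← b.sum_smul p]
    exact Finset.sum_subset (Finset.subset_univ S) fun j _ hj => by rw [h j hj, zero_smul]

/-- The span of some of the basis vectors. -/
def sub (b : GradedBasis 𝒜 I P) (S : Finset b.ι) : GrProj 𝒜 :=
  P.image (b.proj S) (fun p => by
    classical
    rw [b.proj_apply, b.proj_apply]
    refine Finset.sum_congr rfl fun i hi => ?_
    rw [← b.proj_apply, b.c_proj, if_pos hi]) (fun d p hp => by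
    rw [b.proj_apply]
    refine sum_mem fun i _ => ?_
    have := P.smul_mem (b.c_mem i hp) (b.m_mem i)
    rwa [sub_add_cancel] at this)

lemma eq_zero_of_mem_sub_empty (b : GradedBasis 𝒜 I P) (p : (b.sub ∅).carrier) : p = 0 := by
  refine Subtype.ext ?_
  change p.1 = 0
  rw [← b.sum_smul p.1]
  exact Finset.sum_eq_zero fun i _ => by
    rw [b.mem_range_proj.1 p.2 i (Finset.notMem_empty i), zero_smul]

/-- For the zero module the identity maps form a short exact sequence with all three terms equal, so
its class equals its double. -/
lemma cls_sub_empty (b : GradedBasis 𝒜 I P) : (b.sub ∅).cls = 0 := by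
  have := GrProj.cls_eq_add (P' := b.sub ∅) (P := b.sub ∅) (P'' := b.sub ∅) LinearMap.id
    LinearMap.id (fun _ _ h => h) (fun _ _ h => h) (fun _ _ h => h)
    (fun p => iff_of_true (b.eq_zero_of_mem_sub_empty _) ⟨p, rfl⟩) (fun p => ⟨p, rfl⟩)
  exact left_eq_add.1 this

/-- The span of all basis vectors is a different object from `P`, so the two classes are related by
an exact sequence whose quotient is the zero module. -/
lemma cls_sub_univ (b : GradedBasis 𝒜 I P) : P.cls = (b.sub Finset.univ).cls := by
  have := GrProj.cls_eq_add (P' := b.sub Finset.univ) (P := P) (P'' := b.sub ∅)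
    (LinearMap.range (b.proj Finset.univ)).subtype 0 (fun _ _ h => h) (fun _ _ _ => zero_mem _)
    Subtype.val_injective
    (fun p => iff_of_true rfl ⟨⟨p, b.mem_range_proj.2 fun j hj => absurd (Finset.mem_univ j) hj⟩,
      rfl⟩)
    (fun p => ⟨0, (b.eq_zero_of_mem_sub_empty p).symm⟩)
  rw [this, cls_sub_empty, add_zero]

/-- The coordinate `c_i` maps the larger span onto `A I_{x_i}`, and its kernel there is the smaller
span. The generator `m_i` has degree `a_i`, whence the shift. -/
lemma cls_sub_insert [Fintype X] (h : IdemGraded 𝒜 I) (b : GradedBasis 𝒜 I P) [DecidableEq b.ι]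
    {S : Finset b.ι} {i : b.ι} (hi : i ∉ S) : (b.sub (insert i S)).cls = (b.sub S).cls +
      ((GrProj.ofIdem h.internal h.mul_mem (h.idem (b.x i)) (h.idem_mem (b.x i))).shift
        (b.a i)).cls := by
  have hle : LinearMap.range (b.proj S) ≤ LinearMap.range (b.proj (insert i S)) := fun p hp =>
    b.mem_range_proj.2 fun j hj => b.mem_range_proj.1 hp j fun h => hj (Finset.mem_insert_of_mem h)
  let g : LinearMap.range (b.proj (insert i S)) →ₗ[A] Submodule.span A {I (b.x i)} :=
    (b.c i ∘ₗ (LinearMap.range (b.proj (insert i S))).subtype).codRestrict _ (fun p =>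
      Submodule.mem_span_singleton.2 ⟨b.c i p.1, b.c_mul i p.1⟩)
  refine GrProj.cls_eq_add (P' := b.sub S) (P := b.sub (insert i S))
    (P'' := (GrProj.ofIdem h.internal h.mul_mem (h.idem (b.x i)) (h.idem_mem (b.x i))).shift (b.a i))
    (Submodule.inclusion hle) g (fun _ _ h => h) (fun d p hp => b.c_mem i hp)
    (Submodule.inclusion_injective hle) ?_ ?_
  · intro p
    constructor
    · intro hp
      have hp' : b.c i p.1 = 0 := congrArg Subtype.val hp
      refine ⟨⟨p.1, b.mem_range_proj.2 fun j hj => ?_⟩, rfl⟩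
      by_cases e : j = i
      · rw [e, hp']
      · exact b.mem_range_proj.1 p.2 j fun h => (Finset.mem_insert.1 h).elim e hj
    · rintro ⟨p, rfl⟩
      exact Subtype.ext (b.mem_range_proj.1 p.2 i hi)
  · rintro ⟨p, hp⟩
    obtain ⟨a, rfl⟩ := Submodule.mem_span_singleton.1 hp
    refine ⟨⟨a • b.m i, b.mem_range_proj.2 fun j hj => ?_⟩, Subtype.ext ?_⟩
    · rw [map_smul, b.c_ne _ _ fun e => hj (Finset.mem_insert.2 (Or.inl e)), smul_zero]
    · change b.c i (a • b.m i) = a • I (b.x i)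
      rw [map_smul, b.c_self]

lemma cls_eq [Fintype X] (h : IdemGraded 𝒜 I) (b : GradedBasis 𝒜 I P) : P.cls =
    ∑ i, (LaurentPolynomial.T (b.a i) : LaurentPolynomial ℤ) •
      (GrProj.ofIdem h.internal h.mul_mem (h.idem (b.x i)) (h.idem_mem (b.x i))).cls := by
  classical
  rw [b.cls_sub_univ]
  induction (Finset.univ : Finset b.ι) using Finset.induction_on with
  | empty => rw [b.cls_sub_empty, Finset.sum_empty]
  | insert i S hi ih => rw [b.cls_sub_insert h hi, Finset.sum_insert hi, ih, T_smul_cls, add_comm]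

end GradedBasis

lemma algebraMap_T (a : ℤ) :
    algebraMap (LaurentPolynomial ℤ) (RatFunc ℂ) (LaurentPolynomial.T a) = q ^ a := by
  change LaurentPolynomial.eval₂ _ _ _ = _
  rw [LaurentPolynomial.eval₂_T, Units.val_zpow_eq_zpow_val]
  rfl

lemma GradedBasis.clsq_eq [Fintype X] (h : IdemGraded 𝒜 I) (b : GradedBasis 𝒜 I P) : P.clsq =
    ∑ i, (q ^ b.a i : RatFunc ℂ) •
      (GrProj.ofIdem h.internal h.mul_mem (h.idem (b.x i)) (h.idem_mem (b.x i))).clsq := by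
  simp only [GrProj.clsq]
  rw [b.cls_eq h, TensorProduct.tmul_sum]
  refine Finset.sum_congr rfl fun i _ => ?_
  rw [← TensorProduct.smul_tmul, Algebra.smul_def, algebraMap_T, mul_one, TensorProduct.smul_tmul',
    smul_eq_mul, mul_one]

end Classes

/-! ### Linear forms on `K_0` from graded dimensions, and generators of `K_0`. -/

section Characters

variable {K : Type u} [Field K] {A : Type u} [Ring A] [Algebra K A] {𝒜 : ℤ → Submodule K A}

lemma comp_map {P Q : GrProj 𝒜} (b : P.carrier →ₗ[A] Q.carrier)
    (hb : ∀ d, ∀ m ∈ P.gr d, b m ∈ Q.gr d) (d : ℤ) (m : P.carrier) :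
    comp Q.internal d (b m) = b (comp P.internal d m) := by
  refine internal_induction P.internal ?_ ?_ ?_ m
  · intro e m hm
    by_cases h : e = d
    · subst h
      rw [comp_self _ hm, comp_self _ (hb _ _ hm)]
    · rw [comp_ne _ hm h, comp_ne _ (hb _ _ hm) h, map_zero]
  · simp
  · intro m m' h h'
    simp only [map_add, h, h']

variable {X : Type*} [Fintype X] {I : X → A} {G : X → X → RatFunc ℂ}

lemma IdemGraded.hasGrDim_isotypic (h : IdemGraded 𝒜 I)
    (hG : ∀ x y, HasGrDim (corner 𝒜 I x y) (G x y)) (P : GrProj 𝒜) (x : X) :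
    ∃ r, HasGrDim (P.isotypic I x) r :=
  let ⟨b⟩ := h.exists_gradedBasis P
  ⟨_, b.hasGrDim_isotypic h hG x⟩

/-- The graded dimension of `I_x P`. -/
def IdemGraded.dimIso (h : IdemGraded 𝒜 I) (hG : ∀ x y, HasGrDim (corner 𝒜 I x y) (G x y))
    (x : X) (P : GrProj 𝒜) : RatFunc ℂ := (h.hasGrDim_isotypic hG P x).choose

lemma IdemGraded.dimIso_spec (h : IdemGraded 𝒜 I)
    (hG : ∀ x y, HasGrDim (corner 𝒜 I x y) (G x y)) (x : X) (P : GrProj 𝒜) :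
    HasGrDim (P.isotypic I x) (h.dimIso hG x P) := (h.hasGrDim_isotypic hG P x).choose_spec

/-- Passing to `I_x P` in a fixed degree is exact: multiplication by the idempotent and projection
to a degree commute with homogeneous maps, so preimages can be corrected to lie in the same piece.
-/
lemma IdemGraded.dimIso_eq_add (h : IdemGraded 𝒜 I)
    (hG : ∀ x y, HasGrDim (corner 𝒜 I x y) (G x y)) (x : X) {P' P P'' : GrProj 𝒜}
    (a : P'.carrier →ₗ[A] P.carrier) (b : P.carrier →ₗ[A] P''.carrier)
    (ha : ∀ d, ∀ m ∈ P'.gr d, a m ∈ P.gr d) (hb : ∀ d, ∀ m ∈ P.gr d, b m ∈ P''.gr d)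
    (h1 : Function.Injective a) (h2 : Function.Exact a b) (h3 : Function.Surjective b) :
    h.dimIso hG x P = h.dimIso hG x P' + h.dimIso hG x P'' := by
  refine (h.dimIso_spec hG x P).add_of_exact (h.dimIso_spec hG x P') (h.dimIso_spec hG x P'')
    (fun d => (a.restrictScalars K).restrict (p := P'.isotypic I x d) (q := P.isotypic I x d)
      fun m (hm : m ∈ P'.isotypic I x d) => ⟨ha d m hm.1, ?_⟩)
    (fun d => (b.restrictScalars K).restrict (p := P.isotypic I x d) (q := P''.isotypic I x d)
      fun m (hm : m ∈ P.isotypic I x d) => ⟨hb d m hm.1, ?_⟩) ?_ ?_ ?_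
  · change I x • a m = a m
    rw [← map_smul, hm.2]
  · change I x • b m = b m
    rw [← map_smul, hm.2]
  · intro d m m' e
    exact Subtype.ext (h1 (congrArg Subtype.val e))
  · intro d m
    constructor
    · intro e
      have e' : b m.1 = 0 := congrArg Subtype.val e
      obtain ⟨m', hm'⟩ := (h2 m.1).1 e'
      refine ⟨⟨m', ?_, h1 ?_⟩, Subtype.ext hm'⟩
      · have : comp P'.internal d m' = m' := h1 (by
          rw [← comp_map a ha, hm', comp_self _ m.2.1])
        rw [← this]
        exact comp_mem _ _ _
      · rw [map_smul, hm', m.2.2]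
    · rintro ⟨m', rfl⟩
      exact Subtype.ext ((h2 _).2 ⟨m'.1, rfl⟩)
  · intro d m
    obtain ⟨p, hp⟩ := h3 m.1
    refine ⟨⟨I x • comp P.internal d p, ?_, ?_⟩, Subtype.ext ?_⟩
    · have := P.smul_mem (h.idem_mem x) (comp_mem P.internal d p)
      rwa [zero_add] at this
    · rw [smul_smul, h.idem]
    · change b (I x • comp P.internal d p) = m.1
      rw [map_smul, ← comp_map b hb, hp, comp_self _ m.2.1, m.2.2]

lemma IdemGraded.dimIso_shift (h : IdemGraded 𝒜 I)
    (hG : ∀ x y, HasGrDim (corner 𝒜 I x y) (G x y)) (x : X) (P : GrProj 𝒜) (a : ℤ) :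
    h.dimIso hG x (P.shift a) = q ^ a * h.dimIso hG x P :=
  (h.dimIso_spec hG x (P.shift a)).unique ((h.dimIso_spec hG x P).shift a)

lemma K0_addHom_ext {M : Type*} [AddCommGroup M] {f g : K0 𝒜 →+ M}
    (h : ∀ P : GrProj 𝒜, f P.cls = g P.cls) : f = g :=
  QuotientAddGroup.addMonoidHom_ext _ (FreeAbelianGroup.lift_ext _ _ h)

/-- The powers of `q` span the Laurent polynomials over `ℤ`, so for an additive map compatibility
with shifts is enough. -/
lemma laurent_map_smul {M N : Type*} [AddCommGroup M] [AddCommGroup N]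
    [Module (LaurentPolynomial ℤ) M] [Module (LaurentPolynomial ℤ) N] (f : M →+ N)
    (hf : ∀ (i : ℤ) m, f ((LaurentPolynomial.T i : LaurentPolynomial ℤ) • m) =
      (LaurentPolynomial.T i : LaurentPolynomial ℤ) • f m) (p : LaurentPolynomial ℤ) (m : M) :
    f (p • m) = p • f m := by
  induction p using LaurentPolynomial.induction_on' with
  | add p p' h h' => rw [add_smul, map_add, h, h', add_smul]
  | C_mul_T n a =>
    have : (LaurentPolynomial.C a * LaurentPolynomial.T n : LaurentPolynomial ℤ) =
        a • LaurentPolynomial.T n := by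
      rw [zsmul_eq_mul]; simp
    rw [this, smul_assoc, smul_assoc, map_zsmul, hf]

/-- The map on the Grothendieck group given by the graded dimension of `I_x P`. -/
def IdemGraded.chr (h : IdemGraded 𝒜 I) (hG : ∀ x y, HasGrDim (corner 𝒜 I x y) (G x y))
    (x : X) : K0 𝒜 →+ RatFunc ℂ :=
  QuotientAddGroup.lift _ (FreeAbelianGroup.lift (h.dimIso hG x)) (by
    rw [AddSubgroup.closure_le]
    rintro _ ⟨P', P, P'', a, b, ha, hb, h1, h2, h3, rfl⟩
    change FreeAbelianGroup.lift (h.dimIso hG x) _ = 0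
    rw [map_sub, map_sub, FreeAbelianGroup.lift_apply_of, FreeAbelianGroup.lift_apply_of,
      FreeAbelianGroup.lift_apply_of, h.dimIso_eq_add hG x a b ha hb h1 h2 h3]
    ring)

lemma IdemGraded.chr_cls (h : IdemGraded 𝒜 I) (hG : ∀ x y, HasGrDim (corner 𝒜 I x y) (G x y))
    (x : X) (P : GrProj 𝒜) : h.chr hG x P.cls = h.dimIso hG x P :=
  FreeAbelianGroup.lift_apply_of _ _

lemma IdemGraded.chr_T_smul (h : IdemGraded 𝒜 I)
    (hG : ∀ x y, HasGrDim (corner 𝒜 I x y) (G x y)) (x : X) (i : ℤ) (κ : K0 𝒜) :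
    h.chr hG x ((LaurentPolynomial.T i : LaurentPolynomial ℤ) • κ) =
      (LaurentPolynomial.T i : LaurentPolynomial ℤ) • h.chr hG x κ := by
  have : (h.chr hG x).comp (DistribSMul.toAddMonoidHom (K0 𝒜)
      (LaurentPolynomial.T i : LaurentPolynomial ℤ)) =
      (DistribSMul.toAddMonoidHom (RatFunc ℂ) (LaurentPolynomial.T i : LaurentPolynomial ℤ)).comp
        (h.chr hG x) := by
    refine K0_addHom_ext fun P => ?_
    change h.chr hG x ((LaurentPolynomial.T i : LaurentPolynomial ℤ) • P.cls) =
      (LaurentPolynomial.T i : LaurentPolynomial ℤ) • h.chr hG x P.cls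
    rw [T_smul_cls, h.chr_cls, h.chr_cls, h.dimIso_shift, Algebra.smul_def, algebraMap_T]
  exact DFunLike.congr_fun this κ

/-- The graded dimension of `I_x P` as a `ℤ[q, q⁻¹]`-linear map. -/
def IdemGraded.chrLin (h : IdemGraded 𝒜 I) (hG : ∀ x y, HasGrDim (corner 𝒜 I x y) (G x y))
    (x : X) : K0 𝒜 →ₗ[LaurentPolynomial ℤ] RatFunc ℂ :=
  { h.chr hG x with map_smul' := laurent_map_smul _ (h.chr_T_smul hG x) }

/-- The `ℂ(q)`-linear extension of the graded dimension of `I_x P`. -/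
def IdemGraded.chrq (h : IdemGraded 𝒜 I) (hG : ∀ x y, HasGrDim (corner 𝒜 I x y) (G x y))
    (x : X) : K0q 𝒜 →ₗ[RatFunc ℂ] RatFunc ℂ :=
  LinearMap.liftBaseChange (RatFunc ℂ) (h.chrLin hG x)

/-- The basis of `A e` that consists of `e`. -/
def IdemGraded.basisOfIdem (h : IdemGraded 𝒜 I) (y : X) :
    GradedBasis 𝒜 I (GrProj.ofIdem h.internal h.mul_mem (h.idem y) (h.idem_mem y)) where
  ι := PUnit
  x _ := y
  a _ := 0
  m _ := (⟨I y, Submodule.mem_span_singleton_self _⟩ : Submodule.span A {I y})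
  c _ := (Submodule.span A {I y}).subtype
  m_mem _ := h.idem_mem y
  idem_smul _ := Subtype.ext (h.idem y)
  c_mem := fun _ {d p} hp => by rw [sub_zero]; exact hp
  c_mul := by
    rintro _ ⟨p, hp⟩
    obtain ⟨a, rfl⟩ := Submodule.mem_span_singleton.1 hp
    change a • I y * I y = a • I y
    rw [smul_mul_assoc, h.idem]
  c_self _ := rfl
  c_ne i j hij := absurd rfl hij
  sum_smul := by
    rintro ⟨p, hp⟩
    obtain ⟨a, rfl⟩ := Submodule.mem_span_singleton.1 hp
    rw [Fintype.sum_unique]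
    refine Subtype.ext ?_
    change (a • I y) * I y = a • I y
    rw [smul_mul_assoc, h.idem]

lemma IdemGraded.chrq_ofIdem (h : IdemGraded 𝒜 I)
    (hG : ∀ x y, HasGrDim (corner 𝒜 I x y) (G x y)) (x y : X) :
    h.chrq hG x (GrProj.ofIdem h.internal h.mul_mem (h.idem y) (h.idem_mem y)).clsq = G x y := by
  rw [chrq, GrProj.clsq, LinearMap.liftBaseChange_tmul, one_smul]
  refine (h.chr_cls hG x _).trans ?_
  refine (h.dimIso_spec hG x _).unique ?_
  have : HasGrDim _ (∑ _i : PUnit.{u + 1}, q ^ (0 : ℤ) * G x y) :=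
    (h.basisOfIdem y).hasGrDim_isotypic h hG x
  rwa [Fintype.sum_unique, zpow_zero, one_mul] at this

/-- Every class of a module is a combination of these by `clsq_eq`, since every module has a
homogeneous basis, and such classes generate the tensor product. -/
lemma IdemGraded.span_clsq (h : IdemGraded 𝒜 I) :
    ⊤ ≤ Submodule.span (RatFunc ℂ) (Set.range fun y =>
      (GrProj.ofIdem h.internal h.mul_mem (h.idem y) (h.idem_mem y)).clsq) := by
  rintro ξ -
  induction ξ using TensorProduct.induction_on with
  | zero => exact zero_mem _
  | add ξ ξ' hξ hξ' => exact add_mem hξ hξ'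
  | tmul r κ =>
    have hr : r ⊗ₜ[LaurentPolynomial ℤ] κ = r • ((1 : RatFunc ℂ) ⊗ₜ[LaurentPolynomial ℤ] κ) := by
      rw [TensorProduct.smul_tmul', smul_eq_mul, mul_one]
    rw [hr]
    clear hr
    refine Submodule.smul_mem _ _ ?_
    let φ : FreeAbelianGroup (GrProj 𝒜) →+ K0 𝒜 := QuotientAddGroup.mk' _
    obtain ⟨κ, rfl⟩ : ∃ κ', φ κ' = κ := QuotientAddGroup.mk_surjective κ
    have hof : ∀ P, (1 : RatFunc ℂ) ⊗ₜ[LaurentPolynomial ℤ] φ (FreeAbelianGroup.of P) ∈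
        Submodule.span (RatFunc ℂ) (Set.range fun y =>
          (GrProj.ofIdem h.internal h.mul_mem (h.idem y) (h.idem_mem y)).clsq) := by
      intro P
      obtain ⟨b⟩ := h.exists_gradedBasis P
      change P.clsq ∈ _
      rw [b.clsq_eq h]
      exact sum_mem fun i _ => Submodule.smul_mem _ _ (Submodule.subset_span ⟨b.x i, rfl⟩)
    induction κ using FreeAbelianGroup.induction_on with
    | zero => rw [map_zero, TensorProduct.tmul_zero]; exact zero_mem _
    | of P => exact hof P
    | neg P =>
      rw [map_neg, TensorProduct.tmul_neg]
      exact neg_mem (hof P)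
    | add κ κ' hκ hκ' =>
      rw [map_add, TensorProduct.tmul_add]
      exact add_mem hκ hκ'

end Characters

/-! ### The algebra `B_l(n, k)` satisfies the formal hypotheses. -/

section StrandAlgebra

variable (K : Type u) [Field K] {n k : ℕ}

lemma grB_eq_zero_of_neg {d : ℤ} {b : B K n k} (hb : b ∈ grB K n k d) (hd : d < 0) : b = 0 := by
  have hbot : grB K n k d = ⊥ := by
    rw [grB, Submodule.span_eq_bot]
    rintro _ ⟨m, x, y, h, -⟩
    omega
  rw [hbot] at hb
  exact hb

lemma eq_of_deg_eq_zero {x y : IState n k} (h : x.deg y = 0) : x = y := by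
  rw [← IState.dist_eq_deg, IState.dist, Finset.sum_eq_zero_iff] at h
  refine IState.ext_elt fun i => ?_
  have := h i (Finset.mem_univ i)
  omega

/-- A spanning element `U^m f_{y,z}` of degree zero has `m = 0` and `y = z`, since the degree of an
arrow is the distance of its ends; so the degree zero part is spanned by idempotents. -/
lemma mul_idem_of_mem_grB_zero {b : B K n k} (hb : b ∈ grB K n k 0) (x : IState n k) :
    ∃ c : K, b * f K x x = c • f K x x := by
  induction hb using Submodule.span_induction with
  | mem b hb =>
    obtain ⟨m, y, z, hd, rfl⟩ := hb
    have hd' : 2 * ∑ i, m i + y.deg z = 0 := by exact_mod_cast hd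
    have hyz : y = z := eq_of_deg_eq_zero (by omega)
    have hm : m = 0 := by
      have : ∑ i, m i = 0 := by omega
      rw [Finset.sum_eq_zero_iff] at this
      funext i
      exact this i (Finset.mem_univ i)
    subst hyz
    have h1 : Umon K (0 : Fin n → ℕ) = 1 := by simp [Umon]
    rw [hm, h1, one_smul]
    by_cases e : y = x
    · subst e
      exact ⟨1, by rw [f_idem, one_smul]⟩
    · exact ⟨0, by rw [f_not_comp _ _ _ _ e, zero_smul]⟩
  | zero => exact ⟨0, by rw [zero_mul, zero_smul]⟩
  | add b b' _ _ h h' =>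
    obtain ⟨c, hc⟩ := h
    obtain ⟨c', hc'⟩ := h'
    exact ⟨c + c', by rw [add_mul, hc, hc', add_smul]⟩
  | smul r b _ h =>
    obtain ⟨c, hc⟩ := h
    exact ⟨r * c, by rw [smul_mul_assoc, hc, smul_smul]⟩

lemma psiB_smul (c : K) (b : B K n k) : (psiB K n k (c • b)).unop = c • (psiB K n k b).unop := by
  have h : ∀ b : B K n k, c • b = (MvPolynomial.C c : URing K n) • b := fun b => by
    rw [← MvPolynomial.algebraMap_eq, algebraMap_smul]
  rw [h, h, map_smul, MulOpposite.unop_smul]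

lemma psiB_mem {d : ℤ} {b : B K n k} (hb : b ∈ grB K n k d) :
    (psiB K n k b).unop ∈ grB K n k d := by
  induction hb using Submodule.span_induction with
  | mem b hb =>
    obtain ⟨m, x, y, hd, rfl⟩ := hb
    rw [map_smul, psiB_f, MulOpposite.unop_smul, MulOpposite.unop_op]
    refine Submodule.subset_span ⟨m, y, x, ?_, rfl⟩
    rw [← hd, IState.deg, IState.deg]
    congr 2
    refine Finset.sum_congr rfl fun i _ => ?_
    unfold IState.twoW
    omega
  | zero => rw [map_zero]; exact zero_mem _
  | add b b' _ _ h h' => rw [map_add]; exact add_mem h h'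
  | smul c b _ h => rw [psiB_smul]; exact Submodule.smul_mem _ _ h

lemma psiB_psiB (b : B K n k) : (psiB K n k (psiB K n k b).unop).unop = b := by
  refine internal_induction (grB_internal (K := K)) ?_ ?_ ?_ b
  · intro d b hb
    induction hb using Submodule.span_induction with
    | mem b hb =>
      obtain ⟨m, x, y, hd, rfl⟩ := hb
      rw [map_smul, psiB_f, MulOpposite.unop_smul, MulOpposite.unop_op, map_smul, psiB_f,
        MulOpposite.unop_smul, MulOpposite.unop_op]
    | zero => simp
    | add b b' _ _ h h' => simp only [map_add, MulOpposite.unop_add, h, h']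
    | smul c b _ h => rw [psiB_smul, psiB_smul, h]
  · simp
  · intro b b' h h'
    simp only [map_add, MulOpposite.unop_add, h, h']

theorem idemGraded_Bl : IdemGraded (grBl K n k) (Il K) where
  internal := grBl_internal K n k
  mul_mem := grBl_mul K
  eq_zero_of_neg := fun ha hd => inclBl_injective K (grB_eq_zero_of_neg K ha hd)
  idem_mem := Il_mem K
  idem := Il_idem K
  sum_idem := by
    apply inclBl_injective K
    rw [map_sum, inclBl_one]
    rfl
  mul_idem := fun {a} ha x => by
    obtain ⟨c, hc⟩ := mul_idem_of_mem_grB_zero K (b := inclBl K n k a) ha x.1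
    exact ⟨c, inclBl_injective K hc⟩

theorem antiInvolution_psiBl : AntiInvolution (grBl K n k) (Il K) (psiBl K n k) where
  invol := fun a => inclBl_injective K (psiB_psiB K (inclBl K n k a))
  idem := fun x => inclBl_injective K (congrArg MulOpposite.unop (psiB_f x.1 x.1))
  mem := fun {_ a} ha => psiB_mem K (b := inclBl K n k a) ha

end StrandAlgebra

/-! ### The isomorphism `Φ` and the Hom pairing. -/

section Identification

variable (K : Type u) [Field K] (n k : ℕ)

lemma hasGrDim_corner (x y : LeftIState n k) :
    HasGrDim (corner (grBl K n k) (Il K) x y) (gram x y) := hasGrDim_gram K x y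

/-- The graded dimension of `I_x P` as a linear form on the Grothendieck group. -/
def isoDim (x : LeftIState n k) : K0q (grBl K n k) →ₗ[RatFunc ℂ] RatFunc ℂ :=
  (idemGraded_Bl K).chrq (hasGrDim_corner K n k) x

lemma isoDim_projP (x y : LeftIState n k) : isoDim K n k x (projP K y).clsq = gram x y :=
  (idemGraded_Bl K).chrq_ofIdem (hasGrDim_corner K n k) x y

/-- A linear relation among the `v_y`, tested with the forms `χ_x`, says that the same combination
of the basis vectors `w_y` is orthogonal to every `w_x`, hence zero. This transports independence
from the weight space to the Grothendieck group. -/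
lemma linearIndependent_of_gram {F V W ι : Type*} [Field F] [AddCommGroup V] [Module F V]
    [AddCommMonoid W] [Module F W] [Fintype ι] {v : ι → V} (w : Module.Basis ι F W)
    (B : LinearMap.BilinForm F W) (hB : ∀ u, (∀ x, B (w x) u = 0) → u = 0) (χ : ι → V →ₗ[F] F)
    (hχ : ∀ x y, χ x (v y) = B (w x) (w y)) : LinearIndependent F v := by
  rw [Fintype.linearIndependent_iff]
  intro g hg i
  have hw : w.equivFun.symm g = 0 := hB _ fun x => by
    have := congrArg (χ x) hg
    simpa only [Module.Basis.equivFun_symm_apply, map_sum, map_smul, map_zero, hχ] using this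
  rw [LinearEquiv.map_eq_zero_iff] at hw
  rw [hw, Pi.zero_apply]

lemma linearIndependent_clsq :
    LinearIndependent (RatFunc ℂ) fun x : LeftIState n k => (projP K x).clsq :=
  linearIndependent_of_gram (canB n k) (ozForm n k)
    (fun _ h => ozForm_nondegenerate h) (isoDim K n k) (isoDim_projP K n k)

lemma span_projP : ⊤ ≤ Submodule.span (RatFunc ℂ)
    (Set.range fun x : LeftIState n k => (projP K x).clsq) :=
  (idemGraded_Bl K).span_clsq

/-- The classes `[P(x)]` form a basis of the Grothendieck group. -/
def projBasis : Module.Basis (LeftIState n k) (RatFunc ℂ) (K0q (grBl K n k)) :=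
  Module.Basis.mk (linearIndependent_clsq K n k) (span_projP K n k)

lemma projBasis_apply (x : LeftIState n k) : projBasis K n k x = (projP K x).clsq := by
  rw [projBasis, Module.Basis.mk_apply]

/-- The isomorphism that sends `[P(x)]` to the canonical basis vector of `x`. -/
def ident : K0q (grBl K n k) ≃ₗ[RatFunc ℂ] weightSpace n k :=
  (projBasis K n k).equiv (canB n k) (Equiv.refl _)

lemma ident_projP (x : LeftIState n k) : ident K n k (projP K x).clsq = canB n k x := by
  rw [← projBasis_apply, ident, Module.Basis.equiv_apply, Equiv.refl_apply]

lemma isIdentification_ident : IsIdentification K (ident K n k) := fun x => by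
  rw [ident_projP, canB_apply, canVec_eq]

variable {K n k} in
lemma IsIdentification.eq {Φ : K0q (grBl K n k) ≃ₗ[RatFunc ℂ] weightSpace n k}
    (h : IsIdentification K Φ) : Φ = ident K n k := by
  apply LinearEquiv.toLinearMap_injective
  refine (projBasis K n k).ext fun x => Subtype.ext ?_
  rw [projBasis_apply]
  exact (h x).trans (isIdentification_ident K n k x).symm

/-- The pull-back of the Ozsváth–Szabó form. -/
def pairing : LinearMap.BilinForm (RatFunc ℂ) (K0q (grBl K n k)) :=
  (ozForm n k).compl₁₂ (ident K n k).toLinearMap (ident K n k).toLinearMap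

lemma pairing_apply (ξ η : K0q (grBl K n k)) :
    pairing K n k ξ η = ozForm n k (ident K n k ξ) (ident K n k η) := rfl

lemma pairing_projP (x y : LeftIState n k) :
    pairing K n k (projP K x).clsq (projP K y).clsq = gram x y := by
  rw [pairing_apply, ident_projP, ident_projP]
  rfl

/-- With homogeneous bases of `P` and `P'`, both sides are the double sum of `q ^ (a_i + a'_j)`
times the Gram entry of the labels: the Hom space by `hasGrDim_hom`, the pairing by bilinearity and
`clsq_eq`. -/
lemma isHomPairing_pairing : IsHomPairing (grBl K n k) (psiBl K n k) (pairing K n k) := by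
  intro P P'
  obtain ⟨b⟩ := (idemGraded_Bl K).exists_gradedBasis P
  obtain ⟨b'⟩ := (idemGraded_Bl K).exists_gradedBasis P'
  have := b.hasGrDim_hom (idemGraded_Bl K) (antiInvolution_psiBl K) b' (hasGrDim_corner K n k)
  convert this using 1
  rw [b.clsq_eq (idemGraded_Bl K), b'.clsq_eq (idemGraded_Bl K)]
  simp only [map_sum, map_smul, LinearMap.sum_apply, LinearMap.smul_apply, smul_eq_mul,
    Finset.mul_sum]
  rw [Finset.sum_comm]
  refine Finset.sum_congr rfl fun i _ => Finset.sum_congr rfl fun j _ => ?_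
  have e := pairing_projP K n k (b.x i) (b'.x j)
  rw [← e, ← mul_assoc, ← mul_assoc, mul_comm (q ^ b.a i)]
  rfl

variable {K n k} in
-- A bilinear form is determined on the basis of the `[P(x)]`, and a rational function by its
-- Laurent expansion.
lemma IsHomPairing.eq {β : LinearMap.BilinForm (RatFunc ℂ) (K0q (grBl K n k))}
    (h : IsHomPairing (grBl K n k) (psiBl K n k) β) : β = pairing K n k := by
  refine (projBasis K n k).ext fun x => (projBasis K n k).ext fun y => ?_
  rw [projBasis_apply, projBasis_apply]
  exact (h _ _).unique (isHomPairing_pairing K n k _ _)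

lemma sartoriForm_eq : sartoriForm n k = (qFact k * (1 - q ^ 2) ^ k) • ozForm n k := by
  rw [sartoriForm, ozForm, smul_smul, mul_assoc,
    mul_inv_cancel₀ (pow_ne_zero _ one_sub_q_sq_ne_zero), mul_one]

end Identification

end OSz

end

theorem mainTheorem7 {𝕜 : Type*} [Field 𝕜] (n k : ℕ) (hk : k ≤ n) :
    -- the graded dimension of `I_x B_l(n, k) I_y`
    (∀ x y : OSz.LeftIState n k,
      (x.1.TooFar y.1 → OSz.HasGrDim (OSz.cornerGr 𝕜 x y) 0) ∧
      (¬ x.1.TooFar y.1 →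
        (x.1.genIntervals y.1).card = n - k ∧
        OSz.HasGrDim (OSz.cornerGr 𝕜 x y)
          (OSz.q ^ x.1.dist y.1 *
            ((∏ G ∈ x.1.genIntervals y.1, OSz.qNum G.2) / (1 - OSz.q ^ 2) ^ k)))) ∧
    -- the Hom pairing and the identification with the weight space are well defined
    (∃! β : LinearMap.BilinForm (RatFunc ℂ) (OSz.K0q (OSz.grBl 𝕜 n k)),
      OSz.IsHomPairing (OSz.grBl 𝕜 n k) (OSz.psiBl 𝕜 n k) β) ∧
    (∃! Φ : OSz.K0q (OSz.grBl 𝕜 n k) ≃ₗ[RatFunc ℂ] OSz.weightSpace n k,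
      OSz.IsIdentification 𝕜 Φ) ∧
    -- the identification takes the Hom pairing to the Ozsváth–Szabó form
    (∀ (β : LinearMap.BilinForm (RatFunc ℂ) (OSz.K0q (OSz.grBl 𝕜 n k)))
      (Φ : OSz.K0q (OSz.grBl 𝕜 n k) ≃ₗ[RatFunc ℂ] OSz.weightSpace n k),
      OSz.IsHomPairing (OSz.grBl 𝕜 n k) (OSz.psiBl 𝕜 n k) β → OSz.IsIdentification 𝕜 Φ →
      ∀ ξ η,
        β ξ η = OSz.ozForm n k (Φ ξ) (Φ η) ∧
        OSz.sartoriForm n k (Φ ξ) (Φ η) =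
          OSz.qFact k * (1 - OSz.q ^ 2) ^ k * β ξ η) ∧
    OSz.sartoriForm n k = (OSz.qFact k * (1 - OSz.q ^ 2) ^ k) • OSz.ozForm n k := by
  refine ⟨fun x y => ⟨fun h => OSz.hasGrDim_cornerGr_tooFar h, fun h =>
    ⟨OSz.IState.card_genIntervals x.2 h, OSz.hasGrDim_cornerGr h⟩⟩,
    ⟨OSz.pairing 𝕜 n k, OSz.isHomPairing_pairing 𝕜 n k, fun β hβ => hβ.eq⟩,
    ⟨OSz.ident 𝕜 n k, OSz.isIdentification_ident 𝕜 n k, fun Φ hΦ => hΦ.eq⟩,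
    fun β Φ hβ hΦ ξ η => ?_, OSz.sartoriForm_eq n k⟩
  rw [hβ.eq, hΦ.eq, OSz.pairing_apply]
  refine ⟨rfl, ?_⟩
  rw [OSz.sartoriForm_eq]
  rfl
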